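/- Let $p$ be a prime, let $F$ be a field of characteristic $p$, and let $W$ be a finite-dimensional representation over $F$ of the cyclic group $\mathbf{Z}/p$ of order $p$. Let $F[W]:=S(W^*)$ be the symmetric algebra of the dual of $W$, with the induced action of $\mathbf{Z}/p$ by degree-preserving algebra automorphisms, and let $F[W]^{\mathbf{Z}/p}$ be the ring of invariants. The Noether number $\beta(W)$ is the least integer $d$ such that the $F$-algebra $F[W]^{\mathbf{Z}/p}$ is generated by homogeneous elements of degree at most $d$. For $1\le n\le p$ let $V_n$ denote the indecomposable $n$-dimensional representation of $\mathbf{Z}/p$ in which a fixed generator acts by a single $n\times n$ Jordan block with eigenvalue $1$. Let $W^{\mathbf{Z}/p}$ be the space of fixed points in $W$. Suppose that $W$ is reduced, i.e. $W$ has no non-zero direct summand on which $\mathbf{Z}/p$ acts trivially. (a) If $W$ has a direct summand isomorphic to $V_n$ for some $n$ with $3<n\le p$, then $$\beta(W)=(p-1)\dim(W^{\mathbf{Z}/p})+p-2.$$ (b) If $p\ge 3$ and $W$ is isomorphic to $mV_2\oplus \ell V_3$, the direct sum of $m\ge 0$ copies of $V_2$ and $\ell>0$ copies of $V_3$, then $$\beta(W)=(p-1)\dim(W^{\mathbf{Z}/p})+1.$$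 -/

import Mathlib

noncomputable section

namespace CyclicInvariants

/-! ### The ring of invariants and the Noether number -/

section Noether

variable {F G V : Type*} [Field F] [Group G] [AddCommGroup V] [Module F V]

/-- The coordinate ring `F[V] = S(V*)`: the symmetric algebra of the dual of `V`. -/
abbrev CoordRing (F V : Type*) [Field F] [AddCommGroup V] [Module F V] : Type _ :=
  SymmetricAlgebra F (Module.Dual F V)

/-- The action of `g` on `F[V]`: the algebra endomorphism of `S(V*)` that extends the action of
`g` on the dual representation `V*`. -/
def coordAction (ρ : Representation F G V) (g : G) : CoordRing F V →ₐ[F] CoordRing F V :=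
  SymmetricAlgebra.lift (SymmetricAlgebra.ι F (Module.Dual F V) ∘ₗ ρ.dual g)

/-- The ring of invariants `F[V]^G`. -/
def invariantRing (ρ : Representation F G V) : Subalgebra F (CoordRing F V) where
  carrier := {f | ∀ g : G, coordAction ρ g f = f}
  mul_mem' := by
    intro a b ha hb g
    rw [map_mul, ha g, hb g]
  add_mem' := by
    intro a b ha hb g
    rw [map_add, ha g, hb g]
  algebraMap_mem' := by
    intro r g
    exact AlgHom.commutes _ r

/-- The homogeneous component of degree `n` of `F[V]`: the span of all products of `n` linear
forms. -/
def homogeneousPart (F V : Type*) [Field F] [AddCommGroup V] [Module F V] (n : ℕ) :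
    Submodule F (CoordRing F V) :=
  LinearMap.range (SymmetricAlgebra.ι F (Module.Dual F V)) ^ n

/-- `F[V]^G` is generated, as an `F`-algebra, by homogeneous elements of degree at most `d`. -/
def GeneratedInDegreeLE (ρ : Representation F G V) (d : ℕ) : Prop :=
  ∃ S : Set (CoordRing F V),
    (∀ f ∈ S, ∃ n ≤ d, f ∈ homogeneousPart F V n) ∧ Algebra.adjoin F S = invariantRing ρ

/-- `β(V) = d`: the number `d` is the least one such that `F[V]^G` is generated by homogeneous
elements of degree at most `d`. -/
def IsNoetherNumber (ρ : Representation F G V) (d : ℕ) : Prop :=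
  IsLeast {e : ℕ | GeneratedInDegreeLE ρ e} d

end Noether

/-! ### Direct summands -/

section Summands

variable {F G V W : Type*} [Field F] [Group G] [AddCommGroup V] [Module F V]
  [AddCommGroup W] [Module F W]

/-- A representation is reduced if it has no trivial summand: every direct summand on which the
group acts trivially is zero. -/
def IsReduced (ρ : Representation F G W) : Prop :=
  ∀ U U' : Subrepresentation ρ, IsCompl U U' → U.toRepresentation.IsTrivial → U = ⊥

/-- `ρ` has a direct summand isomorphic to `τ`. -/
def HasSummand (ρ : Representation F G W) (τ : Representation F G V) : Prop :=
  ∃ U U' : Subrepresentation ρ, IsCompl U U' ∧ Nonempty (U.toRepresentation.Equiv τ)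

end Summands

/-! ### The indecomposable representations `V_n` of `Z/p` -/

section Indecomposable

variable (F : Type*) [Field F]

/-- The `n × n` Jordan block with eigenvalue `1`. -/
def jordanBlock (n : ℕ) : Matrix (Fin n) (Fin n) F :=
  Matrix.of fun i j => if (j : ℕ) = i ∨ (j : ℕ) = i + 1 then 1 else 0

theorem jordanBlock_sub_one_pow (n : ℕ) : (jordanBlock F n - 1) ^ n = 0 := by
  have htri : (jordanBlock F n).BlockTriangular id := by
    intro i j hij
    have hij' : (j : ℕ) < i := hij
    simp only [jordanBlock, Matrix.of_apply]
    rw [if_neg (by omega)]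
  have hch : (jordanBlock F n).charpoly = (Polynomial.X - 1) ^ n := by
    rw [Matrix.charpoly_of_isUpperTriangular _ htri]
    simp [jordanBlock]
  have h := Matrix.aeval_self_charpoly (jordanBlock F n)
  rw [hch] at h
  simpa using h

variable (p : ℕ) [hp : Fact p.Prime] [CharP F p]

theorem jordanBlock_pow_char {n : ℕ} (hn : n ≤ p) : jordanBlock F n ^ p = 1 := by
  rcases Nat.eq_zero_or_pos n with rfl | hpos
  · exact Subsingleton.elim _ _
  · have : Nonempty (Fin n) := ⟨⟨0, hpos⟩⟩
    have : CharP (Matrix (Fin n) (Fin n) F) p := inferInstance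
    have h : (jordanBlock F n - 1) ^ p = 0 := pow_eq_zero_of_le hn (jordanBlock_sub_one_pow F n)
    rw [sub_pow_char_of_commute (p := p) (Commute.one_right (jordanBlock F n)), one_pow] at h
    exact sub_eq_zero.mp h

/-- For `n ≤ p`, the representation `V_n` of `Z/p` over a field of characteristic `p`: the
generator `1` of `Z/p` acts on `F^n` by the `n × n` Jordan block with eigenvalue `1`. -/
def jordanRep (n : ℕ) (hn : n ≤ p) :
    Representation F (Multiplicative (ZMod p)) (Fin n → F) where
  toFun g := Matrix.toLin' (jordanBlock F n ^ (Multiplicative.toAdd g).val)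
  map_one' := by
    simp [Module.End.one_eq_id]
  map_mul' := by
    intro g h
    rw [Module.End.mul_eq_comp, ← Matrix.toLin'_mul, ← pow_add, toAdd_mul, ZMod.val_add,
      ← pow_eq_pow_mod _ (jordanBlock_pow_char F p hn)]

end Indecomposable

end CyclicInvariants

end

/-!
A Jordan basis of the dual of `W` turns `F[W]` into a polynomial ring on `k` blocks of variables, and
the generator `σ` of `Z/p` into the automorphism `jordanAut F 0` that adds to each variable the one
below it in its block. Here `k` is the dimension of the fixed space, and no block consists of a
single variable because `W` is reduced. Write `Δ = σ - 1`; in characteristic `p`, the transfer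
`1 + σ + ⋯ + σ ^ (p - 1)` is `Δ ^ (p - 1)`.

*Upper bound.* The norm of the top variable of a block is an invariant of degree `p`, monic in that
variable. Dividing by these norms (`exists_sum_blockNorm_mul_add`) leaves invariants that are reduced,
of degree less than `p` in each top variable. In degrees above `(p - 1) k` the reduced polynomials are
free over `F[Z/p]`, so reduced invariants are transfers of reduced polynomials
(`exists_transfer_of_fixed`). A reduced monomial of degree at least `(p - 1) k + t` contains `t`
factors that are not top variables. For `t = p - 1` their product lies in the Hilbert ideal, the
ideal generated by the invariants of positive degree, since it is a product of differences
(`prod_diffOp_mem`); if all blocks have at most three variables, `t = 2` is enough. Finally, the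
transfer of an element of the Hilbert ideal is decomposable (`transfer_mem_lowInv`). Hence invariants
of degree `(p - 1) k + t` or more are decomposable (`fixed_mem_lowInv`).

*Lower bound.* Give the variables of a block of `q + 1` variables the weights `q, q - 2, …, -q`, from
bottom to top. The leading term of `Δ` is then the derivation `lowDer`, which acts as a nilpotent
operator of a representation of `sl₂`. On a multigraded piece whose degree in each block is less than
`p`, it behaves as on a sum of strings that are symmetric around weight zero or of full length `p`
(`balanced_wtHom`). So an invariant has, up to a transfer, no terms of negative weight
(`exists_sub_transfer_mem_wtGe`); as the weights of a transfer are bounded below, monomials of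
sufficiently low weight do not occur in invariants (`coeff_eq_zero_of_wt_neg`). In weight zero, small
odd powers of the middle variable of a block of three variables do not occur either
(`coeff_eq_zero_of_odd`). Now let `x` be the variable below the top of a block of at least three
variables, and let `y` run over the top variables of the other blocks. The monomial
`x ^ (ε + p - 1) * ∏ y ^ (p - 1)`, of degree `(p - 1) k + ε`, occurs in a transfer
(`coeff_transfer_extremalMon`). Suppose that it is a product of two non-constant monomials occurring in
invariants. The variables `y` have negative weight, and `x` has weight `2 - q`, which is negative if
its block has at least four variables; in this case take `ε = p - 2`, so that one factor has degree
less than `p - 1` in `x` and is excluded by its weight. If the block has three variables and `ε = 1`,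
then one of the exponents of `x` is odd, as their sum is `p`, and parity excludes what the weight does
not. So this transfer is not a polynomial in invariants of lower degree
(`exists_fixed_notMem_lowInv_of_three_le`, `exists_fixed_notMem_lowInv_of_eq_two`).
-/

noncomputable section

namespace CyclicInvariants

/-! ### The difference operator and the transfer -/

section CyclicOperator

/-- In characteristic `p`, the operator `(T - 1) ^ (p - 1)` is the transfer
`1 + T + ⋯ + T ^ (p - 1)`. -/
theorem sub_one_pow_eq_geom_sum {F : Type*} [Field F] (p : ℕ) [Fact p.Prime] [CharP F p]
    {A : Type*} [Ring A] [Algebra F A] (T : A) :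
    (T - 1) ^ (p - 1) = ∑ j ∈ Finset.range p, T ^ j := by
  have hp : p - 1 + 1 = p := Nat.sub_add_cancel (Fact.out : p.Prime).one_le
  have h : ((Polynomial.X : Polynomial F) - 1) ^ (p - 1)
      = ∑ j ∈ Finset.range p, (Polynomial.X : Polynomial F) ^ j := by
    have hne : (Polynomial.X : Polynomial F) - 1 ≠ 0 := by
      simpa using Polynomial.X_sub_C_ne_zero (1 : F)
    apply mul_right_cancel₀ hne
    rw [geom_sum_mul, ← pow_succ, hp, sub_pow_char, one_pow]
  simpa using congrArg (Polynomial.aeval T) h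

/-- If `T ^ p = 0`, exactness of `T` and `T ^ (p - 1)` in one order follows from exactness in the
other order, by comparing dimensions. -/
theorem ker_pow_le_range {F : Type*} [Field F] (p : ℕ) {V : Type*} [AddCommGroup V] [Module F V]
    [FiniteDimensional F V]
    (hp : 1 ≤ p) (T : Module.End F V) (hT : T ^ p = 0)
    (h : LinearMap.ker T ≤ LinearMap.range (T ^ (p - 1))) :
    LinearMap.ker (T ^ (p - 1)) ≤ LinearMap.range T := by
  have hle : LinearMap.range T ≤ LinearMap.ker (T ^ (p - 1)) := by
    rintro _ ⟨v, rfl⟩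
    rw [LinearMap.mem_ker, ← Module.End.mul_apply, ← pow_succ, Nat.sub_add_cancel hp, hT,
      LinearMap.zero_apply]
  have h1 := LinearMap.finrank_range_add_finrank_ker T
  have h2 := LinearMap.finrank_range_add_finrank_ker (T ^ (p - 1))
  have h3 := Submodule.finrank_mono h
  exact (Submodule.eq_of_le_of_finrank_le hle (by omega)).ge

theorem sum_range_cast_pow {F : Type*} [Field F] (p : ℕ) [Fact p.Prime] [CharP F p] (a : ℕ) :
    ∑ j ∈ Finset.range p, (j : F) ^ a
      = ((∑ x : ZMod p, x ^ a : ZMod p).cast : F) := by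
  have h : ∑ x : ZMod p, x ^ a = ∑ j ∈ Finset.range p, (j : ZMod p) ^ a := by
    refine Finset.sum_bij' (fun x _ => x.val) (fun j _ => (j : ZMod p)) ?_ ?_ ?_ ?_ ?_
    · intro x _
      exact Finset.mem_range.mpr x.val_lt
    · simp
    · simp
    · intro j hj
      exact ZMod.val_cast_of_lt (Finset.mem_range.mp hj)
    · simp
  rw [h]
  have := map_sum (ZMod.castHom (dvd_refl p) F) (fun j : ℕ => (j : ZMod p) ^ a) (Finset.range p)
  simp only [map_pow, map_natCast] at this
  exact this.symm

theorem sum_range_cast_pow_of_lt {F : Type*} [Field F] (p : ℕ) [Fact p.Prime] [CharP F p] {a : ℕ}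
    (ha : a < p - 1) :
    ∑ j ∈ Finset.range p, (j : F) ^ a = 0 := by
  rw [sum_range_cast_pow, FiniteField.sum_pow_lt_card_sub_one (ZMod p) a (by simpa using ha)]
  simp

theorem sum_range_cast_pow_pred {F : Type*} [Field F] (p : ℕ) [Fact p.Prime] [CharP F p] :
    ∑ j ∈ Finset.range p, (j : F) ^ (p - 1) = -1 := by
  have hp : 0 < p - 1 := Nat.sub_pos_of_lt (Fact.out : p.Prime).one_lt
  have hp' : p - 1 + 1 = p := Nat.sub_add_cancel (Fact.out : p.Prime).one_le
  have h : ∑ j ∈ Finset.range p, (j : F) ^ (p - 1) = ∑ j ∈ Finset.range (p - 1), (1 : F) := by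
    have hs := Finset.sum_range_succ' (fun j : ℕ => (j : F) ^ (p - 1)) (p - 1)
    rw [hp'] at hs
    rw [hs, Nat.cast_zero, zero_pow hp.ne', add_zero]
    refine Finset.sum_congr rfl fun j hj => ?_
    have hj' : j + 1 < p := by have := Finset.mem_range.mp hj; omega
    have h0 : ((j + 1 : ℕ) : ZMod p) ≠ 0 := by
      rw [Ne, ZMod.natCast_eq_zero_iff]
      exact Nat.not_dvd_of_pos_of_lt (Nat.succ_pos j) hj'
    have := congrArg (ZMod.castHom (dvd_refl p) F) (ZMod.pow_card_sub_one_eq_one h0)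
    simpa only [map_pow, map_natCast, map_one] using this
  rw [h, Finset.sum_const, Finset.card_range, nsmul_eq_mul, mul_one,
    Nat.cast_sub (Fact.out : p.Prime).one_le, CharP.cast_eq_zero]
  simp

variable {F : Type*} [Field F] {R : Type*} [CommRing R] [Algebra F R]

/-- The difference operator `σ - 1` of an algebra endomorphism `σ`. -/
def diffOp (σ : R →ₐ[F] R) : Module.End F R := σ.toLinearMap - 1

theorem diffOp_apply (σ : R →ₐ[F] R) (f : R) : diffOp σ f = σ f - f := rfl

theorem diffOp_eq_zero_iff (σ : R →ₐ[F] R) (f : R) : diffOp σ f = 0 ↔ σ f = f := by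
  rw [diffOp_apply, sub_eq_zero]

theorem diffOp_mul_of_fixed {σ : R →ₐ[F] R} {f : R} (hf : σ f = f) (g : R) :
    diffOp σ (f * g) = f * diffOp σ g := by
  rw [diffOp_apply, map_mul, hf, diffOp_apply, mul_sub]

theorem diffOp_pow_mul_of_fixed {σ : R →ₐ[F] R} {f : R} (hf : σ f = f) (m : ℕ) (g : R) :
    (diffOp σ ^ m) (f * g) = f * (diffOp σ ^ m) g := by
  induction m generalizing g with
  | zero => rfl
  | succ m ih =>
    rw [pow_succ, Module.End.mul_apply, diffOp_mul_of_fixed hf, ih, Module.End.mul_apply]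

theorem toLinearMap_pow_apply (σ : R →ₐ[F] R) (j : ℕ) (f : R) :
    (σ.toLinearMap ^ j) f = (σ ^ j) f := by
  induction j generalizing f with
  | zero => rfl
  | succ j ih => rw [pow_succ, pow_succ, Module.End.mul_apply, ih]; rfl

theorem diffOp_pow_pred_apply (p : ℕ) [Fact p.Prime] [CharP F p] (σ : R →ₐ[F] R) (f : R) :
    (diffOp σ ^ (p - 1)) f = ∑ j ∈ Finset.range p, (σ ^ j) f := by
  rw [diffOp, sub_one_pow_eq_geom_sum (F := F) p σ.toLinearMap, LinearMap.sum_apply]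
  simp only [toLinearMap_pow_apply]

theorem pow_apply_of_diffOp_fixed {σ : R →ₐ[F] R} {x y : R} (hy : σ y = y + x) (hx : σ x = x)
    (j : ℕ) : (σ ^ j) y = y + (j : F) • x := by
  induction j with
  | zero => simp
  | succ j ih =>
    rw [pow_succ']
    change σ ((σ ^ j) y) = _
    rw [ih, map_add, map_smul, hy, hx]
    push_cast
    rw [add_smul, one_smul]
    ring

/-- The transfer of `y ^ (p - 1)`, when `y` lies at the top of a Jordan block of length two. -/
theorem transfer_pow_pred (p : ℕ) [Fact p.Prime] [CharP F p] {σ : R →ₐ[F] R} {x y : R}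
    (hy : σ y = y + x) (hx : σ x = x) :
    (diffOp σ ^ (p - 1)) (y ^ (p - 1)) = - x ^ (p - 1) := by
  have key : ∀ j : ℕ, (σ ^ j) (y ^ (p - 1)) = ∑ a ∈ Finset.range (p - 1 + 1),
      ((j : F) ^ a) • (x ^ a * y ^ (p - 1 - a) * ((p - 1).choose a : R)) := by
    intro j
    rw [map_pow, pow_apply_of_diffOp_fixed hy hx, add_comm, add_pow]
    refine Finset.sum_congr rfl fun a _ => ?_
    rw [smul_pow, smul_mul_assoc, smul_mul_assoc]
  rw [diffOp_pow_pred_apply p]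
  simp_rw [key]
  rw [Finset.sum_comm]
  simp_rw [← Finset.sum_smul]
  rw [Finset.sum_range_succ, sum_range_cast_pow_pred, Finset.sum_eq_zero]
  · simp
  · intro a ha
    rw [sum_range_cast_pow_of_lt p (Finset.mem_range.mp ha), zero_smul]

/-- The difference `σ ^ j u - u` agrees with `j • (σ u - u)` up to the difference of an element `w`
of smaller nilpotency index than `u`. -/
theorem exists_pow_sub_eq_diffOp (σ : R →ₐ[F] R) (L : Submodule F R)
    (hL : ∀ u ∈ L, σ u ∈ L) {u : R} (hu : u ∈ L) {a : ℕ} (ha : (diffOp σ ^ (a + 1)) u = 0)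
    (j : ℕ) : ∃ w ∈ L, (diffOp σ ^ a) w = 0 ∧
      (σ ^ j) u = u + diffOp σ ((j : F) • u + w) := by
  have hΔ : ∀ u ∈ L, diffOp σ u ∈ L := fun u hu => L.sub_mem (hL u hu) hu
  induction j with
  | zero => exact ⟨0, L.zero_mem, map_zero _, by simp⟩
  | succ j ih =>
    obtain ⟨w, hwL, hw0, hw⟩ := ih
    refine ⟨w + diffOp σ ((j : F) • u + w), L.add_mem hwL
      (hΔ _ (L.add_mem (L.smul_mem _ hu) hwL)), ?_, ?_⟩
    · have h1 : (diffOp σ ^ a) (diffOp σ u) = 0 := by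
        rw [← Module.End.mul_apply, ← pow_succ, ha]
      have h2 : (diffOp σ ^ a) (diffOp σ w) = 0 := by
        rw [← Module.End.mul_apply, ← pow_succ, pow_succ', Module.End.mul_apply, hw0, map_zero]
      simp only [map_add, map_smul, h1, h2, hw0, smul_zero, add_zero]
    · have h3 : (σ ^ (j + 1)) u = (σ ^ j) u + diffOp σ ((σ ^ j) u) := by
        rw [diffOp_apply, pow_succ']
        change σ ((σ ^ j) u) = _
        ring
      rw [h3, hw]
      push_cast
      simp only [map_add, map_smul, add_smul, one_smul]
      ring

/-- Let `I` contain the transfers of all nonempty products of elements of `L`. Then `I` contains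
all products of `p - 1` differences of elements of `L`: modulo products with smaller nilpotency
indices, `∑ j, ∏ i, (σ ^ j (u i) - u i)` equals `∏ i, (σ (u i) - u i)` times
`∑ j, j ^ (p - 1) = -1`. -/
theorem prod_diffOp_mem {p : ℕ} [Fact p.Prime] [CharP F p] (σ : R →ₐ[F] R) (L : Submodule F R)
    (hL : ∀ u ∈ L, σ u ∈ L) (I : Ideal R)
    (hI : ∀ (s : Finset (Fin (p - 1))) (u : Fin (p - 1) → R), s.Nonempty → (∀ i, u i ∈ L) →
      (diffOp σ ^ (p - 1)) (∏ i ∈ s, u i) ∈ I)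
    (u : Fin (p - 1) → R) (hu : ∀ i, u i ∈ L) (a : Fin (p - 1) → ℕ)
    (ha : ∀ i, (diffOp σ ^ a i) (u i) = 0) :
    ∏ i, diffOp σ (u i) ∈ I := by
  have hp : p - 1 ≠ 0 := (Nat.sub_pos_of_lt (Fact.out : p.Prime).one_lt).ne'
  induction hN : ∑ i, a i using Nat.strong_induction_on generalizing u a with
  | _ N ih =>
  by_cases h0 : ∃ i, a i = 0
  · obtain ⟨i, hi⟩ := h0
    have : u i = 0 := by simpa [hi] using ha i
    rw [Finset.prod_eq_zero (Finset.mem_univ i) (by rw [this, map_zero])]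
    exact I.zero_mem
  push Not at h0
  have ha' : ∀ i, (diffOp σ ^ (a i - 1 + 1)) (u i) = 0 := fun i => by
    rw [Nat.sub_add_cancel (Nat.one_le_iff_ne_zero.mpr (h0 i))]; exact ha i
  choose w hwL hw0 hw using fun i j =>
    exists_pow_sub_eq_diffOp σ L hL (hu i) (ha' i) j
  -- the sum over the group of `∏ (σ ^ j u i - u i)` is a combination of transfers
  have h1 : ∑ j ∈ Finset.range p, ∏ i, ((σ ^ j) (u i) - u i) ∈ I := by
    simp_rw [sub_eq_add_neg, Finset.prod_add]
    rw [Finset.sum_comm]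
    refine I.sum_mem fun t _ => ?_
    rw [← Finset.sum_mul]
    refine I.mul_mem_right _ ?_
    simp_rw [← map_prod]
    rw [← diffOp_pow_pred_apply p]
    rcases t.eq_empty_or_nonempty with rfl | ht
    · have : (diffOp σ ^ (p - 1)) (1 : R) = 0 := by
        rw [← Nat.sub_add_cancel (Nat.one_le_iff_ne_zero.mpr hp), pow_succ, Module.End.mul_apply,
          diffOp_apply, map_one, sub_self, map_zero]
      rw [Finset.prod_empty, this]
      exact I.zero_mem
    · exact hI t u ht hu
  -- the remaining terms are products of differences with a smaller sum of nilpotency indices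
  have h2 : ∀ j : ℕ, ∏ i, ((σ ^ j) (u i) - u i)
      - ((j : F) ^ (p - 1)) • ∏ i, diffOp σ (u i) ∈ I := by
    intro j
    have : ∀ i, (σ ^ j) (u i) - u i = (j : F) • diffOp σ (u i) + diffOp σ (w i j) := by
      intro i
      rw [hw i j, map_add, map_smul]
      ring
    simp_rw [this, Finset.prod_add]
    rw [← Finset.add_sum_erase _ _ (Finset.mem_powerset.mpr (Finset.Subset.refl _))]
    simp only [sdiff_self, Finset.bot_eq_empty, Finset.prod_empty, mul_one]
    rw [Finset.prod_smul, Finset.prod_const, Finset.card_univ, Fintype.card_fin,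
      add_sub_cancel_left]
    refine I.sum_mem fun t ht => ?_
    obtain ⟨hne, -⟩ := Finset.mem_erase.mp ht
    rw [Finset.prod_smul, smul_mul_assoc]
    refine Submodule.smul_of_tower_mem I _ ?_
    have hcomb : (∏ i ∈ t, diffOp σ (u i)) * ∏ i ∈ Finset.univ \ t, diffOp σ (w i j)
        = ∏ i, diffOp σ (if i ∈ t then u i else w i j) := by
      rw [← Finset.prod_sdiff (Finset.subset_univ t), mul_comm]
      congr 1
      · refine Finset.prod_congr rfl fun i hi => ?_
        rw [if_neg (Finset.mem_sdiff.mp hi).2]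
      · refine Finset.prod_congr rfl fun i hi => ?_
        rw [if_pos hi]
    rw [hcomb]
    refine ih (∑ i, if i ∈ t then a i else a i - 1) ?_ _ ?_ (fun i => if i ∈ t then a i else a i - 1)
      ?_ rfl
    · rw [← hN]
      obtain ⟨i, hi⟩ : ∃ i, i ∉ t := by
        by_contra hcon
        push Not at hcon
        exact hne (Finset.eq_univ_of_forall hcon)
      refine Finset.sum_lt_sum (fun i _ => ?_) ⟨i, Finset.mem_univ i, ?_⟩
      · split_ifs <;> omega
      · rw [if_neg hi]; have := h0 i; omega
    · intro i
      split_ifs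
      exacts [hu i, hwL i j]
    · intro i
      by_cases hi : i ∈ t
      · simpa only [if_pos hi] using ha i
      · simpa only [if_neg hi] using hw0 i j
  have h3 := I.sub_mem h1 (I.sum_mem (t := Finset.range p) fun j _ => h2 j)
  rw [← Finset.sum_sub_distrib] at h3
  simp only [sub_sub_cancel] at h3
  rw [← Finset.sum_smul, sum_range_cast_pow_pred, neg_smul, one_smul] at h3
  exact neg_mem_iff.mp h3

/-- A product of two differences of linear forms killed by `(σ - 1) ^ 3` is, modulo invariant
linear forms, an invariant of degree two. -/
theorem diffOp_mul_diffOp_fixed {σ : R →ₐ[F] R} {u v : R} (hu : (diffOp σ ^ 3) u = 0)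
    (hv : (diffOp σ ^ 3) v = 0) :
    let y := diffOp σ u
    let x := diffOp σ y
    let y' := diffOp σ v
    let x' := diffOp σ y'
    σ x = x ∧ σ x' = x' ∧
      σ (y * y' - x * v - x' * u - x * y') = y * y' - x * v - x' * u - x * y' := by
  intro y x y' x'
  have hx : σ x = x := by rw [← diffOp_eq_zero_iff]; exact hu
  have hx' : σ x' = x' := by rw [← diffOp_eq_zero_iff]; exact hv
  have hy : σ y = y + x := by rw [← sub_eq_iff_eq_add']; rfl
  have hy' : σ y' = y' + x' := by rw [← sub_eq_iff_eq_add']; rfl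
  have hu' : σ u = u + y := by rw [← sub_eq_iff_eq_add']; rfl
  have hv' : σ v = v + y' := by rw [← sub_eq_iff_eq_add']; rfl
  refine ⟨hx, hx', ?_⟩
  simp only [map_sub, map_mul, hx, hx', hy, hy', hu', hv']
  ring

end CyclicOperator

/-! ### Sums of Jordan blocks acting on polynomials -/

theorem sub_one_pow_char_of_algebra {F : Type*} [Field F] (p : ℕ) [Fact p.Prime] [CharP F p]
    {A : Type*} [Ring A] [Algebra F A] (T : A) : (T - 1) ^ p = T ^ p - 1 := by
  have h : ((Polynomial.X : Polynomial F) - 1) ^ p = Polynomial.X ^ p - 1 := by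
    rw [sub_pow_char, one_pow]
  simpa using congrArg (Polynomial.aeval T) h

section Blocks

open MvPolynomial

variable {F : Type*} [Field F] {ι : Type*} {q : ι → ℕ}

/-- The variables: the block `i` has the variables `⟨i, 0⟩, …, ⟨i, q i⟩`. -/
abbrev Var (q : ι → ℕ) : Type _ := Σ i, Fin (q i + 1)

/-- The top variable of the block `i`. -/
def top (q : ι → ℕ) (i : ι) : Var q := ⟨i, Fin.last (q i)⟩

/-- The variable one step below `j` in its block (and `j` itself at the bottom of the block). -/
def low (j : Var q) : Var q := ⟨j.1, ⟨j.2 - 1, by omega⟩⟩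

@[simp] theorem top_fst (i : ι) : (top q i).1 = i := rfl
@[simp] theorem top_snd (i : ι) : ((top q i).2 : ℕ) = q i := rfl
@[simp] theorem low_fst (j : Var q) : (low j).1 = j.1 := rfl
@[simp] theorem low_snd (j : Var q) : ((low j).2 : ℕ) = j.2 - 1 := rfl

theorem Var.ext {j j' : Var q} (h : j.1 = j'.1) (h' : (j.2 : ℕ) = j'.2) : j = j' := by
  obtain ⟨i, b⟩ := j
  obtain ⟨i', b'⟩ := j'
  obtain rfl : i = i' := h
  obtain rfl : b = b' := Fin.ext h'
  rfl

theorem Var.snd_le (j : Var q) : (j.2 : ℕ) ≤ q j.1 := Nat.lt_succ_iff.mp j.2.isLt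

theorem Var.eq_top_iff (j : Var q) (i : ι) : j = top q i ↔ j.1 = i ∧ (j.2 : ℕ) = q i := by
  constructor
  · rintro rfl
    exact ⟨rfl, rfl⟩
  · rintro ⟨h, h'⟩
    exact Var.ext h h'

/-- The algebra endomorphism which adds to each variable `j` with `l j.1 < j.2` the variable below
it and fixes the others: in the block `i` it acts by a Jordan block on the variables `⟨i, b⟩` with
`l i ≤ b`. For `l = 0` it is the generator of `Z/p` acting on a sum of Jordan blocks; passing to the
quotient by the variables `⟨i, b⟩` with `b < l i` leads to the endomorphism for `l`. -/
def jordanAut (F : Type*) [Field F] (l : ι → ℕ) :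
    MvPolynomial (Var q) F →ₐ[F] MvPolynomial (Var q) F :=
  aeval fun j => X j + if l j.1 < j.2 then X (low j) else 0

theorem jordanAut_X (l : ι → ℕ) (j : Var q) :
    jordanAut F l (X j) = X j + if l j.1 < j.2 then X (low j) else 0 := by
  simp [jordanAut]

theorem diffOp_jordanAut_X (l : ι → ℕ) (j : Var q) :
    diffOp (jordanAut F l) (X j) = if l j.1 < j.2 then X (low j) else 0 := by
  rw [diffOp_apply, jordanAut_X, add_sub_cancel_left]

theorem diffOp_pow_X_eq_zero (l : ι → ℕ) (b : ℕ) (j : Var q) (hj : (j.2 : ℕ) < b) :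
    (diffOp (jordanAut F l) ^ b) (X j) = 0 := by
  induction b generalizing j with
  | zero => omega
  | succ b ih =>
    rw [pow_succ, Module.End.mul_apply, diffOp_jordanAut_X]
    split_ifs with h
    · exact ih _ (by rw [low_snd]; omega)
    · exact map_zero _

variable (p : ℕ) [Fact p.Prime] [CharP F p]

theorem jordanAut_pow_char (hq : ∀ i, q i < p) (l : ι → ℕ) :
    (jordanAut F l : MvPolynomial (Var q) F →ₐ[F] _) ^ p = 1 := by
  refine MvPolynomial.algHom_ext fun j => ?_
  have h := diffOp_pow_X_eq_zero (F := F) l p j (j.snd_le.trans_lt (hq _))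
  rw [diffOp, sub_one_pow_char_of_algebra (F := F) p, LinearMap.sub_apply, toLinearMap_pow_apply,
    sub_eq_zero] at h
  exact h

theorem diffOp_pow_char (hq : ∀ i, q i < p) (l : ι → ℕ) :
    (diffOp (jordanAut F l : MvPolynomial (Var q) F →ₐ[F] _)) ^ p = 0 := by
  rw [diffOp, sub_one_pow_char_of_algebra (F := F) p, sub_eq_zero]
  refine LinearMap.ext fun f => ?_
  rw [toLinearMap_pow_apply, jordanAut_pow_char p hq]
  rfl

theorem restrictSupport_mul_mem {S S' S'' : Set (Var q →₀ ℕ)} {f g : MvPolynomial (Var q) F}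
    (hf : f ∈ restrictSupport F S) (hg : g ∈ restrictSupport F S')
    (h : ∀ m ∈ S, ∀ m' ∈ S', m + m' ∈ S'') : f * g ∈ restrictSupport F S'' := by
  refine restrictSupport_mono F (Set.add_subset_iff.mpr h) ?_
  rw [restrictSupport_add]
  exact Submodule.mul_mem_mul hf hg

theorem X_mem_restrictSupport {S : Set (Var q →₀ ℕ)} {j : Var q} (h : Finsupp.single j 1 ∈ S) :
    (X j : MvPolynomial (Var q) F) ∈ restrictSupport F S :=
  (monomial_mem_restrictSupport F).mpr (Or.inl h)

theorem mem_restrictSupport_iff_coeff {S : Set (Var q →₀ ℕ)} {f : MvPolynomial (Var q) F} :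
    f ∈ restrictSupport F S ↔ ∀ m, coeff m f ≠ 0 → m ∈ S := by
  rw [mem_restrictSupport_iff]
  constructor
  · intro h m hm
    exact h (mem_support_iff.mpr hm)
  · intro h m hm
    exact h m (mem_support_iff.mp hm)

/-- If an additive relation `r` holds between `low j` and `j` and between `j` and `j`, then sets of
monomials closed under `r` are preserved by `jordanAut`. -/
theorem jordanAut_mem_restrictSupport (l : ι → ℕ) (r : (Var q →₀ ℕ) → (Var q →₀ ℕ) → Prop)
    (h0 : r 0 0) (hadd : ∀ a b c d, r a b → r c d → r (a + c) (b + d))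
    (hrefl : ∀ j, r (Finsupp.single j 1) (Finsupp.single j 1))
    (hlow : ∀ j : Var q, l j.1 < j.2 → r (Finsupp.single (low j) 1) (Finsupp.single j 1))
    {S : Set (Var q →₀ ℕ)} (hS : ∀ m ∈ S, ∀ m', r m' m → m' ∈ S)
    {f : MvPolynomial (Var q) F} (hf : f ∈ restrictSupport F S) :
    jordanAut F l f ∈ restrictSupport F S := by
  have key : ∀ m : Var q →₀ ℕ, jordanAut F l (monomial m (1 : F)) ∈
      restrictSupport F {m' | r m' m} := by
    intro m
    induction m using Finsupp.induction_linear with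
    | zero =>
      have : (monomial (0 : Var q →₀ ℕ) (1 : F)) = 1 := rfl
      rw [this, map_one]
      exact (monomial_mem_restrictSupport F).mpr (Or.inl h0)
    | add a b ha hb =>
      have : monomial (a + b) (1 : F) = monomial a 1 * monomial b 1 := by
        rw [monomial_mul, one_mul]
      rw [this, map_mul]
      exact restrictSupport_mul_mem ha hb fun m hm m' hm' => hadd _ _ _ _ hm hm'
    | single j e =>
      induction e with
      | zero =>
        have : (monomial (Finsupp.single j 0 : Var q →₀ ℕ) (1 : F)) = 1 := by
          rw [Finsupp.single_zero]; rfl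
        rw [this, map_one, Finsupp.single_zero]
        exact (monomial_mem_restrictSupport F).mpr (Or.inl h0)
      | succ e ih =>
        have : monomial (Finsupp.single j (e + 1)) (1 : F)
            = monomial (Finsupp.single j e) 1 * X j := by
          rw [X, monomial_mul, one_mul, ← Finsupp.single_add]
        rw [this, map_mul, Finsupp.single_add]
        refine restrictSupport_mul_mem ih (S' := {m' | r m' (Finsupp.single j 1)}) ?_
          fun m hm m' hm' => hadd _ _ _ _ hm hm'
        rw [jordanAut_X]
        refine Submodule.add_mem _ (X_mem_restrictSupport (hrefl j)) ?_
        split_ifs with h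
        · exact X_mem_restrictSupport (hlow j h)
        · exact Submodule.zero_mem _
  have hle : restrictSupport F S ≤ (restrictSupport F S).comap (jordanAut F l).toLinearMap := by
    conv_lhs => rw [restrictSupport_eq_span]
    rw [Submodule.span_le]
    rintro _ ⟨m, hm, rfl⟩
    exact restrictSupport_mono F (fun m' hm' => hS m hm m' hm') (key m)
  exact hle hf

/-! ### Killing the lower part of each block -/

/-- The algebra endomorphism which maps the variables `⟨i, b⟩` with `b < l i` to zero. -/
def killLow (F : Type*) [Field F] (l : ι → ℕ) :
    MvPolynomial (Var q) F →ₐ[F] MvPolynomial (Var q) F :=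
  aeval fun j => if (j.2 : ℕ) < l j.1 then 0 else X j

theorem killLow_X (l : ι → ℕ) (j : Var q) :
    killLow F l (X j) = if (j.2 : ℕ) < l j.1 then 0 else X j := by
  simp [killLow]

theorem killLow_jordanAut {l l' : ι → ℕ} (h : l ≤ l') (f : MvPolynomial (Var q) F) :
    killLow F l' (jordanAut F l f) = jordanAut F l' (killLow F l' f) := by
  have : (killLow F l').comp (jordanAut F l)
      = (jordanAut F l').comp (killLow F l' : MvPolynomial (Var q) F →ₐ[F] _) := by
    refine MvPolynomial.algHom_ext fun j => ?_
    simp only [AlgHom.comp_apply, jordanAut_X, killLow_X, map_add]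
    have := h j.1
    by_cases h1 : (j.2 : ℕ) < l' j.1
    · rw [if_pos h1, map_zero, zero_add]
      split_ifs
      · rw [killLow_X, if_pos]
        rw [low_snd, low_fst]; omega
      · exact map_zero _
    · rw [if_neg h1, jordanAut_X]
      congr 1
      by_cases h2 : l' j.1 < j.2
      · rw [if_pos (lt_of_le_of_lt this h2), if_pos h2, killLow_X, if_neg]
        rw [low_snd, low_fst]; omega
      · rw [if_neg h2]
        split_ifs
        · rw [killLow_X, if_pos]
          rw [low_snd, low_fst]; omega
        · exact map_zero _
  exact DFunLike.congr_fun this f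

theorem killLow_diffOp {l l' : ι → ℕ} (h : l ≤ l') (f : MvPolynomial (Var q) F) :
    killLow F l' (diffOp (jordanAut F l) f) = diffOp (jordanAut F l') (killLow F l' f) := by
  rw [diffOp_apply, diffOp_apply, map_sub, killLow_jordanAut h]

theorem killLow_diffOp_pow {l l' : ι → ℕ} (h : l ≤ l') (m : ℕ) (f : MvPolynomial (Var q) F) :
    killLow F l' ((diffOp (jordanAut F l) ^ m) f)
      = (diffOp (jordanAut F l') ^ m) (killLow F l' f) := by
  induction m generalizing f with
  | zero => rfl
  | succ m ih => rw [pow_succ, Module.End.mul_apply, ih, killLow_diffOp h, pow_succ,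
      Module.End.mul_apply]

/-- The monomials without the variables `⟨i, b⟩` with `b < l i`. -/
def avoidLow (l : ι → ℕ) : Set (Var q →₀ ℕ) := {m | ∀ j : Var q, (j.2 : ℕ) < l j.1 → m j = 0}

theorem killLow_monomial_of_mem {l : ι → ℕ} {m : Var q →₀ ℕ} (hm : m ∈ avoidLow l) (a : F) :
    killLow F l (monomial m a) = monomial m a := by
  rw [monomial_eq, map_mul, Finsupp.prod, map_prod, algHom_C, algebraMap_eq]
  congr 1
  refine Finset.prod_congr rfl fun j hj => ?_
  rw [map_pow, killLow_X, if_neg]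
  exact fun h => (Finsupp.mem_support_iff.mp hj) (hm j h)

theorem killLow_monomial_of_notMem {l : ι → ℕ} {m : Var q →₀ ℕ} (hm : m ∉ avoidLow l) (a : F) :
    killLow F l (monomial m a) = 0 := by
  simp only [avoidLow, Set.mem_ofPred_eq, not_forall] at hm
  obtain ⟨j, hj, hj'⟩ := hm
  rw [monomial_eq, map_mul, Finsupp.prod, map_prod, Finset.prod_eq_zero
    (Finsupp.mem_support_iff.mpr hj'), mul_zero]
  rw [map_pow, killLow_X, if_pos hj, zero_pow hj']

theorem coeff_killLow {l : ι → ℕ} {m : Var q →₀ ℕ} (hm : m ∈ avoidLow l)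
    (f : MvPolynomial (Var q) F) : coeff m (killLow F l f) = coeff m f := by
  classical
  induction f using MvPolynomial.induction_on' with
  | monomial m' a =>
    by_cases hm' : m' ∈ avoidLow l
    · rw [killLow_monomial_of_mem hm']
    · rw [killLow_monomial_of_notMem hm', coeff_zero, coeff_monomial, if_neg]
      rintro rfl
      exact hm' hm
  | add f g hf hg => rw [map_add, coeff_add, coeff_add, hf, hg]

theorem coeff_killLow_of_notMem {l : ι → ℕ} {m : Var q →₀ ℕ} (hm : m ∉ avoidLow l)
    (f : MvPolynomial (Var q) F) : coeff m (killLow F l f) = 0 := by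
  classical
  induction f using MvPolynomial.induction_on' with
  | monomial m' a =>
    by_cases hm' : m' ∈ avoidLow l
    · rw [killLow_monomial_of_mem hm', coeff_monomial, if_neg]
      rintro rfl
      exact hm hm'
    · rw [killLow_monomial_of_notMem hm', coeff_zero]
  | add f g hf hg => rw [map_add, coeff_add, hf, hg, add_zero]

theorem killLow_mem_restrictSupport {l : ι → ℕ} {S : Set (Var q →₀ ℕ)}
    {f : MvPolynomial (Var q) F} (hf : f ∈ restrictSupport F S) :
    killLow F l f ∈ restrictSupport F (S ∩ avoidLow l) := by
  rw [mem_restrictSupport_iff_coeff] at hf ⊢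
  intro m hm
  have h : m ∈ avoidLow l := by
    by_contra h
    exact hm (coeff_killLow_of_notMem h f)
  rw [coeff_killLow h] at hm
  exact ⟨hf m hm, h⟩

theorem killLow_eq_self {l : ι → ℕ} {f : MvPolynomial (Var q) F}
    (hf : f ∈ restrictSupport F (avoidLow l)) : killLow F l f = f := by
  rw [mem_restrictSupport_iff_coeff] at hf
  ext m
  by_cases h : m ∈ avoidLow l
  · rw [coeff_killLow h]
  · rw [coeff_killLow_of_notMem h]
    by_contra hne
    exact h (hf m (Ne.symm hne))

end Blocks

section Division

open MvPolynomial

variable {F : Type*} [Field F] {ι : Type*} {q : ι → ℕ}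

/-! ### Division by the norms of the top variables -/

/-- The monomials in the variables `⟨i, b⟩` with `l i ≤ b` of the block `i`, of degree `d` and of
degree less than `e` in the top variable. -/
def blockMon (l : ι → ℕ) (i : ι) (e d : ℕ) : Set (Var q →₀ ℕ) :=
  {m | (∀ j : Var q, m j ≠ 0 → j.1 = i ∧ l j.1 ≤ j.2) ∧ m.degree = d ∧ m (top q i) < e}

/-- The monomials of degree `d` without the variables `⟨i, b⟩` with `b < l i`, of degree less than
`p` in the top variables of the blocks in `s`. -/
def redMon (p : ℕ) (l : ι → ℕ) (s : Set ι) (d : ℕ) : Set (Var q →₀ ℕ) :=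
  {m | m ∈ avoidLow l ∧ (∀ i ∈ s, m (top q i) < p) ∧ m.degree = d}

theorem low_ne_top {j : Var q} (h : 0 < (j.2 : ℕ)) (i : ι) : low j ≠ top q i := by
  intro h'
  rw [Var.eq_top_iff] at h'
  obtain ⟨h1, h2⟩ := h'
  have := j.snd_le
  rw [low_fst] at h1
  rw [low_snd] at h2
  subst h1
  omega

theorem single_low_top_le {j : Var q} (h : 0 < (j.2 : ℕ)) (i : ι) :
    Finsupp.single (low j) 1 (top q i) ≤ Finsupp.single j 1 (top q i) := by
  rw [Finsupp.single_eq_of_ne (low_ne_top h i).symm]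
  exact Nat.zero_le _

theorem jordanAut_mem_blockMon (l : ι → ℕ) (i : ι) (e d : ℕ) {f : MvPolynomial (Var q) F}
    (hf : f ∈ restrictSupport F (blockMon l i e d)) :
    jordanAut F l f ∈ restrictSupport F (blockMon l i e d) := by
  classical
  refine jordanAut_mem_restrictSupport l (fun m' m =>
    ((∀ j : Var q, m j ≠ 0 → j.1 = i ∧ l j.1 ≤ j.2) → ∀ j : Var q, m' j ≠ 0 → j.1 = i ∧ l j.1 ≤ j.2)
      ∧ m'.degree = m.degree ∧ m' (top q i) ≤ m (top q i)) ?_ ?_ ?_ ?_ ?_ hf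
  · exact ⟨id, rfl, le_rfl⟩
  · rintro a b c d ⟨h1, h2, h3⟩ ⟨h4, h5, h6⟩
    refine ⟨fun h j hj => ?_, ?_, ?_⟩
    · rw [Finsupp.add_apply] at hj
      by_cases ha : a j = 0
      · refine h4 (fun j' hj' => h j' ?_) j (by omega)
        rw [Finsupp.add_apply]; omega
      · refine h1 (fun j' hj' => h j' ?_) j ha
        rw [Finsupp.add_apply]; omega
    · simp only [map_add, h2, h5]
    · simp only [Finsupp.add_apply]; omega
  · exact fun j => ⟨id, rfl, le_rfl⟩
  · intro j hj
    refine ⟨fun h j' hj' => ?_, ?_, single_low_top_le (by omega) i⟩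
    · obtain rfl : j' = low j := by
        by_contra hne
        exact hj' (Finsupp.single_eq_of_ne hne)
      obtain ⟨h1, h2⟩ := h j (by simp)
      exact ⟨h1, by rw [low_snd, low_fst]; omega⟩
    · simp
  · rintro m ⟨h1, h2, h3⟩ m' ⟨h4, h5, h6⟩
    exact ⟨h4 h1, h5.trans h2, lt_of_le_of_lt h6 h3⟩

theorem jordanAut_mem_redMon (p : ℕ) (l : ι → ℕ) (s : Set ι) (d : ℕ)
    {f : MvPolynomial (Var q) F} (hf : f ∈ restrictSupport F (redMon p l s d)) :
    jordanAut F l f ∈ restrictSupport F (redMon p l s d) := by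
  classical
  refine jordanAut_mem_restrictSupport l (fun m' m =>
    (m ∈ avoidLow l → m' ∈ avoidLow l)
      ∧ m'.degree = m.degree ∧ ∀ i, m' (top q i) ≤ m (top q i)) ?_ ?_ ?_ ?_ ?_ hf
  · exact ⟨id, rfl, fun _ => le_rfl⟩
  · rintro a b c d ⟨h1, h2, h3⟩ ⟨h4, h5, h6⟩
    refine ⟨fun h j hj => ?_, ?_, fun i => ?_⟩
    · have ha := h1 (fun j' hj' => by have := h j' hj'; rw [Finsupp.add_apply] at this; omega) j hj
      have hc := h4 (fun j' hj' => by have := h j' hj'; rw [Finsupp.add_apply] at this; omega) j hj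
      rw [Finsupp.add_apply, ha, hc]
    · simp only [map_add, h2, h5]
    · have := h3 i
      have := h6 i
      simp only [Finsupp.add_apply]; omega
  · exact fun j => ⟨id, rfl, fun _ => le_rfl⟩
  · intro j hj
    refine ⟨fun _ j' hj' => ?_, ?_, single_low_top_le (by omega)⟩
    · refine Finsupp.single_eq_of_ne ?_
      rintro rfl
      rw [low_snd, low_fst] at hj'
      omega
    · simp
  · rintro m ⟨h1, h2, h3⟩ m' ⟨h4, h5, h6⟩
    exact ⟨h4 h1, fun i hi => lt_of_le_of_lt (h6 i) (h2 i hi), h5.trans h3⟩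

theorem diffOp_mem_redMon (p : ℕ) (l : ι → ℕ) (s : Set ι) (d : ℕ)
    {f : MvPolynomial (Var q) F} (hf : f ∈ restrictSupport F (redMon p l s d)) :
    diffOp (jordanAut F l) f ∈ restrictSupport F (redMon p l s d) :=
  Submodule.sub_mem _ (jordanAut_mem_redMon p l s d hf) hf

theorem diffOp_pow_mem_redMon (p : ℕ) (l : ι → ℕ) (s : Set ι) (d e : ℕ)
    {f : MvPolynomial (Var q) F} (hf : f ∈ restrictSupport F (redMon p l s d)) :
    (diffOp (jordanAut F l) ^ e) f ∈ restrictSupport F (redMon p l s d) := by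
  induction e with
  | zero => exact hf
  | succ e ih =>
    rw [pow_succ', Module.End.mul_apply]
    exact diffOp_mem_redMon p l s d ih

/-- The norm of the top variable of the block `i`. -/
def blockNorm (F : Type*) [Field F] {ι : Type*} {q : ι → ℕ} (p : ℕ) (l : ι → ℕ) (i : ι) :
    MvPolynomial (Var q) F :=
  ∏ j ∈ Finset.range p, (jordanAut F l ^ j) (X (top q i))

theorem jordanAut_blockNorm (p : ℕ) [Fact p.Prime] [CharP F p] (hq : ∀ i, q i < p) (l : ι → ℕ)
    (i : ι) : jordanAut F l (blockNorm F p l i : MvPolynomial (Var q) F) = blockNorm F p l i := by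
  have hp : 0 < p := (Fact.out : p.Prime).pos
  obtain ⟨p', rfl⟩ := Nat.exists_eq_succ_of_ne_zero hp.ne'
  have h : ∀ j : ℕ, jordanAut F l ((jordanAut F l ^ j) (X (top q i)))
      = (jordanAut F l ^ (j + 1)) (X (top q i)) := by
    intro j; rw [pow_succ']; rfl
  rw [blockNorm, map_prod]
  simp_rw [h]
  rw [Finset.prod_range_succ, Finset.prod_range_succ']
  have := jordanAut_pow_char (F := F) (p' + 1) hq l
  rw [this]
  rfl

theorem jordanAut_pow_top_sub_mem (l : ι → ℕ) (i : ι) (j : ℕ) :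
    (jordanAut F l ^ j) (X (top q i)) - X (top q i) ∈ restrictSupport F (blockMon l i 1 1) := by
  induction j with
  | zero => rw [pow_zero]; simp
  | succ j ih =>
    have h : (jordanAut F l ^ (j + 1)) (X (top q i)) - X (top q i)
        = jordanAut F l ((jordanAut F l ^ j) (X (top q i)) - X (top q i))
          + diffOp (jordanAut F l) (X (top q i)) := by
      rw [pow_succ', diffOp_apply, map_sub]
      change jordanAut F l ((jordanAut F l ^ j) (X (top q i))) - _ = _
      ring
    rw [h]
    refine Submodule.add_mem _ (jordanAut_mem_blockMon l i 1 1 ih) ?_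
    rw [diffOp_jordanAut_X]
    split_ifs with h'
    · rw [top_snd, top_fst] at h'
      refine X_mem_restrictSupport ⟨fun j' hj' => ?_, by simp, ?_⟩
      · obtain rfl : j' = low (top q i) := by
          by_contra hne
          exact hj' (Finsupp.single_eq_of_ne hne)
        exact ⟨rfl, by rw [low_snd, low_fst, top_snd, top_fst]; omega⟩
      · rw [Finsupp.single_eq_of_ne (low_ne_top (by rw [top_snd]; omega) i).symm]
        exact one_pos
    · exact Submodule.zero_mem _

/-- The norm is monic of degree `p` in the top variable. -/
theorem blockNorm_sub_mem (p : ℕ) {l : ι → ℕ} {i : ι} (hl : l i ≤ q i) :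
    (blockNorm F p l i : MvPolynomial (Var q) F) - X (top q i) ^ p
      ∈ restrictSupport F (blockMon l i p p) := by
  unfold blockNorm
  induction p with
  | zero => simp
  | succ p ih =>
    rw [Finset.prod_range_succ, pow_succ]
    set N := ∏ j ∈ Finset.range p, (jordanAut F l ^ j) (X (top q i) : MvPolynomial (Var q) F)
    set z : MvPolynomial (Var q) F := X (top q i)
    have h : N * (jordanAut F l ^ p) z - z ^ p * z
        = (N - z ^ p) * z + (N - z ^ p) * ((jordanAut F l ^ p) z - z)
          + z ^ p * ((jordanAut F l ^ p) z - z) := by ring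
    have he := jordanAut_pow_top_sub_mem (F := F) (q := q) l i p
    have hz : z ∈ restrictSupport F (blockMon l i 2 1) := by
      refine X_mem_restrictSupport ⟨fun j' hj' => ?_, by simp, by simp⟩
      obtain rfl : j' = top q i := by
        by_contra hne
        exact hj' (Finsupp.single_eq_of_ne hne)
      exact ⟨rfl, by simpa using hl⟩
    have hzp : z ^ p ∈ restrictSupport F (blockMon l i (p + 1) p) := by
      rw [X_pow_eq_monomial]
      refine (monomial_mem_restrictSupport F).mpr (Or.inl ⟨fun j' hj' => ?_, by simp, by simp⟩)
      obtain rfl : j' = top q i := by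
        by_contra hne
        exact hj' (Finsupp.single_eq_of_ne hne)
      exact ⟨rfl, by simpa using hl⟩
    have hadd : ∀ a b c d, a + c ≤ p + 1 + 1 → b + d = p + 1 →
        ∀ m ∈ blockMon (q := q) l i a b, ∀ m' ∈ blockMon (q := q) l i c d,
        m + m' ∈ blockMon (q := q) l i (p + 1) (p + 1) := by
      rintro a b c d hac hbd m ⟨h1, h2, h3⟩ m' ⟨h4, h5, h6⟩
      refine ⟨fun j hj => ?_, ?_, ?_⟩
      · rw [Finsupp.add_apply] at hj
        by_cases hm : m j = 0
        · exact h4 j (by omega)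
        · exact h1 j hm
      · rw [map_add, h2, h5, hbd]
      · rw [Finsupp.add_apply]; omega
    rw [h]
    refine Submodule.add_mem _ (Submodule.add_mem _ ?_ ?_) ?_
    · exact restrictSupport_mul_mem ih hz (hadd _ _ _ _ (by omega) (by omega))
    · exact restrictSupport_mul_mem ih he (hadd _ _ _ _ (by omega) (by omega))
    · exact restrictSupport_mul_mem hzp he (hadd _ _ _ _ (by omega) (by omega))

theorem blockNorm_mem (p : ℕ) {l : ι → ℕ} {i : ι} (hl : l i ≤ q i) :
    (blockNorm F p l i : MvPolynomial (Var q) F) ∈ restrictSupport F {m | m.degree = p} := by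
  rw [← sub_add_cancel (blockNorm F p l i : MvPolynomial (Var q) F) (X (top q i) ^ p)]
  refine Submodule.add_mem _ (restrictSupport_mono F (fun m hm => hm.2.1)
    (blockNorm_sub_mem p hl)) ?_
  rw [X_pow_eq_monomial]
  exact (monomial_mem_restrictSupport F).mpr (Or.inl (by simp))

/-- Uniqueness of division by the norm, which is monic in the top variable. -/
theorem eq_zero_of_blockNorm_mul_mem {p : ℕ} {l : ι → ℕ} {i : ι} (hl : l i ≤ q i)
    {g : MvPolynomial (Var q) F}
    (h : blockNorm F p l i * g ∈ restrictSupport F {m | m (top q i) < p}) : g = 0 := by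
  classical
  by_contra hg
  have hcoeff : coeff (Finsupp.single (top q i) p) (blockNorm F p l i) = (1 : F) := by
    have h1 := blockNorm_sub_mem (F := F) p hl
    rw [mem_restrictSupport_iff_coeff] at h1
    by_contra hne
    have h2 := (h1 (Finsupp.single (top q i) p) ?_).2.2
    · simp at h2
    · rw [coeff_sub, X_pow_eq_monomial, coeff_monomial, if_pos rfl]
      exact sub_ne_zero.mpr hne
  have hN : (blockNorm F p l i : MvPolynomial (Var q) F) ≠ 0 := by
    intro h0
    rw [h0, coeff_zero] at hcoeff
    exact zero_ne_one hcoeff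
  have h1 : p ≤ degreeOf (top q i) (blockNorm F p l i : MvPolynomial (Var q) F) := by
    have := monomial_le_degreeOf (top q i) (m := Finsupp.single (top q i) p)
      (f := (blockNorm F p l i : MvPolynomial (Var q) F))
      (mem_support_iff.mpr (by rw [hcoeff]; exact one_ne_zero))
    simpa using this
  have hp : 0 < p ∨ p = 0 := by omega
  rcases hp with hp | rfl
  · have h2 : degreeOf (top q i) (blockNorm F p l i * g) < p := by
      rw [degreeOf_lt_iff hp]
      intro m hm
      exact h hm
    rw [degreeOf_mul_eq hN hg] at h2
    omega
  · have : blockNorm F 0 l i * g = 0 := by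
      ext m
      rw [coeff_zero]
      by_contra hm
      exact absurd ((mem_restrictSupport_iff_coeff.mp h) m hm) (Nat.not_lt_zero _)
    exact (mul_ne_zero hN hg) this

/-- Existence of division by the norm of the block `i`, for polynomials already reduced with respect
to the blocks in `s`. -/
theorem mem_map_sup_redMon {p : ℕ} {l : ι → ℕ} {s : Set ι} {i : ι} (hl : l i ≤ q i)
    (hi : i ∉ s) (d : ℕ) {f : MvPolynomial (Var q) F}
    (hf : f ∈ restrictSupport F (redMon p l s d)) :
    f ∈ (restrictSupport F (redMon p l s (d - p))).map
        (LinearMap.mulLeft F (blockNorm F p l i)) ⊔ restrictSupport F (redMon p l (insert i s) d) := by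
  classical
  set Y := (restrictSupport F (redMon p l s (d - p))).map
        (LinearMap.mulLeft F (blockNorm F p l i)) ⊔ restrictSupport F (redMon p l (insert i s) d)
  have key : ∀ t : ℕ, restrictSupport F {m | m ∈ redMon p l s d ∧ m (top q i) < t} ≤ Y := by
    intro t
    induction t with
    | zero =>
      intro f hf
      have : f = 0 := by
        ext m
        rw [coeff_zero]
        by_contra hm
        exact absurd ((mem_restrictSupport_iff_coeff.mp hf) m hm).2 (Nat.not_lt_zero _)
      rw [this]
      exact Submodule.zero_mem _
    | succ t ih =>
      rw [restrictSupport_eq_span, Submodule.span_le]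
      rintro _ ⟨m, ⟨⟨hm1, hm2, hm3⟩, hm⟩, rfl⟩
      change monomial m 1 ∈ Y
      by_cases hmp : m (top q i) < p
      · refine Submodule.mem_sup_right ((monomial_mem_restrictSupport F).mpr (Or.inl
          ⟨hm1, ?_, hm3⟩))
        rintro i' (rfl | hi')
        exacts [hmp, hm2 i' hi']
      have hle : Finsupp.single (top q i) p ≤ m := by
        rw [Finsupp.single_le_iff]; omega
      obtain ⟨m', rfl⟩ : ∃ m', m = Finsupp.single (top q i) p + m' :=
        ⟨m - Finsupp.single (top q i) p, (add_tsub_cancel_of_le hle).symm⟩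
      have hprod : monomial (Finsupp.single (top q i) p + m') (1 : F)
          = blockNorm F p l i * monomial m' 1
            - (blockNorm F p l i - X (top q i) ^ p) * monomial m' 1 := by
        rw [sub_mul, sub_sub_cancel, X_pow_eq_monomial, monomial_mul, one_mul]
      have hm1' : ∀ j : Var q, (j.2 : ℕ) < l j.1 → m' j = 0 := fun j hj => by
        have := hm1 j hj
        rw [Finsupp.add_apply] at this
        omega
      have hm2' : ∀ i' ∈ s, m' (top q i') < p := fun i' hi' => by
        have := hm2 i' hi'
        rw [Finsupp.add_apply] at this
        omega
      rw [map_add, Finsupp.degree_single] at hm3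
      rw [Finsupp.add_apply, Finsupp.single_eq_same] at hm
      rw [hprod]
      refine Submodule.sub_mem _ (Submodule.mem_sup_left ⟨_, ?_, rfl⟩) (ih ?_)
      · exact (monomial_mem_restrictSupport F).mpr (Or.inl ⟨hm1', hm2', by omega⟩)
      · refine restrictSupport_mul_mem (blockNorm_sub_mem p hl)
          ((monomial_mem_restrictSupport F (s := {m'})).mpr (Or.inl rfl)) ?_
        rintro a ⟨ha1, ha2, ha3⟩ _ rfl
        refine ⟨⟨fun j hj => ?_, fun i' hi' => ?_, ?_⟩, ?_⟩
        · have h1 : a j = 0 := by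
            by_contra hne
            have := (ha1 j hne).2
            omega
          rw [Finsupp.add_apply, h1, hm1' j hj]
        · have h1 : a (top q i') = 0 := by
            by_contra hne
            have := (ha1 _ hne).1
            rw [top_fst] at this
            exact hi (this ▸ hi')
          rw [Finsupp.add_apply, h1, zero_add]
          exact hm2' i' hi'
        · rw [map_add, ha2, hm3]
        · rw [Finsupp.add_apply]; omega
  obtain ⟨t, ht⟩ : ∃ t, ∀ m ∈ f.support, m (top q i) < t :=
    ⟨f.support.sup (fun m => m (top q i)) + 1, fun m hm =>
      Nat.lt_succ_of_le (Finset.le_sup (f := fun m : Var q →₀ ℕ => m (top q i)) hm)⟩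
  exact key t fun m hm => ⟨hf hm, ht m hm⟩

theorem exists_blockNorm_mul_add {p : ℕ} {l : ι → ℕ} {s : Set ι} {i : ι} (hl : l i ≤ q i)
    (hi : i ∉ s) (d : ℕ) {f : MvPolynomial (Var q) F}
    (hf : f ∈ restrictSupport F (redMon p l s d)) :
    ∃ g ∈ restrictSupport F (redMon p l s (d - p)),
      ∃ r ∈ restrictSupport F (redMon p l (insert i s) d), f = blockNorm F p l i * g + r := by
  obtain ⟨_, ⟨g, hg, rfl⟩, r, hr, h⟩ := Submodule.mem_sup.mp (mem_map_sup_redMon hl hi d hf)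
  exact ⟨g, hg, r, hr, h.symm⟩

/-- By uniqueness, quotient and remainder of an invariant are invariants. -/
theorem fixed_of_blockNorm_mul_add {p : ℕ} [Fact p.Prime] [CharP F p] (hq : ∀ i, q i < p)
    {l : ι → ℕ} {s : Set ι} {i : ι} (hl : l i ≤ q i) {d : ℕ} {f g r : MvPolynomial (Var q) F}
    (hr : r ∈ restrictSupport F (redMon p l (insert i s) d)) (h : f = blockNorm F p l i * g + r)
    (hf : jordanAut F l f = f) : jordanAut F l g = g ∧ jordanAut F l r = r := by
  have h1 : blockNorm F p l i * (jordanAut F l g - g) = r - jordanAut F l r := by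
    have := hf
    rw [h, map_add, map_mul, jordanAut_blockNorm p hq] at this
    linear_combination this
  have h2 : jordanAut F l g - g = 0 := by
    refine eq_zero_of_blockNorm_mul_mem (p := p) hl ?_
    rw [h1]
    refine restrictSupport_mono F ?_ (Submodule.sub_mem _ hr (jordanAut_mem_redMon _ _ _ _ hr))
    exact fun m hm => hm.2.1 i (Set.mem_insert _ _)
  refine ⟨sub_eq_zero.mp h2, ?_⟩
  rw [h2, mul_zero] at h1
  exact (sub_eq_zero.mp h1.symm).symm

/-- An invariant is reduced modulo the norms of all top variables: division by one norm after the
other gives invariant quotients and an invariant remainder of degree less than `p` in each top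
variable. -/
theorem exists_sum_blockNorm_mul_add [Fintype ι] {p : ℕ} [Fact p.Prime] [CharP F p]
    (hq : ∀ i, q i < p) {l : ι → ℕ} (hl : l ≤ q) {d : ℕ} {f : MvPolynomial (Var q) F}
    (hf : f ∈ restrictSupport F (redMon p l ∅ d)) (hfix : jordanAut F l f = f) :
    ∃ g : ι → MvPolynomial (Var q) F, ∃ r ∈ restrictSupport F (redMon p l Set.univ d),
      (∀ i, g i ∈ restrictSupport F (redMon p l ∅ (d - p)) ∧ jordanAut F l (g i) = g i) ∧
      jordanAut F l r = r ∧ f = ∑ i, blockNorm F p l i * g i + r := by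
  classical
  have key : ∀ s : Finset ι, ∃ g : ι → MvPolynomial (Var q) F,
      ∃ r ∈ restrictSupport F (redMon p l s d),
      (∀ i, g i ∈ restrictSupport F (redMon p l ∅ (d - p)) ∧ jordanAut F l (g i) = g i) ∧
      jordanAut F l r = r ∧ f = ∑ i ∈ s, blockNorm F p l i * g i + r := by
    intro s
    induction s using Finset.induction_on with
    | empty =>
      exact ⟨0, f, by simpa using hf, fun i => ⟨Submodule.zero_mem _, map_zero _⟩, hfix, by simp⟩
    | insert i s his ih =>
      obtain ⟨g, r, hr, hg, hrfix, h⟩ := ih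
      obtain ⟨g', hg', r', hr', h'⟩ := exists_blockNorm_mul_add (hl i) (by simpa using his) d hr
      obtain ⟨h1, h2⟩ := fixed_of_blockNorm_mul_add hq (hl i) hr' h' hrfix
      refine ⟨Function.update g i g', r', by rwa [Finset.coe_insert], fun i' => ?_, h2, ?_⟩
      · by_cases hii : i' = i
        · subst hii
          rw [Function.update_self]
          refine ⟨restrictSupport_mono F ?_ hg', h1⟩
          exact fun m hm => ⟨hm.1, fun _ h => absurd h (Set.notMem_empty _), hm.2.2⟩
        · rw [Function.update_of_ne hii]
          exact hg i'
      · have hsum : ∑ x ∈ s, blockNorm F p l x * Function.update g i g' x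
            = ∑ x ∈ s, blockNorm F p l x * g x := by
          refine Finset.sum_congr rfl fun x hx => ?_
          rw [Function.update_of_ne (ne_of_mem_of_not_mem hx his)]
        rw [Finset.sum_insert his, Function.update_self, hsum, h, h']
        ring
  obtain ⟨g, r, hr, h⟩ := key Finset.univ
  exact ⟨g, r, by simpa using hr, h⟩

end Division

section Freeness

open MvPolynomial

variable {F : Type*} [Field F] {ι : Type*} {q : ι → ℕ} {p : ℕ}

/-! ### Reduced invariants of large degree are transfers -/

theorem finite_redMon [Fintype ι] (l : ι → ℕ) (s : Set ι) (d : ℕ) :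
    (redMon (q := q) p l s d).Finite :=
  (Finsupp.finite_of_degree_le d).subset fun _ hm => hm.2.2.le

/-- If all reduced invariants of degree `d` are transfers, then the kernel of the transfer on the
reduced polynomials of degree `d` is the image of `diffOp`, by comparing dimensions. -/
theorem exists_diffOp_of_transfer_eq_zero [Fintype ι] [Fact p.Prime] [CharP F p] (hq : ∀ i, q i < p)
    (l : ι → ℕ) (d : ℕ)
    (hP : ∀ f ∈ restrictSupport F (redMon (q := q) p l Set.univ d), diffOp (jordanAut F l) f = 0 →
      ∃ h ∈ restrictSupport F (redMon p l Set.univ d), (diffOp (jordanAut F l) ^ (p - 1)) h = f)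
    {f : MvPolynomial (Var q) F} (hf : f ∈ restrictSupport F (redMon p l Set.univ d))
    (hf0 : (diffOp (jordanAut F l) ^ (p - 1)) f = 0) :
    ∃ h ∈ restrictSupport F (redMon p l Set.univ d), diffOp (jordanAut F l) h = f := by
  have : Finite (redMon (q := q) p l Set.univ d) := finite_redMon l Set.univ d
  have : FiniteDimensional F (restrictSupport F (redMon (q := q) p l Set.univ d)) :=
    Module.Finite.of_basis (basisRestrictSupport F _)
  let T := (diffOp (jordanAut F l)).restrict
    (fun f hf => diffOp_mem_redMon (F := F) (q := q) p l Set.univ d hf)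
  have hTpow : ∀ (e : ℕ) v, ((T ^ e) v : MvPolynomial (Var q) F)
      = (diffOp (jordanAut F l) ^ e) v := by
    intro e v
    induction e generalizing v with
    | zero => rfl
    | succ e ih => rw [pow_succ, Module.End.mul_apply, ih, pow_succ, Module.End.mul_apply]; rfl
  have hT : T ^ p = 0 := by
    refine LinearMap.ext fun v => Subtype.ext ?_
    rw [hTpow, diffOp_pow_char p hq]
    rfl
  have hker := ker_pow_le_range p (Fact.out : p.Prime).one_le T hT (by
    intro v hv
    obtain ⟨h, hh, hh'⟩ := hP v v.2 (congrArg Subtype.val (LinearMap.mem_ker.mp hv))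
    exact ⟨⟨h, hh⟩, Subtype.ext ((hTpow _ _).trans hh')⟩)
  obtain ⟨h, hh⟩ := hker (x := ⟨f, hf⟩)
    (LinearMap.mem_ker.mpr (Subtype.ext ((hTpow _ _).trans hf0)))
  exact ⟨h, h.2, congrArg Subtype.val hh⟩

/-- A polynomial that vanishes when the variable `⟨i, l i⟩` is set to zero is divisible by it. -/
theorem exists_eq_X_mul_of_killLow_eq_zero [DecidableEq ι] {l : ι → ℕ} {i : ι}
    {j : Var q} (hj1 : j.1 = i) (hj2 : (j.2 : ℕ) = l i) {d : ℕ} {f : MvPolynomial (Var q) F}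
    (hf : f ∈ restrictSupport F (redMon p l Set.univ (d + 1)))
    (h0 : killLow F (Function.update l i (l i + 1)) f = 0) :
    ∃ g ∈ restrictSupport F (redMon p l Set.univ d), f = X j * g := by
  classical
  have hle : restrictSupport F {m | m ∈ redMon (q := q) p l Set.univ (d + 1) ∧ m j ≠ 0} ≤
      (restrictSupport F (redMon p l Set.univ d)).map (LinearMap.mulLeft F (X j)) := by
    rw [restrictSupport_eq_span, Submodule.span_le]
    rintro _ ⟨m, ⟨⟨hm1, hm2, hm3⟩, hm⟩, rfl⟩
    have hle : Finsupp.single j 1 ≤ m := by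
      rw [Finsupp.single_le_iff]; omega
    obtain ⟨m', rfl⟩ : ∃ m', m = Finsupp.single j 1 + m' :=
      ⟨m - Finsupp.single j 1, (add_tsub_cancel_of_le hle).symm⟩
    refine ⟨monomial m' 1, (monomial_mem_restrictSupport F).mpr (Or.inl
      ⟨fun j' hj' => ?_, fun i' hi' => ?_, ?_⟩), ?_⟩
    · have := hm1 j' hj'
      rw [Finsupp.add_apply] at this
      omega
    · have := hm2 i' hi'
      rw [Finsupp.add_apply] at this
      omega
    · rw [map_add, Finsupp.degree_single] at hm3
      omega
    · rw [LinearMap.mulLeft_apply, X, monomial_mul, one_mul]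
  obtain ⟨g, hg, hg'⟩ := hle (show f ∈ _ by
    rw [mem_restrictSupport_iff_coeff] at hf ⊢
    intro m hm
    refine ⟨hf m hm, fun hmj => hm ?_⟩
    rw [← coeff_killLow (l := Function.update l i (l i + 1)), h0, coeff_zero]
    intro j' hj'
    by_cases hi : j'.1 = i
    · have hu : Function.update l i (l i + 1) j'.1 = l i + 1 := by rw [hi, Function.update_self]
      have hlj : l j'.1 = l i := congrArg l hi
      by_cases hlt : (j'.2 : ℕ) < l i
      · exact (hf m hm).1 j' (by omega)
      · have : j' = j := Var.ext (hi.trans hj1.symm) (by omega)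
        rw [this, hmj]
    · rw [Function.update_of_ne hi] at hj'
      exact (hf m hm).1 j' hj')
  exact ⟨g, hg, hg'.symm⟩

/-- Division by the invariant variable `X j` at the bottom of the block `i`: if `X j * g` is a
transfer, so is `g`. In the quotient by `X j` the preimage `h` has transfer zero, hence is a difference there
by the hypothesis on the quotient; subtracting the lifted difference from `h` leaves a multiple of
`X j` with the same transfer. -/
theorem exists_transfer_of_X_mul [Fintype ι] [DecidableEq ι] [Fact p.Prime] [CharP F p]
    (hq : ∀ i, q i < p)
    {l : ι → ℕ} {i : ι} (hl : l i < q i)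
    {j : Var q} (hj1 : j.1 = i) (hj2 : (j.2 : ℕ) = l i) {d : ℕ}
    (hP : ∀ f ∈ restrictSupport F (redMon (q := q) p (Function.update l i (l i + 1)) Set.univ (d + 1)),
      diffOp (jordanAut F (Function.update l i (l i + 1))) f = 0 →
      ∃ h ∈ restrictSupport F (redMon p (Function.update l i (l i + 1)) Set.univ (d + 1)),
        (diffOp (jordanAut F (Function.update l i (l i + 1))) ^ (p - 1)) h = f)
    {g h : MvPolynomial (Var q) F}
    (hh : h ∈ restrictSupport F (redMon p l Set.univ (d + 1)))
    (hgh : (diffOp (jordanAut F l) ^ (p - 1)) h = X j * g) :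
    ∃ h ∈ restrictSupport F (redMon p l Set.univ d), (diffOp (jordanAut F l) ^ (p - 1)) h = g := by
  set l' := Function.update l i (l i + 1) with hl'
  have hll' : l ≤ l' := by
    intro i'
    by_cases hi : i' = i
    · subst hi; rw [hl', Function.update_self]; exact Nat.le_succ _
    · rw [hl', Function.update_of_ne hi]
  have havoid : avoidLow (q := q) l' ⊆ avoidLow l := fun m hm j' hj' =>
    hm j' (lt_of_lt_of_le hj' (hll' _))
  have hj : killLow F l' (X j) = 0 := by
    rw [killLow_X, if_pos]
    have : l' j.1 = l i + 1 := by rw [hj1, hl', Function.update_self]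
    omega
  have hκh : killLow F l' h ∈ restrictSupport F (redMon p l' Set.univ (d + 1)) :=
    restrictSupport_mono F (fun m hm => And.intro hm.2 ⟨hm.1.2.1, hm.1.2.2⟩)
      (killLow_mem_restrictSupport hh)
  have hκ0 : (diffOp (jordanAut F l') ^ (p - 1)) (killLow F l' h) = 0 := by
    rw [← killLow_diffOp_pow hll', hgh, map_mul, hj, zero_mul]
  obtain ⟨h', hh', hh''⟩ := exists_diffOp_of_transfer_eq_zero hq l' (d + 1) hP hκh hκ0
  have hh'l : h' ∈ restrictSupport F (redMon p l Set.univ (d + 1)) :=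
    restrictSupport_mono F (fun m hm => And.intro (havoid hm.1) ⟨hm.2.1, hm.2.2⟩) hh'
  obtain ⟨k, hk, hk'⟩ := exists_eq_X_mul_of_killLow_eq_zero (p := p) hj1 hj2
    (f := h - diffOp (jordanAut F l) h')
    (Submodule.sub_mem _ hh (diffOp_mem_redMon p l _ _ hh'l)) (by
      rw [map_sub, killLow_diffOp hll', killLow_eq_self (restrictSupport_mono F
        (fun m hm => hm.1) hh'), hh'', sub_self])
  refine ⟨k, hk, mul_left_cancel₀ (X_ne_zero (R := F) j) ?_⟩
  have hXj : jordanAut F l (X j : MvPolynomial (Var q) F) = X j := by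
    rw [jordanAut_X, if_neg, add_zero]
    have : l j.1 = l i := congrArg l hj1
    omega
  rw [← diffOp_pow_mul_of_fixed hXj, ← hk', map_sub, hgh, ← Module.End.mul_apply, ← pow_succ,
    Nat.sub_add_cancel (Fact.out : p.Prime).one_le, diffOp_pow_char p hq, LinearMap.zero_apply,
    sub_zero]

theorem exists_transfer_of_X_pow_mul [Fintype ι] [DecidableEq ι] [Fact p.Prime] [CharP F p]
    (hq : ∀ i, q i < p)
    {l : ι → ℕ} {i : ι} (hl : l i < q i)
    {j : Var q} (hj1 : j.1 = i) (hj2 : (j.2 : ℕ) = l i) {d₀ : ℕ}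
    (hP : ∀ d, d₀ < d →
      ∀ f ∈ restrictSupport F (redMon (q := q) p (Function.update l i (l i + 1)) Set.univ d),
      diffOp (jordanAut F (Function.update l i (l i + 1))) f = 0 →
      ∃ h ∈ restrictSupport F (redMon p (Function.update l i (l i + 1)) Set.univ d),
        (diffOp (jordanAut F (Function.update l i (l i + 1))) ^ (p - 1)) h = f)
    {g : MvPolynomial (Var q) F} (t d : ℕ) (hd : d₀ < d) (h : MvPolynomial (Var q) F)
    (hh : h ∈ restrictSupport F (redMon p l Set.univ (d + t)))
    (hgh : (diffOp (jordanAut F l) ^ (p - 1)) h = X j ^ t * g) :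
    ∃ h ∈ restrictSupport F (redMon p l Set.univ d), (diffOp (jordanAut F l) ^ (p - 1)) h = g := by
  induction t generalizing h with
  | zero => exact ⟨h, hh, by simpa using hgh⟩
  | succ t ih =>
    obtain ⟨h', hh', hh''⟩ := exists_transfer_of_X_mul (d := d + t) (g := X j ^ t * g) hq hl hj1 hj2
      (hP (d + t + 1) (by omega)) hh (by rw [hgh, pow_succ']; ring)
    exact ih h' hh' hh''

/-- In degrees above `(p - 1) k`, where `k` is the number of blocks, the reduced polynomials form a
free module over `F[Z/p]`; in other words, reduced invariants are transfers of reduced polynomials.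
The induction removes the bottom variables of the blocks one at a time.
-/
theorem exists_transfer_of_fixed [Fintype ι] [Fact p.Prime] [CharP F p] (hq : ∀ i, q i < p)
    {l : ι → ℕ} (hl : l ≤ q) {d : ℕ} (hd : (p - 1) * Fintype.card ι < d)
    {f : MvPolynomial (Var q) F} (hf : f ∈ restrictSupport F (redMon p l Set.univ d))
    (hfix : diffOp (jordanAut F l) f = 0) :
    ∃ h ∈ restrictSupport F (redMon p l Set.univ d),
      (diffOp (jordanAut F l) ^ (p - 1)) h = f := by
  classical
  have hp1 : 1 ≤ p := (Fact.out : p.Prime).one_le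
  induction hN : ∑ i, (q i - l i) generalizing l d f with
  | zero =>
    -- only the top variables remain, and these have exponents less than `p`
    refine ⟨0, Submodule.zero_mem _, ?_⟩
    rw [map_zero, eq_comm]
    ext m
    rw [coeff_zero]
    by_contra hm
    obtain ⟨h1, h2, h3⟩ := (mem_restrictSupport_iff_coeff.mp hf) m hm
    have hlq : ∀ i, l i = q i := fun i => by
      have h1 : q i - l i = 0 := Finset.sum_eq_zero_iff.mp hN i (Finset.mem_univ i)
      have h2 : l i ≤ q i := hl i
      omega
    have hsum : m.degree = ∑ i, m (top q i) := by
      rw [Finsupp.degree_eq_sum, ← Finset.univ_sigma_univ, Finset.sum_sigma]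
      refine Finset.sum_congr rfl fun i _ => ?_
      refine Finset.sum_eq_single (Fin.last (q i)) (fun b _ hb => ?_) (by simp)
      refine h1 ⟨i, b⟩ ?_
      change (b : ℕ) < l i
      rw [hlq i]
      exact Fin.val_lt_last hb
    have hle : ∑ i, m (top q i) ≤ ∑ _i : ι, (p - 1) :=
      Finset.sum_le_sum fun i _ => by have := h2 i (Set.mem_univ i); omega
    rw [Finset.sum_const, Finset.card_univ, smul_eq_mul, mul_comm, ← hsum, h3] at hle
    exact absurd hle (not_le.mpr hd)
  | succ N ih =>
    obtain ⟨i, hi⟩ : ∃ i, l i < q i := by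
      by_contra hcon
      push Not at hcon
      rw [Finset.sum_eq_zero (fun i _ => by have := hcon i; omega)] at hN
      omega
    set l' := Function.update l i (l i + 1) with hl'
    have hl'q : l' ≤ q := by
      intro i'
      by_cases hii : i' = i
      · subst hii; rw [hl', Function.update_self]; exact hi
      · rw [hl', Function.update_of_ne hii]; exact hl i'
    have hN' : ∑ i', (q i' - l' i') = N := by
      rw [← Finset.add_sum_erase _ _ (Finset.mem_univ i)] at hN ⊢
      have : ∑ x ∈ Finset.univ.erase i, (q x - l' x) = ∑ x ∈ Finset.univ.erase i, (q x - l x) := by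
        refine Finset.sum_congr rfl fun x hx => ?_
        rw [hl', Function.update_of_ne (Finset.ne_of_mem_erase hx)]
      rw [this, hl', Function.update_self]
      omega
    let j : Var q := ⟨i, ⟨l i, by omega⟩⟩
    let j' : Var q := ⟨i, ⟨l i + 1, by omega⟩⟩
    have hXj : jordanAut F l (X j : MvPolynomial (Var q) F) = X j := by
      rw [jordanAut_X, if_neg (lt_irrefl (l i)), add_zero]
    have hXj' : jordanAut F l (X j' : MvPolynomial (Var q) F) = X j' + X j := by
      rw [jordanAut_X, if_pos (Nat.lt_succ_self (l i))]
      rfl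
    -- `f * X j ^ (p - 1)` is a transfer, and the powers of the bottom variable can be divided out
    have hTr : (diffOp (jordanAut F l) ^ (p - 1)) (f * X j' ^ (p - 1)) = - (f * X j ^ (p - 1)) := by
      rw [diffOp_pow_mul_of_fixed ((diffOp_eq_zero_iff _ _).mp hfix), transfer_pow_pred p hXj' hXj,
        mul_neg]
    have hmul : ∀ (j : Var q), j.1 = i → l i ≤ j.2 → ∀ f ∈ restrictSupport F (redMon p l Set.univ d),
        f * X j ^ (p - 1) ∈ restrictSupport F (redMon p l {i}ᶜ (d + (p - 1))) := by
      intro j hj1 hj2 f hf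
      rw [X_pow_eq_monomial]
      refine restrictSupport_mul_mem hf ((monomial_mem_restrictSupport F
        (s := {Finsupp.single j (p - 1)})).mpr (Or.inl rfl)) ?_
      rintro m ⟨h1, h2, h3⟩ _ rfl
      refine ⟨fun a ha => ?_, fun i' hi' => ?_, ?_⟩
      · rw [Finsupp.add_apply, h1 a ha, Finsupp.single_eq_of_ne, add_zero]
        rintro rfl
        have : l a.1 = l i := congrArg l hj1
        omega
      · rw [Finsupp.add_apply, Finsupp.single_eq_of_ne, add_zero]
        · exact h2 i' (Set.mem_univ _)
        · rintro rfl
          exact hi' hj1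
      · rw [map_add, h3, Finsupp.degree_single]
    have hfj' := hmul j' rfl (Nat.le_succ _) f hf
    have hins : insert i ({i}ᶜ : Set ι) = Set.univ := by
      ext x; by_cases hx : x = i <;> simp [hx]
    obtain ⟨g, hg, r, hr, hgr⟩ := exists_blockNorm_mul_add (hl i) (by simp) _ hfj'
    rw [hins] at hr
    -- applying the transfer, the remainder must vanish by uniqueness
    have h1 : blockNorm F p l i * (diffOp (jordanAut F l) ^ (p - 1)) g
        = - (f * X j ^ (p - 1)) - (diffOp (jordanAut F l) ^ (p - 1)) r := by
      rw [← diffOp_pow_mul_of_fixed (jordanAut_blockNorm p hq l i), eq_sub_iff_add_eq, ← map_add,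
        ← hgr, hTr]
    have hfj : f * X j ^ (p - 1) ∈ restrictSupport F {m : Var q →₀ ℕ | m (top q i) < p} := by
      rw [X_pow_eq_monomial]
      refine restrictSupport_mul_mem hf ((monomial_mem_restrictSupport F
        (s := {Finsupp.single j (p - 1)})).mpr (Or.inl rfl)) ?_
      rintro m ⟨-, h2, -⟩ _ rfl
      change (m + Finsupp.single j (p - 1)) (top q i) < p
      rw [Finsupp.add_apply, Finsupp.single_eq_of_ne, add_zero]
      · exact h2 i (Set.mem_univ _)
      · intro h
        have h4 : q i = l i := congrArg (fun x : Var q => (x.2 : ℕ)) h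
        omega
    have h2 : (diffOp (jordanAut F l) ^ (p - 1)) g = 0 := by
      refine eq_zero_of_blockNorm_mul_mem (p := p) (hl i) ?_
      rw [h1]
      refine Submodule.sub_mem _ (Submodule.neg_mem _ hfj) (restrictSupport_mono F ?_
        (diffOp_pow_mem_redMon p l _ _ _ hr))
      exact fun m hm => hm.2.1 i (Set.mem_univ _)
    rw [h2, mul_zero] at h1
    refine exists_transfer_of_X_pow_mul (j := j) (d₀ := (p - 1) * Fintype.card ι) hq hi rfl rfl ?_
      (p - 1) d hd (-r) (Submodule.neg_mem _ hr) ?_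
    · intro d' hd' f' hf' hfix'
      exact ih hl'q hd' hf' hfix' hN'
    · rw [map_neg]
      linear_combination -h1

end Freeness

section UpperBound

open MvPolynomial

variable {F : Type*} [Field F] {ι : Type*} {q : ι → ℕ} {p : ℕ}

/-! ### The upper bound -/

/-- The homogeneous invariants of degree `d` of a sum of Jordan blocks. -/
def invHom (F : Type*) [Field F] {ι : Type*} (q : ι → ℕ) (d : ℕ) :
    Submodule F (MvPolynomial (Var q) F) :=
  restrictSupport F {m | m.degree = d} ⊓ LinearMap.ker (diffOp (jordanAut F 0))

/-- The subalgebra generated by the homogeneous invariants of degree less than `d`. -/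
def lowInv (F : Type*) [Field F] {ι : Type*} (q : ι → ℕ) (d : ℕ) :
    Subalgebra F (MvPolynomial (Var q) F) :=
  Algebra.adjoin F {f | ∃ e < d, f ∈ invHom F q e}

/-- The Hilbert ideal: the ideal generated by the homogeneous invariants of positive degree. -/
def hilbertIdeal (F : Type*) [Field F] {ι : Type*} (q : ι → ℕ) : Ideal (MvPolynomial (Var q) F) :=
  Ideal.span {f | ∃ e, 0 < e ∧ f ∈ invHom F q e}

theorem mem_invHom {d : ℕ} {f : MvPolynomial (Var q) F} :
    f ∈ invHom F q d ↔ f ∈ restrictSupport F {m | m.degree = d} ∧ jordanAut F 0 f = f := by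
  rw [invHom, Submodule.mem_inf, LinearMap.mem_ker, diffOp_eq_zero_iff]

theorem jordanAut_mem_degree (l : ι → ℕ) {d : ℕ} {f : MvPolynomial (Var q) F}
    (hf : f ∈ restrictSupport F {m | m.degree = d}) :
    jordanAut F l f ∈ restrictSupport F {m | m.degree = d} := by
  refine jordanAut_mem_restrictSupport l (fun m' m => m'.degree = m.degree) rfl ?_ ?_ ?_ ?_ hf
  · intro a b c d h1 h2
    rw [map_add, map_add, h1, h2]
  · exact fun _ => rfl
  · intro j _
    simp
  · exact fun m hm m' hm' => hm'.trans hm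

theorem diffOp_pow_mem_degree (l : ι → ℕ) {d : ℕ} (e : ℕ) {f : MvPolynomial (Var q) F}
    (hf : f ∈ restrictSupport F {m | m.degree = d}) :
    (diffOp (jordanAut F l) ^ e) f ∈ restrictSupport F {m | m.degree = d} := by
  induction e with
  | zero => exact hf
  | succ e ih =>
    rw [pow_succ', Module.End.mul_apply]
    exact Submodule.sub_mem _ (jordanAut_mem_degree l ih) ih

theorem transfer_mem_invHom [Fact p.Prime] [CharP F p] (hq : ∀ i, q i < p) {d : ℕ}
    {f : MvPolynomial (Var q) F} (hf : f ∈ restrictSupport F {m | m.degree = d}) :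
    (diffOp (jordanAut F 0) ^ (p - 1)) f ∈ invHom F q d := by
  refine ⟨diffOp_pow_mem_degree 0 _ hf, ?_⟩
  change diffOp (jordanAut F 0) _ = 0
  rw [← Module.End.mul_apply, ← pow_succ', Nat.sub_add_cancel (Fact.out : p.Prime).one_le,
    diffOp_pow_char p hq, LinearMap.zero_apply]

theorem mem_degree_iff_isHomogeneous {d : ℕ} {f : MvPolynomial (Var q) F} :
    f ∈ restrictSupport F {m | m.degree = d} ↔ f.IsHomogeneous d := by
  rw [mem_restrictSupport_iff_coeff]
  refine forall_congr' fun m => ?_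
  rw [Finsupp.degree_eq_weight_one]
  rfl

/-- The transfer of a homogeneous element of the Hilbert ideal is decomposable: if `f` is invariant,
then the transfer of `a * f` is `f` times the transfer of `a`, and constants have transfer zero. -/
theorem transfer_mem_lowInv [Fact p.Prime] [CharP F p] (hq : ∀ i, q i < p) {d : ℕ}
    {h : MvPolynomial (Var q) F} (hd : h ∈ restrictSupport F {m | m.degree = d})
    (hh : h ∈ hilbertIdeal F q) : (diffOp (jordanAut F 0) ^ (p - 1)) h ∈ lowInv F q d := by
  have key : ∀ h ∈ hilbertIdeal F q, ∀ a : MvPolynomial (Var q) F,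
      homogeneousComponent d ((diffOp (jordanAut F 0) ^ (p - 1)) (a * h)) ∈ lowInv F q d := by
    intro h hh
    induction hh using Submodule.span_induction with
    | mem f hf =>
      obtain ⟨e, he, hf⟩ := hf
      intro a
      induction a using MvPolynomial.induction_on' with
      | monomial m c =>
        have hm : monomial m c ∈ restrictSupport F {m' : Var q →₀ ℕ | m'.degree = m.degree} :=
          (monomial_mem_restrictSupport F).mpr (Or.inl rfl)
        have hmf : monomial m c * f ∈ restrictSupport F {m' | m'.degree = m.degree + e} :=
          restrictSupport_mul_mem hm (mem_invHom.mp hf).1 fun a ha b hb => by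
            change (a + b).degree = _
            rw [map_add, ha, hb]
        have hT := diffOp_pow_mem_degree 0 (p - 1) hmf
        rw [homogeneousComponent_of_mem (mem_degree_iff_isHomogeneous.mp hT)]
        split_ifs with hde
        · rw [mul_comm, diffOp_pow_mul_of_fixed (mem_invHom.mp hf).2]
          by_cases hm0 : m.degree = 0
          · have : m = 0 := (Finsupp.degree_eq_zero_iff m).mp hm0
            have h1 : (diffOp (jordanAut F 0) ^ (p - 1)) (monomial m c) = 0 := by
              have hp : p - 1 ≠ 0 := (Nat.sub_pos_of_lt (Fact.out : p.Prime).one_lt).ne'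
              obtain ⟨k, hk⟩ := Nat.exists_eq_succ_of_ne_zero hp
              rw [hk, pow_succ, Module.End.mul_apply, this, diffOp_apply]
              change (diffOp (jordanAut F 0) ^ k) (jordanAut F 0 (C c) - C c) = 0
              rw [algHom_C, algebraMap_eq, sub_self, map_zero]
            rw [h1, mul_zero]
            exact Subalgebra.zero_mem _
          · refine Subalgebra.mul_mem _ (Algebra.subset_adjoin ⟨e, by omega, hf⟩)
              (Algebra.subset_adjoin ⟨m.degree, by omega, transfer_mem_invHom hq hm⟩)
        · exact Subalgebra.zero_mem _
      | add a b ha hb =>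
        rw [add_mul, map_add, map_add]
        exact Subalgebra.add_mem _ ha hb
    | zero =>
      intro a
      rw [mul_zero, map_zero, map_zero]
      exact Subalgebra.zero_mem _
    | add x y _ _ hx hy =>
      intro a
      rw [mul_add, map_add, map_add]
      exact Subalgebra.add_mem _ (hx a) (hy a)
    | smul b x _ hx =>
      intro a
      rw [smul_eq_mul, ← mul_assoc]
      exact hx _
  have h1 := key h hh 1
  rw [one_mul, homogeneousComponent_of_mem (mem_degree_iff_isHomogeneous.mp
    (diffOp_pow_mem_degree 0 (p - 1) hd)), if_pos rfl] at h1
  exact h1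

/-- A monomial of degree at least `t` in the variables satisfying `P` is divisible by a product of
`t` of them. -/
theorem exists_sum_single_le {σ : Type*} [Fintype σ] (P : σ → Prop) [DecidablePred P] (m : σ →₀ ℕ)
    (t : ℕ) (h : t ≤ ∑ j with P j, m j) :
    ∃ u : Fin t → σ, (∀ i, P (u i)) ∧ ∑ i, Finsupp.single (u i) 1 ≤ m := by
  classical
  induction t with
  | zero => exact ⟨Fin.elim0, fun i => i.elim0, by simp⟩
  | succ t ih =>
    obtain ⟨u, hu, hle⟩ := ih (by omega)
    set s := ∑ i, Finsupp.single (u i) 1 with hs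
    obtain ⟨j, hj, hlt⟩ : ∃ j ∈ Finset.univ.filter P, s j < m j := by
      by_contra hcon
      push Not at hcon
      have h1 : ∑ j with P j, m j ≤ ∑ j, s j :=
        (Finset.sum_le_sum hcon).trans (Finset.sum_le_sum_of_subset (Finset.filter_subset _ _))
      have h2 : ∑ j, s j = t := by
        rw [← Finsupp.degree_eq_sum, hs, map_sum]
        simp
      omega
    refine ⟨Fin.cons j u, fun i => ?_, ?_⟩
    · refine Fin.cases ?_ (fun i => ?_) i
      · exact (Finset.mem_filter.mp hj).2
      · exact hu i
    · rw [Fin.sum_univ_succ]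
      simp only [Fin.cons_zero, Fin.cons_succ, ← hs]
      intro x
      rw [Finsupp.add_apply]
      by_cases hx : x = j
      · subst hx
        rw [Finsupp.single_eq_same]
        omega
      · rw [Finsupp.single_eq_of_ne hx, zero_add]
        exact hle x

/-- If all products of `t` variables different from the top variables lie in an ideal, then so do
the reduced polynomials of degree at least `(p - 1) k + t`. -/
theorem redMon_mem_ideal [Fintype ι] (hp : 1 ≤ p) (J : Ideal (MvPolynomial (Var q) F)) (t : ℕ)
    (hJ : ∀ u : Fin t → Var q, (∀ i, ((u i).2 : ℕ) < q (u i).1) → ∏ i, X (u i) ∈ J) {d : ℕ}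
    (hd : (p - 1) * Fintype.card ι + t ≤ d) {f : MvPolynomial (Var q) F}
    (hf : f ∈ restrictSupport F (redMon p 0 Set.univ d)) : f ∈ J := by
  classical
  have hle : restrictSupport F (redMon p 0 Set.univ d) ≤ J.restrictScalars F := by
    rw [restrictSupport_eq_span, Submodule.span_le]
    rintro _ ⟨m, ⟨-, h2, h3⟩, rfl⟩
    change monomial m 1 ∈ J
    have hsum : m.degree = ∑ j with (j.2 : ℕ) < q j.1, m j + ∑ i, m (top q i) := by
      rw [Finsupp.degree_eq_sum, ← Finset.sum_filter_add_sum_filter_not Finset.univ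
        (fun j : Var q => (j.2 : ℕ) < q j.1)]
      congr 1
      symm
      refine Finset.sum_bij (fun i _ => top q i) (fun i _ => by simp) (fun i _ i' _ h => ?_)
        (fun j hj => ⟨j.1, Finset.mem_univ _, ?_⟩) (fun i _ => rfl)
      · exact congrArg Sigma.fst h
      · have := (Finset.mem_filter.mp hj).2
        exact Var.ext rfl (by rw [top_snd]; have := j.snd_le; omega)
    have htop : ∑ i, m (top q i) ≤ ∑ _i : ι, (p - 1) :=
      Finset.sum_le_sum fun i _ => by have := h2 i (Set.mem_univ i); omega
    rw [Finset.sum_const, Finset.card_univ, smul_eq_mul, mul_comm] at htop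
    obtain ⟨u, hu, hle⟩ := exists_sum_single_le (fun j : Var q => (j.2 : ℕ) < q j.1) m t (by omega)
    have hm : monomial m (1 : F) = (∏ i, X (u i)) * monomial (m - ∑ i, Finsupp.single (u i) 1) 1 := by
      have : (∏ i, X (u i) : MvPolynomial (Var q) F)
          = monomial (∑ i, Finsupp.single (u i) 1) 1 := by
        rw [monomial_sum_one]; rfl
      rw [this, monomial_mul, one_mul, add_tsub_cancel_of_le hle]
    rw [hm]
    exact J.mul_mem_right _ (hJ u hu)
  exact hle hf

/-- The variable one step above `j`. -/
def up (j : Var q) (hj : (j.2 : ℕ) < q j.1) : Var q := ⟨j.1, ⟨j.2 + 1, by omega⟩⟩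

theorem diffOp_X_up (j : Var q) (hj : (j.2 : ℕ) < q j.1) :
    diffOp (jordanAut F 0) (X (up j hj) : MvPolynomial (Var q) F) = X j := by
  rw [diffOp_jordanAut_X]
  exact if_pos (Nat.succ_pos (j.2 : ℕ))

theorem X_mem_degree (j : Var q) :
    (X j : MvPolynomial (Var q) F) ∈ restrictSupport F {m | m.degree = 1} :=
  X_mem_restrictSupport (by simp)

/-- A variable below the top of its block is a difference of variables, so any `p - 1` of them have
their product in the Hilbert ideal. -/
theorem prod_X_mem_hilbertIdeal [Fact p.Prime] [CharP F p] (hq : ∀ i, q i < p)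
    (u : Fin (p - 1) → Var q) (hu : ∀ i, ((u i).2 : ℕ) < q (u i).1) :
    ∏ i, X (u i) ∈ hilbertIdeal F q := by
  have := prod_diffOp_mem (p := p) (jordanAut F 0) (restrictSupport F {m | m.degree = 1})
    (fun f hf => jordanAut_mem_degree 0 hf) (hilbertIdeal F q) ?_
    (fun i => (X (up (u i) (hu i)) : MvPolynomial (Var q) F)) (fun i => X_mem_degree _) (fun _ => p)
    (fun i => by rw [diffOp_pow_char p hq]; rfl)
  · simpa only [diffOp_X_up] using this
  · intro s v hs hv
    have hdeg : ∏ i ∈ s, v i ∈ restrictSupport F {m | m.degree = s.card} := by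
      clear hs
      classical
      induction s using Finset.induction_on with
      | empty => exact (monomial_mem_restrictSupport F).mpr (Or.inl (by simp))
      | insert i s his ih =>
        rw [Finset.prod_insert his, Finset.card_insert_of_notMem his]
        refine restrictSupport_mul_mem (hv i) ih fun a ha b hb => ?_
        change (a + b).degree = _
        rw [map_add, ha, hb, add_comm]
    exact Ideal.subset_span ⟨s.card, Finset.card_pos.mpr hs, transfer_mem_invHom hq hdeg⟩

/-- If no block has more than three variables, then two factors are enough: `y * y'` completes to an
invariant of degree two modulo invariant linear forms. -/
theorem prod_X_mem_hilbertIdeal_of_le_two (hq : ∀ i, q i ≤ 2)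
    (u : Fin 2 → Var q) (hu : ∀ i, ((u i).2 : ℕ) < q (u i).1) :
    ∏ i, X (u i) ∈ hilbertIdeal F q := by
  have h3 : ∀ j : Var q, (diffOp (jordanAut F 0) ^ 3) (X j : MvPolynomial (Var q) F) = 0 := fun j =>
    diffOp_pow_X_eq_zero 0 3 j (by have := j.snd_le; have := hq j.1; omega)
  obtain ⟨h1, h2, h4⟩ := diffOp_mul_diffOp_fixed (h3 (up (u 0) (hu 0))) (h3 (up (u 1) (hu 1)))
  rw [diffOp_X_up, diffOp_X_up] at h4
  rw [diffOp_X_up] at h1 h2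
  have hmul : ∀ f ∈ restrictSupport F {m : Var q →₀ ℕ | m.degree = 1},
      ∀ g ∈ restrictSupport F {m : Var q →₀ ℕ | m.degree = 1},
      f * g ∈ restrictSupport F {m : Var q →₀ ℕ | m.degree = 2} := fun f hf g hg =>
    restrictSupport_mul_mem hf hg fun a ha b hb => by
      change (a + b).degree = _
      rw [map_add, ha, hb]
  have hX : ∀ j : Var q, diffOp (jordanAut F 0) (X j : MvPolynomial (Var q) F)
      ∈ restrictSupport F {m | m.degree = 1} := fun j =>
    diffOp_pow_mem_degree 0 1 (X_mem_degree j)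
  rw [Fin.prod_univ_two]
  set y : MvPolynomial (Var q) F := X (u 0)
  set y' : MvPolynomial (Var q) F := X (u 1)
  set x := diffOp (jordanAut F 0) y
  set x' := diffOp (jordanAut F 0) y'
  set v : MvPolynomial (Var q) F := X (up (u 1) (hu 1))
  set w : MvPolynomial (Var q) F := X (up (u 0) (hu 0))
  have hx : x ∈ hilbertIdeal F q := Ideal.subset_span ⟨1, one_pos, mem_invHom.mpr ⟨hX _, h1⟩⟩
  have hx' : x' ∈ hilbertIdeal F q := Ideal.subset_span ⟨1, one_pos, mem_invHom.mpr ⟨hX _, h2⟩⟩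
  have hinv : y * y' - x * v - x' * w - x * y' ∈ hilbertIdeal F q := by
    refine Ideal.subset_span ⟨2, two_pos, mem_invHom.mpr ⟨?_, h4⟩⟩
    refine Submodule.sub_mem _ (Submodule.sub_mem _ (Submodule.sub_mem _ ?_ ?_) ?_) ?_
    · exact hmul _ (X_mem_degree _) _ (X_mem_degree _)
    · exact hmul _ (hX _) _ (X_mem_degree _)
    · exact hmul _ (hX _) _ (X_mem_degree _)
    · exact hmul _ (hX _) _ (X_mem_degree _)
  have : y * y' = (y * y' - x * v - x' * w - x * y') + x * v + x' * w + x * y' := by ring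
  rw [this]
  exact Ideal.add_mem _ (Ideal.add_mem _ (Ideal.add_mem _ hinv (Ideal.mul_mem_right _ _ hx))
    (Ideal.mul_mem_right _ _ hx')) (Ideal.mul_mem_right _ _ hx)

/-- Homogeneous invariants of large degree are decomposable. -/
theorem mem_lowInv_of_mem_invHom [Fintype ι] [Nonempty ι] [Fact p.Prime] [CharP F p]
    (hq : ∀ i, q i < p) {t : ℕ} (ht : 2 ≤ t)
    (hJ : ∀ u : Fin t → Var q, (∀ i, ((u i).2 : ℕ) < q (u i).1) → ∏ i, X (u i) ∈ hilbertIdeal F q)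
    {d : ℕ} (hd : (p - 1) * Fintype.card ι + t ≤ d) {f : MvPolynomial (Var q) F}
    (hf : f ∈ invHom F q d) : f ∈ lowInv F q d := by
  have hp : 1 ≤ p := (Fact.out : p.Prime).one_le
  have hpd : p < d := by
    have : (p - 1) * 1 ≤ (p - 1) * Fintype.card ι := Nat.mul_le_mul_left _ Fintype.card_pos
    omega
  obtain ⟨hf1, hf2⟩ := mem_invHom.mp hf
  have hred : f ∈ restrictSupport F (redMon p 0 ∅ d) :=
    restrictSupport_mono F (fun m hm => And.intro (fun j hj => absurd hj (Nat.not_lt_zero _))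
      ⟨fun i hi => absurd hi (Set.notMem_empty _), hm⟩) hf1
  obtain ⟨g, r, hr, hg, hrfix, rfl⟩ :=
    exists_sum_blockNorm_mul_add hq (fun i => Nat.zero_le (q i)) hred hf2
  refine Subalgebra.add_mem _ (Subalgebra.sum_mem _ fun i _ => Subalgebra.mul_mem _ ?_ ?_) ?_
  · exact Algebra.subset_adjoin ⟨p, hpd, mem_invHom.mpr
      ⟨blockNorm_mem p (Nat.zero_le _), jordanAut_blockNorm p hq 0 i⟩⟩
  · exact Algebra.subset_adjoin ⟨d - p, by omega, mem_invHom.mpr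
      ⟨restrictSupport_mono F (fun m hm => hm.2.2) (hg i).1, (hg i).2⟩⟩
  · obtain ⟨h, hh, rfl⟩ := exists_transfer_of_fixed hq (l := 0) (fun i => Nat.zero_le (q i))
      (by omega) hr ((diffOp_eq_zero_iff _ _).mpr hrfix)
    exact transfer_mem_lowInv hq (restrictSupport_mono F (fun m hm => hm.2.2) hh)
      (redMon_mem_ideal hp _ t hJ hd hh)

theorem jordanAut_homogeneousComponent (l : ι → ℕ) (d : ℕ) (f : MvPolynomial (Var q) F) :
    jordanAut F l (homogeneousComponent d f) = homogeneousComponent d (jordanAut F l f) := by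
  classical
  induction f using MvPolynomial.induction_on' with
  | monomial m c =>
    have hm : monomial m c ∈ restrictSupport F {m' : Var q →₀ ℕ | m'.degree = m.degree} :=
      (monomial_mem_restrictSupport F).mpr (Or.inl rfl)
    rw [homogeneousComponent_of_mem (mem_degree_iff_isHomogeneous.mp hm),
      homogeneousComponent_of_mem (mem_degree_iff_isHomogeneous.mp (jordanAut_mem_degree l hm))]
    split_ifs
    · rfl
    · exact map_zero _
  | add a b ha hb => simp only [map_add, ha, hb]

/-- All invariants lie in the algebra generated by the homogeneous invariants of degree less than
`(p - 1) k + t`. -/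
theorem fixed_mem_lowInv [Fintype ι] [Nonempty ι] [Fact p.Prime] [CharP F p]
    (hq : ∀ i, q i < p) {t : ℕ} (ht : 2 ≤ t)
    (hJ : ∀ u : Fin t → Var q, (∀ i, ((u i).2 : ℕ) < q (u i).1) → ∏ i, X (u i) ∈ hilbertIdeal F q)
    {f : MvPolynomial (Var q) F} (hf : jordanAut F 0 f = f) :
    f ∈ lowInv F q ((p - 1) * Fintype.card ι + t) := by
  have key : ∀ d, ∀ f ∈ invHom F q d, f ∈ lowInv F q ((p - 1) * Fintype.card ι + t) := by
    intro d
    induction d using Nat.strong_induction_on with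
    | _ d ih =>
    intro f hf
    rcases lt_or_ge d ((p - 1) * Fintype.card ι + t) with hd | hd
    · exact Algebra.subset_adjoin ⟨d, hd, hf⟩
    · have hle : lowInv F q d ≤ lowInv F q ((p - 1) * Fintype.card ι + t) :=
        Algebra.adjoin_le fun g ⟨e, he, hg⟩ => ih e he g hg
      exact hle (mem_lowInv_of_mem_invHom hq ht hJ hd hf)
  rw [← sum_homogeneousComponent f]
  refine Subalgebra.sum_mem _ fun d _ => key d _ (mem_invHom.mpr ⟨?_, ?_⟩)
  · exact mem_degree_iff_isHomogeneous.mpr (homogeneousComponent_isHomogeneous d f)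
  · rw [jordanAut_homogeneousComponent, hf]

end UpperBound

section Balanced

variable {F : Type*} [Field F] {M M' : Type*} [AddCommGroup M] [Module F M]
  [AddCommGroup M'] [Module F M']

/-! ### Balanced graded operators -/

/-- Let `D` be an operator of degree `2` on a graded space. If the space is a direct sum of strings
of length at most `p`, where each string is either of length `p` or has its weights placed
symmetrically around zero, then an element of weight less than `1 - j` which is killed by `D ^ j`
lies in the image of `D ^ (p - j)`. This consequence is taken as the definition. -/
def Balanced (p : ℕ) (D : Module.End F M) (G : ℤ → Submodule F M) : Prop :=
  ∀ j ≤ p, ∀ u : ℤ, u < 1 - j → ∀ a ∈ G u, (D ^ j) a = 0 →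
    ∃ b ∈ G (u - 2 * (p - j)), (D ^ (p - j)) b = a

theorem mem_grading_of_eq {G : ℤ → Submodule F M} {u u' : ℤ} {a : M} (ha : a ∈ G u) (h : u = u') :
    a ∈ G u' := h ▸ ha

/-- Being balanced passes to direct summands. -/
theorem Balanced.of_retract {p : ℕ} {D : Module.End F M} {G : ℤ → Submodule F M}
    {D' : Module.End F M'} {G' : ℤ → Submodule F M'} (h : Balanced p D' G')
    (hD : ∀ u, ∀ a ∈ G u, D a ∈ G (u + 2)) (hD' : ∀ u, ∀ a ∈ G' u, D' a ∈ G' (u + 2))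
    (s : M →ₗ[F] M') (r : M' →ₗ[F] M)
    (hs : ∀ u, ∀ a ∈ G u, s a ∈ G' u) (hr : ∀ u, ∀ a ∈ G' u, r a ∈ G u)
    (hsD : ∀ u, ∀ a ∈ G u, s (D a) = D' (s a)) (hrD : ∀ u, ∀ a ∈ G' u, r (D' a) = D (r a))
    {c : F} (hc : c ≠ 0) (hrs : ∀ u, ∀ a ∈ G u, r (s a) = c • a) : Balanced p D G := by
  have hs' : ∀ (m : ℕ) u, ∀ a ∈ G u, s ((D ^ m) a) = (D' ^ m) (s a) := by
    intro m
    induction m with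
    | zero => exact fun _ _ _ => rfl
    | succ m ih =>
      intro u a ha
      rw [pow_succ, Module.End.mul_apply, ih _ _ (hD u a ha), hsD u a ha, pow_succ,
        Module.End.mul_apply]
  have hr' : ∀ (m : ℕ) u, ∀ a ∈ G' u, r ((D' ^ m) a) = (D ^ m) (r a) := by
    intro m
    induction m with
    | zero => exact fun _ _ _ => rfl
    | succ m ih =>
      intro u a ha
      rw [pow_succ, Module.End.mul_apply, ih _ _ (hD' u a ha), hrD u a ha, pow_succ,
        Module.End.mul_apply]
  intro j hj u hu a ha haj
  obtain ⟨b, hb, hb'⟩ := h j hj u hu (s a) (hs u a ha) (by rw [← hs' j u a ha, haj, map_zero])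
  refine ⟨c⁻¹ • r b, Submodule.smul_mem _ _ (hr _ b hb), ?_⟩
  rw [map_smul, ← hr' _ _ b hb, hb', hrs u a ha, smul_smul, inv_mul_cancel₀ hc, one_smul]

/-- The operator on `M ⊗ V_2`, written as `M x ⊕ M z`, where the operator on `V_2` maps `z` to `x`
and `x` to `0`. -/
def prodOp (D : Module.End F M) : Module.End F (M × M) :=
  LinearMap.prod (D ∘ₗ LinearMap.fst F M M + LinearMap.snd F M M) (D ∘ₗ LinearMap.snd F M M)

theorem prodOp_apply (D : Module.End F M) (v : M × M) : prodOp D v = (D v.1 + v.2, D v.2) := rfl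

theorem prodOp_pow_succ_apply (D : Module.End F M) (m : ℕ) (v : M × M) :
    (prodOp D ^ (m + 1)) v
      = ((D ^ (m + 1)) v.1 + ((m + 1 : ℕ) : F) • (D ^ m) v.2, (D ^ (m + 1)) v.2) := by
  induction m with
  | zero =>
    simp only [zero_add, pow_one, prodOp_apply, Nat.cast_one, one_smul, pow_zero,
      Module.End.one_apply]
  | succ m ih =>
    rw [pow_succ', Module.End.mul_apply, ih, prodOp_apply]
    refine Prod.ext ?_ ?_
    · simp only [map_add, map_smul]
      rw [← Module.End.mul_apply, ← Module.End.mul_apply, ← pow_succ', ← pow_succ']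
      push_cast
      module
    · simp only
      rw [← Module.End.mul_apply, ← pow_succ']

/-- The grading on `M ⊗ V_2`, where `x` has weight `1` and `z` has weight `-1`. -/
def prodGrading (G : ℤ → Submodule F M) (u : ℤ) : Submodule F (M × M) :=
  (G (u - 1)).prod (G (u + 1))

theorem prodOp_mem {D : Module.End F M} {G : ℤ → Submodule F M}
    (hD : ∀ u, ∀ a ∈ G u, D a ∈ G (u + 2)) (u : ℤ) (v : M × M) (hv : v ∈ prodGrading G u) :
    prodOp D v ∈ prodGrading G (u + 2) := by
  obtain ⟨h1, h2⟩ := Submodule.mem_prod.mp hv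
  refine Submodule.mem_prod.mpr ⟨Submodule.add_mem _ ?_ ?_, ?_⟩
  · exact mem_grading_of_eq (hD _ _ h1) (by ring)
  · exact mem_grading_of_eq (h2) (by ring)
  · exact mem_grading_of_eq (hD _ _ h2) (by ring)

/-- Being balanced is stable under tensoring with `V_2`. -/
theorem Balanced.prod {p : ℕ} [Fact p.Prime] [CharP F p] {D : Module.End F M}
    {G : ℤ → Submodule F M} (h : Balanced p D G) (hD : ∀ u, ∀ a ∈ G u, D a ∈ G (u + 2)) :
    Balanced p (prodOp D) (prodGrading G) := by
  intro j hj u hu v hv hjv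
  rcases j with _ | j
  · exact ⟨0, Submodule.zero_mem _, by rw [map_zero]; exact hjv.symm⟩
  rcases hj.eq_or_lt with hj' | hj'
  · refine ⟨v, ?_, by rw [← hj', Nat.sub_self]; rfl⟩
    rw [hj', sub_self, mul_zero, sub_zero]
    exact hv
  obtain ⟨m, hm⟩ : ∃ m, p = m + 1 + (j + 1) := ⟨p - 1 - (j + 1), by omega⟩
  have hjF : ((j + 1 : ℕ) : F) ≠ 0 := by
    rw [Ne, CharP.cast_eq_zero_iff F p]
    exact Nat.not_dvd_of_pos_of_lt (Nat.succ_pos j) hj'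
  have hmF : ((m + 1 : ℕ) : F) = - ((j + 1 : ℕ) : F) := by
    rw [eq_neg_iff_add_eq_zero, ← Nat.cast_add, ← hm, CharP.cast_eq_zero]
  obtain ⟨a, b⟩ := v
  obtain ⟨ha, hb⟩ := Submodule.mem_prod.mp hv
  simp only at ha hb
  rw [prodOp_pow_succ_apply] at hjv
  simp only [Prod.mk_eq_zero] at hjv
  obtain ⟨h1, h2⟩ := hjv
  push_cast at hu
  have h3 : (D ^ (j + 2)) a = 0 := by
    have := congrArg D h1
    rw [map_add, map_smul, map_zero, ← Module.End.mul_apply, ← Module.End.mul_apply, ← pow_succ',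
      ← pow_succ', h2, smul_zero, add_zero] at this
    exact this
  obtain ⟨α, hα, hα'⟩ := h (j + 2) (by omega) (u - 1) (by push_cast; linarith) a ha h3
  have h4 : (D ^ j) (b + ((j + 1 : ℕ) : F)⁻¹ • D a) = 0 := by
    have : (D ^ j) (D a) = (D ^ (j + 1)) a := by rw [pow_succ, Module.End.mul_apply]
    rw [map_add, map_smul, this, eq_neg_of_add_eq_zero_left h1, smul_neg, smul_smul,
      inv_mul_cancel₀ hjF, one_smul, add_neg_cancel]
  have hb' : b + ((j + 1 : ℕ) : F)⁻¹ • D a ∈ G (u + 1) := by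
    refine Submodule.add_mem _ hb (Submodule.smul_mem _ _ ?_)
    exact mem_grading_of_eq (hD _ _ ha) (by ring)
  obtain ⟨γ, hγ, hγ'⟩ := h j (by omega) (u + 1) (by linarith) _ hb' h4
  have e1 : p - (j + 2) = m := by omega
  have e2 : p - j = m + 1 + 1 := by omega
  have e3 : p - (j + 1) = m + 1 := by omega
  rw [e1] at hα'
  rw [e2] at hγ'
  rw [e3]
  -- with `n = j + 1`: `D ^ (p - n - 1) α = a` and `D ^ (p - n + 1) γ = b + n⁻¹ • D a`, and the
  -- coefficient in `prodOp_pow_succ_apply` is `p - n = -n`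
  refine ⟨(((j + 1 : ℕ) : F) • γ, - (((j + 1 : ℕ) : F)⁻¹ • α) + D γ),
    Submodule.mem_prod.mpr ⟨Submodule.smul_mem _ _ ?_, Submodule.add_mem _
      (Submodule.neg_mem _ (Submodule.smul_mem _ _ ?_)) ?_⟩, ?_⟩
  · exact mem_grading_of_eq (hγ) (by push_cast; ring)
  · exact mem_grading_of_eq (hα) (by push_cast; ring)
  · exact mem_grading_of_eq (hD _ _ hγ) (by push_cast; ring)
  · rw [prodOp_pow_succ_apply, hmF]
    have e4 : (D ^ m) (D γ) = (D ^ (m + 1)) γ := by rw [pow_succ, Module.End.mul_apply]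
    have e5 : (D ^ (m + 1)) (D γ) = b + ((j + 1 : ℕ) : F)⁻¹ • D a := by
      rw [← hγ', pow_succ _ (m + 1), Module.End.mul_apply]
    have e6 : (D ^ (m + 1)) α = D a := by rw [pow_succ', Module.End.mul_apply, hα']
    refine Prod.ext ?_ ?_
    · simp only [map_add, map_neg, map_smul, e4, hα']
      rw [smul_add, smul_neg, neg_smul, neg_neg, smul_smul, mul_inv_cancel₀ hjF, one_smul, neg_smul]
      abel
    · simp only [map_add, map_neg, map_smul, e5, e6]
      abel

/-- The operator on `M ⊗ V`, where `V` has a basis indexed by `ℕ` and the operator on `V` maps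
each basis vector to the preceding one; elements are given by their coefficients. -/
def seqOp (D : Module.End F M) : Module.End F (ℕ → M) :=
  LinearMap.pi fun b => D ∘ₗ LinearMap.proj (φ := fun _ : ℕ => M) b
    + LinearMap.proj (φ := fun _ : ℕ => M) (b + 1)

theorem seqOp_apply (D : Module.End F M) (v : ℕ → M) (b : ℕ) :
    seqOp D v b = D (v b) + v (b + 1) := rfl

/-- The grading on `M ⊗ V_n`, as a space of sequences supported in `{0, …, n - 1}`: the basis vector
`b` of `V_n` has weight `n - 1 - 2 b`. -/
def seqGrading (G : ℤ → Submodule F M) (n : ℕ) (u : ℤ) : Submodule F (ℕ → M) where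
  carrier := {v | (∀ b < n, v b ∈ G (u - (n - 1) + 2 * b)) ∧ ∀ b, n ≤ b → v b = 0}
  zero_mem' := ⟨fun _ _ => Submodule.zero_mem _, fun _ _ => rfl⟩
  add_mem' := fun {v w} hv hw => ⟨fun b hb => Submodule.add_mem _ (hv.1 b hb) (hw.1 b hb),
    fun b hb => by rw [Pi.add_apply, hv.2 b hb, hw.2 b hb, add_zero]⟩
  smul_mem' := fun c v hv => ⟨fun b hb => Submodule.smul_mem _ _ (hv.1 b hb),
    fun b hb => by rw [Pi.smul_apply, hv.2 b hb, smul_zero]⟩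

theorem seqOp_mem {D : Module.End F M} {G : ℤ → Submodule F M}
    (hD : ∀ u, ∀ a ∈ G u, D a ∈ G (u + 2)) (n : ℕ) (u : ℤ) (v : ℕ → M)
    (hv : v ∈ seqGrading G n u) : seqOp D v ∈ seqGrading G n (u + 2) := by
  refine ⟨fun b hb => Submodule.add_mem _ ?_ ?_, fun b hb => ?_⟩
  · exact mem_grading_of_eq (hD _ _ (hv.1 b hb)) (by ring)
  · by_cases hb' : b + 1 < n
    · exact mem_grading_of_eq (hv.1 _ hb') (by push_cast; ring)
    · change v (b + 1) ∈ _
      rw [hv.2 _ (by omega)]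
      exact Submodule.zero_mem _
  · rw [seqOp_apply, hv.2 b hb, hv.2 _ (by omega), map_zero, add_zero]

/-- Being balanced is stable under tensoring with `V_n` for `1 ≤ n ≤ p`: the case of `V_2` is a
computation, and `V_{n + 1}` is a direct summand of `V_n ⊗ V_2` when `n` is invertible. -/
theorem Balanced.seq {p : ℕ} [Fact p.Prime] [CharP F p] {D : Module.End F M}
    {G : ℤ → Submodule F M} (h : Balanced p D G) (hD : ∀ u, ∀ a ∈ G u, D a ∈ G (u + 2))
    {n : ℕ} (hn : n + 1 ≤ p) : Balanced p (seqOp D) (seqGrading G (n + 1)) := by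
  induction n with
  | zero =>
    refine h.of_retract (seqOp_mem hD _) hD (LinearMap.proj 0) (LinearMap.single F (fun _ : ℕ => M) 0)
      ?_ ?_ ?_ ?_ one_ne_zero ?_
    · intro u v hv
      simpa using hv.1 0 one_pos
    · intro u a ha
      refine ⟨fun b hb => ?_, fun b hb => ?_⟩
      · obtain rfl : b = 0 := by omega
        simpa using ha
      · exact Pi.single_eq_of_ne (by omega) _
    · intro u v hv
      change D (v 0) + v (0 + 1) = D (v 0)
      rw [hv.2 (0 + 1) le_rfl, add_zero]
    · intro u a ha
      funext b
      rw [seqOp_apply]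
      change Pi.single (M := fun _ => M) 0 (D a) b = D (Pi.single (M := fun _ => M) 0 a b)
        + Pi.single (M := fun _ => M) 0 a (b + 1)
      rw [Pi.single_eq_of_ne (Nat.succ_ne_zero b), add_zero]
      rcases b with _ | b
      · rw [Pi.single_eq_same, Pi.single_eq_same]
      · rw [Pi.single_eq_of_ne (Nat.succ_ne_zero b), Pi.single_eq_of_ne (Nat.succ_ne_zero b),
          map_zero]
    · intro u v hv
      funext b
      change Pi.single (M := fun _ => M) 0 (v 0) b = (1 : F) • v b
      rw [one_smul]
      rcases b with _ | b
      · rw [Pi.single_eq_same]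
      · rw [Pi.single_eq_of_ne (Nat.succ_ne_zero b), hv.2 _ (by omega)]
  | succ n ih =>
    have hnF : ((n + 1 : ℕ) : F) ≠ 0 := by
      rw [Ne, CharP.cast_eq_zero_iff F p]
      exact Nat.not_dvd_of_pos_of_lt (Nat.succ_pos n) (by omega)
    let s : (ℕ → M) →ₗ[F] (ℕ → M) × (ℕ → M) := LinearMap.prod
      (LinearMap.pi fun b => (((n + 1 : ℕ) : F) - b) • LinearMap.proj b)
      (LinearMap.pi fun b => LinearMap.proj (b + 1))
    let r : (ℕ → M) × (ℕ → M) →ₗ[F] (ℕ → M) := LinearMap.pi fun b =>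
      LinearMap.proj b ∘ₗ LinearMap.fst F _ _
        + (b : F) • (LinearMap.proj (b - 1) ∘ₗ LinearMap.snd F _ _)
    have hs1 : ∀ v b, (s v).1 b = (((n + 1 : ℕ) : F) - b) • v b := fun _ _ => rfl
    have hs2 : ∀ v b, (s v).2 b = v (b + 1) := fun _ _ => rfl
    have hr1 : ∀ w b, r w b = w.1 b + (b : F) • w.2 (b - 1) := fun _ _ => rfl
    refine ((ih (by omega)).prod (seqOp_mem hD _)).of_retract (seqOp_mem hD _)
      (prodOp_mem (seqOp_mem hD _)) s r ?_ ?_ ?_ ?_ hnF ?_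
    · intro u v hv
      refine Submodule.mem_prod.mpr ⟨⟨fun b hb => ?_, fun b hb => ?_⟩, ⟨fun b hb => ?_,
        fun b hb => ?_⟩⟩
      · rw [hs1]
        refine Submodule.smul_mem _ _ ?_
        exact mem_grading_of_eq (hv.1 b (by omega)) (by push_cast; ring)
      · rw [hs1]
        rcases hb.eq_or_lt with rfl | hb'
        · rw [sub_self, zero_smul]
        · rw [hv.2 b (by omega), smul_zero]
      · rw [hs2]
        exact mem_grading_of_eq (hv.1 (b + 1) (by omega)) (by push_cast; ring)
      · rw [hs2, hv.2 _ (by omega)]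
    · intro u w hw
      obtain ⟨h1, h2⟩ := Submodule.mem_prod.mp hw
      refine ⟨fun b hb => ?_, fun b hb => ?_⟩
      · rw [hr1]
        refine Submodule.add_mem _ ?_ ?_
        · by_cases hb' : b < n + 1
          · exact mem_grading_of_eq (h1.1 b hb') (by push_cast; ring)
          · rw [h1.2 b (by omega)]
            exact Submodule.zero_mem _
        · rcases b with _ | b
          · have h0 : ((0 : ℕ) : F) • w.2 (0 - 1) = 0 := by rw [Nat.cast_zero, zero_smul]
            rw [h0]
            exact Submodule.zero_mem _
          · refine Submodule.smul_mem _ _ ?_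
            rw [Nat.add_sub_cancel]
            exact mem_grading_of_eq (h2.1 b (by omega)) (by push_cast; ring)
      · rw [hr1, h1.2 b (by omega), h2.2 (b - 1) (by omega), smul_zero, add_zero]
    · intro u v hv
      refine Prod.ext ?_ ?_
      · funext b
        change (s (seqOp D v)).1 b = seqOp D (s v).1 b + (s v).2 b
        rw [hs1, seqOp_apply, seqOp_apply, hs1, hs1, hs2, map_smul]
        push_cast
        module
      · funext b
        change (s (seqOp D v)).2 b = seqOp D (s v).2 b
        rw [hs2, seqOp_apply, seqOp_apply, hs2, hs2]
    · intro u w hw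
      funext b
      rw [hr1, prodOp_apply, seqOp_apply, hr1, hr1]
      simp only [Pi.add_apply, seqOp_apply, map_add, map_smul, Nat.add_sub_cancel]
      rcases b with _ | b
      · simp only [Nat.cast_zero, zero_smul, add_zero, Nat.cast_succ, zero_add, one_smul]
        abel
      · simp only [Nat.add_sub_cancel]
        push_cast
        module
    · intro u v hv
      funext b
      rw [hr1, hs1, hs2, Pi.smul_apply]
      rcases b with _ | b
      · simp
      · rw [Nat.add_sub_cancel, ← add_smul, sub_add_cancel]

end Balanced

section Weights

open MvPolynomial

variable {F : Type*} [Field F] {ι : Type*} {q : ι → ℕ} {p : ℕ}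

/-! ### Weights on the polynomial ring -/

/-- The degree of a monomial in the variables of the block `i`. -/
def blockDeg (i : ι) (m : Var q →₀ ℕ) : ℕ := ∑ b : Fin (q i + 1), m ⟨i, b⟩

/-- The weight of a monomial; the variables of the block `i` have the weights
`q i, q i - 2, …, - q i`, from bottom to top. -/
def wt : (Var q →₀ ℕ) →+ ℤ :=
  Finsupp.liftAddHom fun j => (q j.1 - 2 * j.2 : ℤ) • Nat.castAddMonoidHom ℤ

theorem blockDeg_add (i : ι) (m m' : Var q →₀ ℕ) :
    blockDeg i (m + m') = blockDeg i m + blockDeg i m' := by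
  simp [blockDeg, Finset.sum_add_distrib]

theorem blockDeg_single [DecidableEq ι] (i : ι) (j : Var q) (e : ℕ) :
    blockDeg i (Finsupp.single j e) = if j.1 = i then e else 0 := by
  unfold blockDeg
  split_ifs with h
  · subst h
    rw [Finset.sum_eq_single j.2]
    · exact Finsupp.single_eq_same
    · intro b _ hb
      refine Finsupp.single_eq_of_ne fun h => hb ?_
      have := congrArg (fun x : Var q => (x.2 : ℕ)) h
      exact Fin.ext this
    · simp
  · refine Finset.sum_eq_zero fun b _ => Finsupp.single_eq_of_ne ?_
    rintro rfl
    exact h rfl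

theorem wt_single (j : Var q) (e : ℕ) :
    wt (Finsupp.single j e) = (q j.1 - 2 * j.2 : ℤ) * e := by
  simp [wt]

/-- The polynomials of multidegree `c` with respect to the blocks and of weight `u`. -/
def wtHom (F : Type*) [Field F] {ι : Type*} {q : ι → ℕ} (c : ι → ℕ) (u : ℤ) :
    Submodule F (MvPolynomial (Var q) F) :=
  restrictSupport F {m | (∀ i, blockDeg i m = c i) ∧ wt m = u}

/-- The polynomials of multidegree `c` with respect to the blocks, with all weights at least `u`. -/
def wtGe (F : Type*) [Field F] {ι : Type*} {q : ι → ℕ} (c : ι → ℕ) (u : ℤ) :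
    Submodule F (MvPolynomial (Var q) F) :=
  restrictSupport F {m | (∀ i, blockDeg i m = c i) ∧ u ≤ wt m}

theorem wtHom_le_wtGe (c : ι → ℕ) (u : ℤ) : wtHom F (q := q) c u ≤ wtGe F c u :=
  restrictSupport_mono F fun _ hm => And.intro hm.1 hm.2.ge

theorem wtGe_anti (c : ι → ℕ) {u u' : ℤ} (h : u ≤ u') : wtGe F (q := q) c u' ≤ wtGe F c u :=
  restrictSupport_mono F fun _ hm => And.intro hm.1 (h.trans hm.2)

theorem wtGe_mul {c c' : ι → ℕ} {u u' : ℤ} {f g : MvPolynomial (Var q) F} (hf : f ∈ wtGe F c u)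
    (hg : g ∈ wtGe F c' u') : f * g ∈ wtGe F (c + c') (u + u') :=
  restrictSupport_mul_mem hf hg fun m hm m' hm' =>
    And.intro (fun i => by rw [blockDeg_add, hm.1, hm'.1, Pi.add_apply])
      (by rw [map_add]; exact add_le_add hm.2 hm'.2)

/-- The derivation of the polynomial ring which maps each variable to the variable below it, and
the bottom variables to zero. -/
def lowDer (F : Type*) [Field F] {ι : Type*} (q : ι → ℕ) :
    Derivation F (MvPolynomial (Var q) F) (MvPolynomial (Var q) F) :=
  mkDerivation F fun j => if 0 < (j.2 : ℕ) then X (low j) else 0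

theorem lowDer_X (j : Var q) :
    lowDer F q (X j) = if 0 < (j.2 : ℕ) then X (low j) else 0 := by
  simp [lowDer]

/-- `lowDer` as a linear map. -/
abbrev lowOp (F : Type*) [Field F] {ι : Type*} (q : ι → ℕ) :
    Module.End F (MvPolynomial (Var q) F) := (lowDer F q).toLinearMap

theorem wt_low {j : Var q} (hj : 0 < (j.2 : ℕ)) :
    wt (Finsupp.single (low j) 1) = wt (Finsupp.single j 1) + 2 := by
  rw [wt_single, wt_single, low_snd, low_fst, Nat.cast_sub hj]
  push_cast
  ring

theorem mem_wtGe_mul {c c' : ι → ℕ} {u u' v : ℤ} {f g : MvPolynomial (Var q) F}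
    (hf : f ∈ wtGe F c u) (hg : g ∈ wtGe F c' u') (h : v ≤ u + u') : f * g ∈ wtGe F (c + c') v :=
  wtGe_anti _ h (wtGe_mul hf hg)

/-- The leading term of `diffOp` with respect to the weight is the derivation `lowDer`. -/
theorem diffOp_monomial_mem (m : Var q →₀ ℕ) :
    diffOp (jordanAut F 0) (monomial m 1) ∈ wtGe F (fun i => blockDeg i m) (wt m + 2) ∧
    diffOp (jordanAut F 0) (monomial m 1) - lowDer F q (monomial m 1)
      ∈ wtGe F (fun i => blockDeg i m) (wt m + 4) := by
  classical
  have hmon : ∀ m : Var q →₀ ℕ, monomial m (1 : F) ∈ wtGe F (fun i => blockDeg i m) (wt m) :=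
    fun m => (monomial_mem_restrictSupport F).mpr (Or.inl ⟨fun _ => rfl, le_rfl⟩)
  have hone : diffOp (jordanAut F 0) (monomial (0 : Var q →₀ ℕ) (1 : F)) = 0 ∧
      lowDer F q (monomial 0 1) = 0 := by
    have h1 : (monomial (0 : Var q →₀ ℕ) (1 : F)) = 1 := rfl
    rw [h1, diffOp_apply, map_one, sub_self, Derivation.map_one_eq_zero]
    exact ⟨rfl, rfl⟩
  have hadd : ∀ a b : Var q →₀ ℕ,
      (diffOp (jordanAut F 0) (monomial a 1) ∈ wtGe F (fun i => blockDeg i a) (wt a + 2) ∧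
      diffOp (jordanAut F 0) (monomial a 1) - lowDer F q (monomial a 1)
        ∈ wtGe F (fun i => blockDeg i a) (wt a + 4)) →
      (diffOp (jordanAut F 0) (monomial b 1) ∈ wtGe F (fun i => blockDeg i b) (wt b + 2) ∧
      diffOp (jordanAut F 0) (monomial b 1) - lowDer F q (monomial b 1)
        ∈ wtGe F (fun i => blockDeg i b) (wt b + 4)) →
      (diffOp (jordanAut F 0) (monomial (a + b) 1)
        ∈ wtGe F (fun i => blockDeg i (a + b)) (wt (a + b) + 2) ∧
      diffOp (jordanAut F 0) (monomial (a + b) 1) - lowDer F q (monomial (a + b) 1)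
        ∈ wtGe F (fun i => blockDeg i (a + b)) (wt (a + b) + 4)) := by
    rintro a b ⟨ha1, ha2⟩ ⟨hb1, hb2⟩
    have hc : (fun i => blockDeg i (a + b)) = (fun i => blockDeg i a) + fun i => blockDeg i b :=
      funext fun i => blockDeg_add i a b
    have hab : monomial (a + b) (1 : F) = monomial a 1 * monomial b 1 := by
      rw [monomial_mul, one_mul]
    rw [hc, hab, map_add]
    have h1 : diffOp (jordanAut F 0) (monomial a 1 * monomial b (1 : F))
        = monomial a 1 * diffOp (jordanAut F 0) (monomial b 1)
          + diffOp (jordanAut F 0) (monomial a 1) * monomial b 1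
          + diffOp (jordanAut F 0) (monomial a 1) * diffOp (jordanAut F 0) (monomial b 1) := by
      simp only [diffOp_apply, map_mul]
      ring
    have h2 : diffOp (jordanAut F 0) (monomial a 1 * monomial b (1 : F))
        - lowDer F q (monomial a 1 * monomial b 1)
        = monomial a 1 * (diffOp (jordanAut F 0) (monomial b 1) - lowDer F q (monomial b 1))
          + (diffOp (jordanAut F 0) (monomial a 1) - lowDer F q (monomial a 1)) * monomial b 1
          + diffOp (jordanAut F 0) (monomial a 1) * diffOp (jordanAut F 0) (monomial b 1) := by
      rw [h1, Derivation.leibniz, smul_eq_mul, smul_eq_mul]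
      ring
    rw [h2, h1]
    exact ⟨Submodule.add_mem _ (Submodule.add_mem _ (mem_wtGe_mul (hmon a) hb1 (by linarith))
      (mem_wtGe_mul ha1 (hmon b) (by linarith))) (mem_wtGe_mul ha1 hb1 (by linarith)),
      Submodule.add_mem _ (Submodule.add_mem _ (mem_wtGe_mul (hmon a) hb2 (by linarith))
      (mem_wtGe_mul ha2 (hmon b) (by linarith))) (mem_wtGe_mul ha1 hb1 (by linarith))⟩
  have hzero : diffOp (jordanAut F 0) (monomial (0 : Var q →₀ ℕ) 1)
        ∈ wtGe F (fun i => blockDeg i (0 : Var q →₀ ℕ)) (wt (0 : Var q →₀ ℕ) + 2) ∧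
      diffOp (jordanAut F 0) (monomial (0 : Var q →₀ ℕ) 1) - lowDer F q (monomial 0 1)
        ∈ wtGe F (fun i => blockDeg i (0 : Var q →₀ ℕ)) (wt (0 : Var q →₀ ℕ) + 4) := by
    rw [hone.1, hone.2, sub_zero]
    exact ⟨Submodule.zero_mem _, Submodule.zero_mem _⟩
  induction m using Finsupp.induction_linear with
  | zero => exact hzero
  | add a b ha hb => exact hadd a b ha hb
  | single j e =>
    induction e with
    | zero => rw [Finsupp.single_zero]; exact hzero
    | succ e ih =>
      rw [Finsupp.single_add]
      refine hadd _ _ ih ?_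
      change diffOp (jordanAut F 0) (X j) ∈ _ ∧ diffOp (jordanAut F 0) (X j) - lowDer F q (X j) ∈ _
      rw [diffOp_jordanAut_X, lowDer_X]
      simp only [Pi.zero_apply, sub_self]
      refine ⟨?_, Submodule.zero_mem _⟩
      split_ifs with h
      · refine X_mem_restrictSupport ⟨fun i => ?_, ?_⟩
        · change blockDeg i _ = blockDeg i _
          rw [blockDeg_single, blockDeg_single, low_fst]
        · rw [wt_low h]
      · exact Submodule.zero_mem _

theorem lowDer_mem_wtHom {c : ι → ℕ} (u : ℤ) (f : MvPolynomial (Var q) F) (hf : f ∈ wtHom F c u) :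
    lowDer F q f ∈ wtHom F c (u + 2) := by
  classical
  have key : ∀ m : Var q →₀ ℕ, lowDer F q (monomial m 1)
      ∈ wtHom F (fun i => blockDeg i m) (wt m + 2) := by
    have hmul : ∀ {c c' : ι → ℕ} {u u' v : ℤ} {f g : MvPolynomial (Var q) F},
        f ∈ wtHom F c u → g ∈ wtHom F c' u' → u + u' = v → f * g ∈ wtHom F (c + c') v := by
      intro c c' u u' v f g hf hg huv
      exact restrictSupport_mul_mem hf hg fun m hm m' hm' =>
        And.intro (fun i => by rw [blockDeg_add, hm.1, hm'.1, Pi.add_apply])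
          (by rw [map_add, hm.2, hm'.2, huv])
    have hmon : ∀ m : Var q →₀ ℕ, monomial m (1 : F) ∈ wtHom F (fun i => blockDeg i m) (wt m) :=
      fun m => (monomial_mem_restrictSupport F).mpr (Or.inl ⟨fun _ => rfl, rfl⟩)
    have hadd : ∀ a b : Var q →₀ ℕ,
        lowDer F q (monomial a 1) ∈ wtHom F (fun i => blockDeg i a) (wt a + 2) →
        lowDer F q (monomial b 1) ∈ wtHom F (fun i => blockDeg i b) (wt b + 2) →
        lowDer F q (monomial (a + b) 1)
          ∈ wtHom F (fun i => blockDeg i (a + b)) (wt (a + b) + 2) := by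
      intro a b ha hb
      have hc : (fun i => blockDeg i (a + b)) = (fun i => blockDeg i b) + fun i => blockDeg i a :=
        funext fun i => by rw [blockDeg_add, Pi.add_apply, add_comm]
      have hab : monomial (a + b) (1 : F) = monomial a 1 * monomial b 1 := by
        rw [monomial_mul, one_mul]
      rw [hab, Derivation.leibniz, smul_eq_mul, smul_eq_mul, hc, map_add]
      refine Submodule.add_mem _ ?_ (hmul (hmon b) ha (by ring))
      rw [add_comm (fun i => blockDeg i b)]
      exact hmul (hmon a) hb (by ring)
    have hzero : lowDer F q (monomial (0 : Var q →₀ ℕ) 1)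
        ∈ wtHom F (fun i => blockDeg i (0 : Var q →₀ ℕ)) (wt (0 : Var q →₀ ℕ) + 2) := by
      have h1 : (monomial (0 : Var q →₀ ℕ) (1 : F)) = 1 := rfl
      rw [h1, Derivation.map_one_eq_zero]
      exact Submodule.zero_mem _
    intro m
    induction m using Finsupp.induction_linear with
    | zero => exact hzero
    | add a b ha hb => exact hadd a b ha hb
    | single j e =>
      induction e with
      | zero => rw [Finsupp.single_zero]; exact hzero
      | succ e ih =>
        rw [Finsupp.single_add]
        refine hadd _ _ ih ?_
        change lowDer F q (X j) ∈ _
        rw [lowDer_X]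
        split_ifs with h
        · refine X_mem_restrictSupport ⟨fun i => ?_, ?_⟩
          · change blockDeg i _ = blockDeg i _
            rw [blockDeg_single, blockDeg_single, low_fst]
          · rw [wt_low h]
        · exact Submodule.zero_mem _
  have hle : wtHom F (q := q) c u ≤ (wtHom F c (u + 2)).comap (lowOp F q) := by
    conv_lhs => rw [wtHom, restrictSupport_eq_span]
    rw [Submodule.span_le]
    rintro _ ⟨m, ⟨hm1, rfl⟩, rfl⟩
    obtain rfl : (fun i => blockDeg i m) = c := funext hm1
    exact key m
  exact hle hf

theorem diffOp_mem_wtGe {c : ι → ℕ} {u : ℤ} {f : MvPolynomial (Var q) F} (hf : f ∈ wtGe F c u) :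
    diffOp (jordanAut F 0) f ∈ wtGe F c (u + 2) ∧
      diffOp (jordanAut F 0) f - lowOp F q f ∈ wtGe F c (u + 4) := by
  have hle : wtGe F (q := q) c u ≤ (wtGe F c (u + 2)).comap (diffOp (jordanAut F 0)) ⊓
      (wtGe F c (u + 4)).comap (diffOp (jordanAut F 0) - lowOp F q) := by
    conv_lhs => rw [wtGe, restrictSupport_eq_span]
    rw [Submodule.span_le]
    rintro _ ⟨m, ⟨hm1, hm2⟩, rfl⟩
    obtain rfl : (fun i => blockDeg i m) = c := funext hm1
    have := diffOp_monomial_mem (F := F) m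
    exact ⟨wtGe_anti _ (by linarith) this.1, wtGe_anti _ (by linarith) this.2⟩
  exact hle hf

theorem diffOp_pow_mem_wtGe {c : ι → ℕ} {u : ℤ} {f : MvPolynomial (Var q) F} (hf : f ∈ wtGe F c u)
    (m : ℕ) : (diffOp (jordanAut F 0) ^ m) f ∈ wtGe F c (u + 2 * m) := by
  induction m with
  | zero => simpa using hf
  | succ m ih =>
    rw [pow_succ', Module.End.mul_apply]
    exact wtGe_anti _ (by push_cast; linarith) (diffOp_mem_wtGe ih).1

theorem lowOp_pow_mem_wtHom {c : ι → ℕ} {u : ℤ} {f : MvPolynomial (Var q) F} (hf : f ∈ wtHom F c u)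
    (m : ℕ) : (lowOp F q ^ m) f ∈ wtHom F c (u + 2 * m) := by
  induction m with
  | zero => simpa using hf
  | succ m ih =>
    rw [pow_succ', Module.End.mul_apply]
    exact mem_grading_of_eq (G := wtHom F c) (lowDer_mem_wtHom _ _ ih) (by push_cast; ring)

theorem diffOp_pow_sub_mem_wtGe {c : ι → ℕ} {u : ℤ} {f : MvPolynomial (Var q) F}
    (hf : f ∈ wtHom F c u) (m : ℕ) :
    (diffOp (jordanAut F 0) ^ m) f - (lowOp F q ^ m) f ∈ wtGe F c (u + 2 * m + 2) := by
  induction m with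
  | zero => simp
  | succ m ih =>
    have h : (diffOp (jordanAut F 0) ^ (m + 1)) f - (lowOp F q ^ (m + 1)) f
        = diffOp (jordanAut F 0) ((diffOp (jordanAut F 0) ^ m) f - (lowOp F q ^ m) f)
          + (diffOp (jordanAut F 0) ((lowOp F q ^ m) f) - lowOp F q ((lowOp F q ^ m) f)) := by
      rw [pow_succ', pow_succ', Module.End.mul_apply, Module.End.mul_apply, map_sub]
      ring
    rw [h]
    exact Submodule.add_mem _ (wtGe_anti _ (by push_cast; linarith) (diffOp_mem_wtGe ih).1)
      (wtGe_anti _ (by push_cast; linarith)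
        (diffOp_mem_wtGe (wtHom_le_wtGe _ _ (lowOp_pow_mem_wtHom hf m))).2)

/-! ### The multigraded pieces of the polynomial ring are balanced -/

/-- The commutator of `lowDer` with the partial derivative for the variable `b` of a block is the
partial derivative for the variable `b + 1`. -/
theorem pderiv_lowDer [DecidableEq ι] (i : ι) (b : ℕ) (hb : b < q i + 1)
    (f : MvPolynomial (Var q) F) :
    pderiv (⟨i, ⟨b, hb⟩⟩ : Var q) (lowDer F q f) = lowDer F q (pderiv ⟨i, ⟨b, hb⟩⟩ f)
      + if h : b + 1 < q i + 1 then pderiv ⟨i, ⟨b + 1, h⟩⟩ f else 0 := by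
  have key : ⁅(pderiv (⟨i, ⟨b, hb⟩⟩ : Var q) : Derivation F (MvPolynomial (Var q) F) _), lowDer F q⁆
      = if h : b + 1 < q i + 1 then pderiv ⟨i, ⟨b + 1, h⟩⟩ else 0 := by
    refine derivation_ext fun j => ?_
    have h1 : lowDer F q (pderiv ⟨i, ⟨b, hb⟩⟩ (X j)) = 0 := by
      rw [pderiv_X]
      by_cases hj : j = ⟨i, ⟨b, hb⟩⟩
      · subst hj
        rw [Pi.single_eq_same, Derivation.map_one_eq_zero]
      · rw [Pi.single_eq_of_ne hj, map_zero]
    rw [Derivation.commutator_apply, h1, sub_zero, lowDer_X]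
    have h2 : (if h : b + 1 < q i + 1 then pderiv (⟨i, ⟨b + 1, h⟩⟩ : Var q) else 0 :
        Derivation F (MvPolynomial (Var q) F) _) (X j)
        = if j.1 = i ∧ (j.2 : ℕ) = b + 1 then 1 else 0 := by
      by_cases hj : j.1 = i ∧ (j.2 : ℕ) = b + 1
      · have hlt : b + 1 < q i + 1 := by
          have := j.2.isLt
          have h3 : q j.1 = q i := congrArg q hj.1
          omega
        have hj' : j = ⟨i, ⟨b + 1, hlt⟩⟩ := Var.ext hj.1 hj.2
        rw [dif_pos hlt, if_pos hj, hj', pderiv_X_self]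
      · rw [if_neg hj]
        split_ifs with hlt
        · refine pderiv_X_of_ne ?_
          rintro rfl
          exact hj ⟨rfl, rfl⟩
        · rfl
    rw [h2]
    by_cases hj : j.1 = i ∧ (j.2 : ℕ) = b + 1
    · have hj' : low j = ⟨i, ⟨b, hb⟩⟩ := Var.ext hj.1 (by rw [low_snd, hj.2]; rfl)
      rw [if_pos hj, if_pos (by omega), hj', pderiv_X_self]
    · rw [if_neg hj]
      split_ifs with h0
      · refine pderiv_X_of_ne fun h => hj ?_
        have h3 : (low j).1 = i := congrArg Sigma.fst h
        have h4 : ((low j).2 : ℕ) = b := congrArg (fun x : Var q => (x.2 : ℕ)) h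
        rw [low_snd] at h4
        exact ⟨h3, by omega⟩
      · exact map_zero _
  have := DFunLike.congr_fun key f
  rw [Derivation.commutator_apply, sub_eq_iff_eq_add'] at this
  rw [this]
  congr 1
  split_ifs <;> rfl

/-- Euler's identity for the variables of one block. -/
theorem sum_X_mul_pderiv {c : ι → ℕ} {u : ℤ} {f : MvPolynomial (Var q) F} (hf : f ∈ wtHom F c u)
    (i : ι) : ∑ b : Fin (q i + 1), X ⟨i, b⟩ * pderiv (⟨i, b⟩ : Var q) f = (c i : F) • f := by
  have hle : wtHom F (q := q) c u ≤ LinearMap.ker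
      ((∑ b : Fin (q i + 1), LinearMap.mulLeft F (X ⟨i, b⟩) ∘ₗ (pderiv (⟨i, b⟩ : Var q)).toLinearMap)
        - (c i : F) • LinearMap.id) := by
    rw [wtHom, restrictSupport_eq_span, Submodule.span_le]
    rintro _ ⟨m, ⟨hm1, -⟩, rfl⟩
    change _ = _
    rw [LinearMap.sub_apply, LinearMap.sum_apply, sub_eq_zero]
    change ∑ b : Fin (q i + 1), X ⟨i, b⟩ * pderiv (⟨i, b⟩ : Var q) (monomial m (1 : F))
      = (c i : F) • monomial m 1
    simp_rw [X_mul_pderiv_monomial]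
    rw [← Finset.sum_smul, ← hm1 i, Nat.cast_smul_eq_nsmul]
    rfl
  have := LinearMap.mem_ker.mp (hle hf)
  rw [LinearMap.sub_apply, LinearMap.sum_apply, sub_eq_zero] at this
  exact this

theorem pderiv_mem_wtHom [DecidableEq ι] {c : ι → ℕ} {i : ι} {u : ℤ} {f : MvPolynomial (Var q) F}
    (hf : f ∈ wtHom F (Function.update c i (c i + 1)) u) (b : Fin (q i + 1)) :
    pderiv (⟨i, b⟩ : Var q) f ∈ wtHom F c (u - q i + 2 * b) := by
  have hle : wtHom F (q := q) (Function.update c i (c i + 1)) u ≤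
      (wtHom F c (u - q i + 2 * b)).comap (pderiv (⟨i, b⟩ : Var q)).toLinearMap := by
    conv_lhs => rw [wtHom, restrictSupport_eq_span]
    rw [Submodule.span_le]
    rintro _ ⟨m, ⟨hm1, hm2⟩, rfl⟩
    change pderiv (⟨i, b⟩ : Var q) (monomial m (1 : F)) ∈ wtHom F c (u - q i + 2 * b)
    rw [pderiv_monomial]
    refine (monomial_mem_restrictSupport F).mpr ?_
    by_cases h0 : m ⟨i, b⟩ = 0
    · right; rw [h0, Nat.cast_zero, mul_zero]
    left
    obtain ⟨m', rfl⟩ : ∃ m', m = m' + Finsupp.single ⟨i, b⟩ 1 :=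
      ⟨m - Finsupp.single ⟨i, b⟩ 1, (tsub_add_cancel_of_le (by
        rw [Finsupp.single_le_iff]; omega)).symm⟩
    rw [add_tsub_cancel_right]
    refine ⟨fun i' => ?_, ?_⟩
    · have := hm1 i'
      rw [blockDeg_add, blockDeg_single] at this
      change _ + (if i = i' then 1 else 0) = _ at this
      by_cases hi : i' = i
      · subst hi
        rw [Function.update_self, if_pos rfl] at this
        omega
      · rw [Function.update_of_ne hi, if_neg (Ne.symm hi)] at this
        omega
    · rw [map_add, wt_single] at hm2
      change _ + ((q i : ℤ) - 2 * b) * _ = _ at hm2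
      push_cast at hm2
      linarith
  exact hle hf

theorem X_mul_mem_wtHom [DecidableEq ι] {c : ι → ℕ} {i : ι} {u : ℤ} {f : MvPolynomial (Var q) F}
    {b : Fin (q i + 1)} (hf : f ∈ wtHom F c (u - q i + 2 * b)) :
    X ⟨i, b⟩ * f ∈ wtHom F (Function.update c i (c i + 1)) u := by
  refine restrictSupport_mul_mem ((monomial_mem_restrictSupport F
    (s := {Finsupp.single (⟨i, b⟩ : Var q) 1})).mpr (Or.inl rfl)) hf ?_
  rintro _ rfl m ⟨hm1, hm2⟩
  refine ⟨fun i' => ?_, ?_⟩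
  · rw [blockDeg_add, blockDeg_single, hm1]
    change (if i = i' then 1 else 0) + _ = _
    by_cases hi : i' = i
    · subst hi
      rw [Function.update_self, if_pos rfl, add_comm]
    · rw [Function.update_of_ne hi, if_neg (Ne.symm hi), zero_add]
  · rw [map_add, wt_single, hm2]
    change ((q i : ℤ) - 2 * b) * _ + _ = _
    push_cast
    ring

/-- The pieces of multidegree `c` with all `c i < p` are balanced: by Euler's identity, the piece of
multidegree `c + e_i` is a direct summand of the tensor product of the piece of multidegree `c`
with the space of linear forms of the block `i`. -/
theorem balanced_wtHom [Fintype ι] [Fact p.Prime] [CharP F p] (hq : ∀ i, q i < p) (c : ι → ℕ)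
    (hc : ∀ i, c i < p) : Balanced p (lowOp F q) (wtHom F c) := by
  classical
  induction hN : ∑ i, c i generalizing c with
  | zero =>
    have hc0 : ∀ i, c i = 0 := fun i => Finset.sum_eq_zero_iff.mp hN i (Finset.mem_univ i)
    intro j hj u hu a ha haj
    rcases j with _ | j
    · exact ⟨0, Submodule.zero_mem _, by rw [map_zero]; exact haj.symm⟩
    · have ha0 : a = 0 := by
        ext m
        rw [coeff_zero]
        by_contra hm
        obtain ⟨h1, h2⟩ := (mem_restrictSupport_iff_coeff.mp ha) m hm
        have : m = 0 := by
          ext ⟨i, b⟩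
          have := h1 i
          rw [hc0 i] at this
          exact Finset.sum_eq_zero_iff.mp this b (Finset.mem_univ b)
        rw [this, map_zero] at h2
        push_cast at hu
        linarith
      exact ⟨0, Submodule.zero_mem _, by rw [map_zero, ha0]⟩
  | succ N ih =>
    obtain ⟨i, hi⟩ : ∃ i, c i ≠ 0 := by
      by_contra hcon
      push Not at hcon
      rw [Finset.sum_eq_zero (fun i _ => hcon i)] at hN
      omega
    obtain ⟨c', rfl⟩ : ∃ c', c = Function.update c' i (c' i + 1) := by
      refine ⟨Function.update c i (c i - 1), ?_⟩
      rw [Function.update_self, Function.update_idem, Nat.sub_add_cancel (by omega),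
        Function.update_eq_self]
    have hc' : ∀ i', c' i' < p := fun i' => by
      have := hc i'
      by_cases hii : i' = i
      · subst hii
        rw [Function.update_self] at this
        omega
      · rwa [Function.update_of_ne hii] at this
    have hci := hc i
    rw [Function.update_self] at hci
    have hN' : ∑ i, c' i = N := by
      rw [Finset.sum_update_of_mem (Finset.mem_univ i), ← Finset.erase_eq] at hN
      rw [← Finset.add_sum_erase _ _ (Finset.mem_univ i)]
      omega
    have hcF : ((c' i + 1 : ℕ) : F) ≠ 0 := by
      rw [Ne, CharP.cast_eq_zero_iff F p]
      exact Nat.not_dvd_of_pos_of_lt (Nat.succ_pos _) hci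
    have hD : ∀ (c : ι → ℕ) (u : ℤ), ∀ a ∈ wtHom F (q := q) c u, lowOp F q a ∈ wtHom F c (u + 2) :=
      fun c u a ha => lowDer_mem_wtHom u a ha
    let s : MvPolynomial (Var q) F →ₗ[F] (ℕ → MvPolynomial (Var q) F) := LinearMap.pi fun b =>
      if h : b < q i + 1 then (pderiv (⟨i, ⟨b, h⟩⟩ : Var q)).toLinearMap else 0
    let r : (ℕ → MvPolynomial (Var q) F) →ₗ[F] MvPolynomial (Var q) F :=
      ∑ b : Fin (q i + 1), LinearMap.mulLeft F (X ⟨i, b⟩) ∘ₗ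
        LinearMap.proj (φ := fun _ : ℕ => MvPolynomial (Var q) F) (b : ℕ)
    have hs1 : ∀ f b (h : b < q i + 1), s f b = pderiv (⟨i, ⟨b, h⟩⟩ : Var q) f := fun f b h => by
      change (if h : b < q i + 1 then (pderiv (⟨i, ⟨b, h⟩⟩ : Var q)).toLinearMap else 0) f = _
      rw [dif_pos h]
      rfl
    have hs2 : ∀ f b, ¬ b < q i + 1 → s f b = 0 := fun f b h => by
      change (if h : b < q i + 1 then (pderiv (⟨i, ⟨b, h⟩⟩ : Var q)).toLinearMap else 0) f = _
      rw [dif_neg h]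
      rfl
    have hr : ∀ v, r v = ∑ b : Fin (q i + 1), X ⟨i, b⟩ * v b := fun v => by
      change (∑ b : Fin (q i + 1), _ : _ →ₗ[F] _) v = _
      rw [LinearMap.sum_apply]
      rfl
    refine ((ih c' hc' hN').seq (hD c') (n := q i) (hq i)).of_retract (hD _) (seqOp_mem (hD c') _)
      s r ?_ ?_ ?_ ?_ hcF ?_
    · intro u f hf
      refine ⟨fun b hb => ?_, fun b hb => hs2 _ _ (by omega)⟩
      rw [hs1 _ _ hb]
      exact mem_grading_of_eq (G := wtHom F c') (pderiv_mem_wtHom hf ⟨b, hb⟩) (by push_cast; ring)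
    · intro u v hv
      rw [hr]
      refine Submodule.sum_mem _ fun b _ => X_mul_mem_wtHom ?_
      exact mem_grading_of_eq (G := wtHom F c') (hv.1 b b.isLt) (by push_cast; ring)
    · intro u f hf
      funext b
      rw [seqOp_apply]
      by_cases hb : b < q i + 1
      · rw [hs1 _ _ hb, hs1 _ _ hb]
        change pderiv (⟨i, ⟨b, hb⟩⟩ : Var q) (lowDer F q f) = lowDer F q _ + _
        rw [pderiv_lowDer]
        congr 1
        split_ifs with h
        · exact (hs1 f _ h).symm
        · exact (hs2 f _ h).symm
      · rw [hs2 _ _ hb, hs2 _ _ hb, hs2 _ _ (by omega), map_zero, add_zero]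
    · intro u v hv
      rw [hr, hr]
      change _ = lowDer F q _
      rw [map_sum]
      simp_rw [Derivation.leibniz, smul_eq_mul, seqOp_apply, mul_add, Finset.sum_add_distrib]
      congr 1
      rw [Fin.sum_univ_castSucc, Fin.sum_univ_succ (n := q i)]
      have h1 : v ((Fin.last (q i) : ℕ) + 1) = 0 := hv.2 _ (by simp)
      have h2 : lowDer F q (X (⟨i, 0⟩ : Var q)) = 0 := by
        rw [lowDer_X]
        exact if_neg (lt_irrefl 0)
      rw [h1, h2, mul_zero, mul_zero, add_zero, zero_add]
      refine Finset.sum_congr rfl fun b _ => ?_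
      have h3 : lowDer F q (X (⟨i, b.succ⟩ : Var q)) = X ⟨i, b.castSucc⟩ := by
        rw [lowDer_X]
        exact if_pos (Nat.succ_pos (b : ℕ))
      rw [h3, mul_comm]
      rfl
    · intro u f hf
      have h1 := sum_X_mul_pderiv hf i
      rw [Function.update_self] at h1
      rw [hr, ← h1]
      exact Finset.sum_congr rfl fun b _ => by rw [hs1 _ _ b.isLt]

end Weights

section LowerBound

open MvPolynomial

variable {F : Type*} [Field F] {ι : Type*} {q : ι → ℕ} {p : ℕ}

/-! ### Coefficients of invariants that vanish -/

/-- A polynomial splits into its terms inside `S` and its terms outside `S`. -/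
theorem exists_add_of_restrictSupport (S : Set (Var q →₀ ℕ)) {T : Set (Var q →₀ ℕ)}
    {f : MvPolynomial (Var q) F} (hf : f ∈ restrictSupport F T) :
    ∃ a ∈ restrictSupport F (T ∩ S), ∃ b ∈ restrictSupport F (T \ S), a + b = f := by
  rw [← Set.inter_union_sdiff T S, restrictSupport_eq_span, Set.image_union,
    Submodule.span_union, ← restrictSupport_eq_span, ← restrictSupport_eq_span] at hf
  exact Submodule.mem_sup.mp hf

theorem eq_zero_of_mem_restrictSupport_of_disjoint {S T : Set (Var q →₀ ℕ)}
    {f : MvPolynomial (Var q) F} (hS : f ∈ restrictSupport F S) (hT : f ∈ restrictSupport F T)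
    (h : Disjoint S T) : f = 0 := by
  ext m
  by_contra hm
  exact Set.disjoint_left.mp h (mem_restrictSupport_iff_coeff.mp hS m hm)
    (mem_restrictSupport_iff_coeff.mp hT m hm)

theorem coeff_eq_zero_of_mem_restrictSupport {S : Set (Var q →₀ ℕ)} {f : MvPolynomial (Var q) F}
    (hf : f ∈ restrictSupport F S) {m : Var q →₀ ℕ} (hm : m ∉ S) : coeff m f = 0 :=
  not_not.mp fun h => hm (mem_restrictSupport_iff_coeff.mp hf m h)

theorem diffOp_mem_blockDeg (C : Set (ι → ℕ)) {f : MvPolynomial (Var q) F}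
    (hf : f ∈ restrictSupport F {m | (fun i => blockDeg i m) ∈ C}) :
    diffOp (jordanAut F 0) f ∈ restrictSupport F {m | (fun i => blockDeg i m) ∈ C} := by
  have hle : restrictSupport F {m : Var q →₀ ℕ | (fun i => blockDeg i m) ∈ C} ≤
      (restrictSupport F {m | (fun i => blockDeg i m) ∈ C}).comap (diffOp (jordanAut F 0)) := by
    conv_lhs => rw [restrictSupport_eq_span]
    rw [Submodule.span_le]
    rintro _ ⟨m, hm, rfl⟩
    refine restrictSupport_mono F ?_ (diffOp_monomial_mem (F := F) m).1
    rintro m' ⟨hm', -⟩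
    change (fun i => blockDeg i m') ∈ C
    rw [funext hm']
    exact hm
  exact hle hf

/-- The part of multidegree `c` of an invariant is an invariant. -/
theorem exists_blockDeg_part (c : ι → ℕ) {f : MvPolynomial (Var q) F}
    (hf : diffOp (jordanAut F 0) f = 0) :
    ∃ a ∈ restrictSupport F {m : Var q →₀ ℕ | ∀ i, blockDeg i m = c i},
      diffOp (jordanAut F 0) a = 0 ∧
        ∀ m : Var q →₀ ℕ, (∀ i, blockDeg i m = c i) → coeff m a = coeff m f := by
  obtain ⟨a, ha, b, hb, rfl⟩ := exists_add_of_restrictSupport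
    {m : Var q →₀ ℕ | (fun i => blockDeg i m) ∈ ({c} : Set (ι → ℕ))} (T := Set.univ) (f := f)
    (by rw [restrictSupport_univ]; trivial)
  rw [Set.univ_inter] at ha
  have hb' : b ∈ restrictSupport F
      {m : Var q →₀ ℕ | (fun i => blockDeg i m) ∈ ({c}ᶜ : Set (ι → ℕ))} :=
    restrictSupport_mono F (fun m hm => hm.2) hb
  refine ⟨a, restrictSupport_mono F (fun m hm i => congrFun hm i) ha, ?_, fun m hm => ?_⟩
  · have h1 := diffOp_mem_blockDeg _ ha
    have h2 := diffOp_mem_blockDeg _ hb'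
    rw [map_add, add_eq_zero_iff_eq_neg] at hf
    refine eq_zero_of_mem_restrictSupport_of_disjoint h1 (hf ▸ Submodule.neg_mem _ h2) ?_
    exact Set.disjoint_left.mpr fun m hm hm' => hm' hm
  · rw [coeff_add, coeff_eq_zero_of_mem_restrictSupport hb' fun h => h (funext hm), add_zero]

/-- The weight is determined modulo two, and bounded below, by the degrees in the blocks. -/
theorem wt_eq_sub [Fintype ι] (m : Var q →₀ ℕ) :
    wt m = 2 * ∑ j : Var q, ((q j.1 - j.2) * m j : ℤ) - ∑ i, (q i * blockDeg i m : ℕ) := by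
  have h1 : wt m = ∑ j : Var q, ((q j.1 - 2 * j.2) * m j : ℤ) := by
    rw [wt, Finsupp.liftAddHom_apply, Finsupp.sum_fintype _ _ (fun j => map_zero _)]
    exact Finset.sum_congr rfl fun j _ => by simp
  have h2 : ((∑ i, (q i * blockDeg i m : ℕ) : ℕ) : ℤ) = ∑ j : Var q, (q j.1 * m j : ℤ) := by
    rw [Fintype.sum_sigma, Nat.cast_sum]
    refine Finset.sum_congr rfl fun i _ => ?_
    rw [blockDeg, Nat.cast_mul, Nat.cast_sum, Finset.mul_sum]
  rw [h1, h2, Finset.mul_sum, ← Finset.sum_sub_distrib]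
  exact Finset.sum_congr rfl fun j _ => by ring

theorem blockDeg_mem_wtGe [Fintype ι] {c : ι → ℕ} {f : MvPolynomial (Var q) F}
    (hf : f ∈ restrictSupport F {m : Var q →₀ ℕ | ∀ i, blockDeg i m = c i}) :
    f ∈ wtGe F c (- ∑ i, (q i * c i : ℕ)) := by
  refine restrictSupport_mono F (fun m hm => And.intro hm ?_) hf
  have h : (0 : ℤ) ≤ ∑ j : Var q, ((q j.1 - j.2) * m j : ℤ) := Finset.sum_nonneg fun j _ =>
    mul_nonneg (by have := j.snd_le; omega) (Int.natCast_nonneg _)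
  have hm' : ∀ i, blockDeg i m = c i := hm
  rw [wt_eq_sub]
  simp only [hm']
  linarith

/-- Up to a transfer, an invariant of multidegree `c` with all `c i < p` has no terms of
negative weight: its term of lowest weight is killed by `lowOp`, hence a `lowOp ^ (p - 1)`. -/
theorem exists_sub_transfer_mem_wtGe [Fintype ι] [Fact p.Prime] [CharP F p] (hq : ∀ i, q i < p)
    {c : ι → ℕ} (hc : ∀ i, c i < p) {f : MvPolynomial (Var q) F}
    (hf : f ∈ restrictSupport F {m : Var q →₀ ℕ | ∀ i, blockDeg i m = c i})
    (hinv : diffOp (jordanAut F 0) f = 0) :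
    ∃ h ∈ restrictSupport F {m : Var q →₀ ℕ | ∀ i, blockDeg i m = c i},
      f - (diffOp (jordanAut F 0) ^ (p - 1)) h ∈ wtGe F c 0 := by
  have hp : p - 1 + 1 = p := Nat.sub_add_cancel (Fact.out : p.Prime).one_le
  have key : ∀ (t : ℕ) (f : MvPolynomial (Var q) F), f ∈ wtGe F c (-t) →
      diffOp (jordanAut F 0) f = 0 →
      ∃ h ∈ restrictSupport F {m : Var q →₀ ℕ | ∀ i, blockDeg i m = c i},
        f - (diffOp (jordanAut F 0) ^ (p - 1)) h ∈ wtGe F c 0 := by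
    intro t
    induction t with
    | zero => exact fun f hf _ => ⟨0, Submodule.zero_mem _, by simpa using hf⟩
    | succ t ih =>
      intro f hf hinv
      obtain ⟨f0, hf0, f1, hf1, rfl⟩ := exists_add_of_restrictSupport
        {m : Var q →₀ ℕ | wt m = -(t + 1 : ℕ)} hf
      replace hf0 : f0 ∈ wtHom F c (-(t + 1 : ℕ)) :=
        restrictSupport_mono F (fun m hm => And.intro hm.1.1 hm.2) hf0
      replace hf1 : f1 ∈ wtGe F c (-t) := restrictSupport_mono F (fun m hm => And.intro hm.1.1 (by
        have h1 : -((t + 1 : ℕ) : ℤ) ≤ wt m := hm.1.2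
        have h2 : wt m ≠ -((t + 1 : ℕ) : ℤ) := hm.2
        push_cast at h1 h2
        omega)) hf1
      have hD : lowOp F q f0 = 0 := by
        refine eq_zero_of_mem_restrictSupport_of_disjoint (lowDer_mem_wtHom _ f0 hf0)
          (T := {m | (∀ i, blockDeg i m = c i) ∧ (-t + 2 : ℤ) ≤ wt m}) ?_ ?_
        · have h1 := (diffOp_mem_wtGe (wtHom_le_wtGe _ _ hf0)).2
          have h2 := (diffOp_mem_wtGe hf1).1
          have h3 : lowOp F q f0 = -((diffOp (jordanAut F 0) f0 - lowOp F q f0)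
              + diffOp (jordanAut F 0) f1) := by
            rw [map_add] at hinv
            linear_combination hinv
          change lowOp F q f0 ∈ wtGe F c (-t + 2 : ℤ)
          rw [h3]
          exact Submodule.neg_mem _ (Submodule.add_mem _
            (wtGe_anti _ (by push_cast; linarith) h1) h2)
        · refine Set.disjoint_left.mpr fun m hm hm' => ?_
          have h1 := hm.2
          have h2 := hm'.2
          push_cast at h1
          linarith
      obtain ⟨h0, hh0, hh0'⟩ := balanced_wtHom hq c hc 1 (Fact.out : p.Prime).one_le
        _ (by push_cast; omega) f0 hf0 (by rw [pow_one]; exact hD)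
      have hsub := diffOp_pow_sub_mem_wtGe hh0 (p - 1)
      rw [hh0'] at hsub
      have hinv' : diffOp (jordanAut F 0) ((diffOp (jordanAut F 0) ^ (p - 1)) h0) = 0 := by
        rw [← Module.End.mul_apply, ← pow_succ', hp, diffOp_pow_char p hq]
        rfl
      obtain ⟨h, hh, hh'⟩ := ih (f0 + f1 - (diffOp (jordanAut F 0) ^ (p - 1)) h0) (by
        have : f0 + f1 - (diffOp (jordanAut F 0) ^ (p - 1)) h0
            = f1 - ((diffOp (jordanAut F 0) ^ (p - 1)) h0 - f0) := by ring
        rw [this]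
        refine Submodule.sub_mem _ hf1 (wtGe_anti _ ?_ hsub)
        rw [Nat.cast_sub (Fact.out : p.Prime).one_le]
        push_cast
        linarith) (by rw [map_sub, hinv, hinv', sub_zero])
      refine ⟨h0 + h, Submodule.add_mem _
        (restrictSupport_mono F (fun m hm => hm.1) hh0) hh, ?_⟩
      rw [map_add, ← sub_sub]
      exact hh'
  exact key _ f (blockDeg_mem_wtGe hf) hinv

/-- Let `f` be an invariant and `m` a monomial whose degree in each block is less than `p`. If the
weight of `m` is negative and too small for a transfer, then `m` does not occur in `f`. -/
theorem coeff_eq_zero_of_wt_neg [Fintype ι] [Fact p.Prime] [CharP F p] (hq : ∀ i, q i < p)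
    {f : MvPolynomial (Var q) F} (hf : diffOp (jordanAut F 0) f = 0) {m : Var q →₀ ℕ}
    (hm : ∀ i, blockDeg i m < p) (hneg : wt m < 0)
    (hlt : wt m < - ∑ i, (q i * blockDeg i m : ℕ) + 2 * (p - 1 : ℕ)) : coeff m f = 0 := by
  obtain ⟨a, ha, hinv, hcoeff⟩ := exists_blockDeg_part (fun i => blockDeg i m) hf
  obtain ⟨h, hh, hh'⟩ := exists_sub_transfer_mem_wtGe hq hm ha hinv
  rw [← hcoeff m fun _ => rfl, ← sub_add_cancel a ((diffOp (jordanAut F 0) ^ (p - 1)) h), coeff_add,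
    coeff_eq_zero_of_mem_restrictSupport hh' fun h => h.2.not_gt hneg,
    coeff_eq_zero_of_mem_restrictSupport (diffOp_pow_mem_wtGe (blockDeg_mem_wtGe hh) (p - 1))
      fun h => h.2.not_gt hlt, add_zero]

theorem coeff_lowDer [Fintype ι] [DecidableEq ι] (n : Var q →₀ ℕ) (f : MvPolynomial (Var q) F) :
    coeff n (lowDer F q f) = ∑ j : Var q, if 0 < (j.2 : ℕ) ∧ n (low j) ≠ 0 then
      coeff (n - Finsupp.single (low j) 1 + Finsupp.single j 1) f
        * ((n - Finsupp.single (low j) 1 : Var q →₀ ℕ) j + 1) else 0 := by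
  have h : lowDer F q f = ∑ j : Var q, lowDer F q (X j) * pderiv j f := by
    have : lowDer F q = ∑ j : Var q, lowDer F q (X j) • pderiv j := by
      refine derivation_ext fun j => ?_
      rw [← Derivation.coeFnAddMonoidHom_apply (∑ j : Var q, _), map_sum, Finset.sum_apply,
        Finset.sum_eq_single j]
      · simp
      · intro j' _ hj
        simp [pderiv_X_of_ne hj.symm]
      · simp
    conv_lhs => rw [this]
    rw [← Derivation.coeFnAddMonoidHom_apply (∑ j : Var q, _), map_sum, Finset.sum_apply]
    rfl
  rw [h, coeff_sum]
  refine Finset.sum_congr rfl fun j _ => ?_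
  rw [lowDer_X]
  by_cases hj : 0 < (j.2 : ℕ)
  · simp only [hj, if_true, true_and, coeff_X_mul', Finsupp.mem_support_iff, coeff_pderiv]
  · simp [hj]

/-- In a block of three variables `x, y, z`, an element of weight `0` in the kernel of `lowOp` is
a multiple of a power of `y ^ 2 - 2 x z`, and has no term that is an odd power of `y`. -/
theorem coeff_eq_zero_of_odd_of_lowDer [Fintype ι] [Fact p.Prime] [CharP F p] {i : ι} (hi : q i = 2)
    {f : MvPolynomial (Var q) F} (hf : lowDer F q f = 0) {e : ℕ} (he : Odd e) (hep : e < p) :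
    coeff (Finsupp.single ⟨i, ⟨1, by omega⟩⟩ e) f = 0 := by
  classical
  let x : Var q := ⟨i, ⟨2, by omega⟩⟩
  let y : Var q := ⟨i, ⟨1, by omega⟩⟩
  let z : Var q := ⟨i, ⟨0, by omega⟩⟩
  let μ : ℕ → ℕ → ℕ → (Var q →₀ ℕ) := fun a b c =>
    Finsupp.single x a + Finsupp.single y b + Finsupp.single z c
  have hxy : x ≠ y := fun h => absurd (congrArg (fun j : Var q => (j.2 : ℕ)) h) (by simp [x, y])
  have hxz : x ≠ z := fun h => absurd (congrArg (fun j : Var q => (j.2 : ℕ)) h) (by simp [x, z])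
  have hyz : y ≠ z := fun h => absurd (congrArg (fun j : Var q => (j.2 : ℕ)) h) (by simp [y, z])
  have hlx : low x = y := rfl
  have hly : low y = z := rfl
  have hx : ∀ a b c, μ a b c x = a := fun a b c => by
    simp [μ, Finsupp.single_eq_of_ne hxy, Finsupp.single_eq_of_ne hxz]
  have hy : ∀ a b c, μ a b c y = b := fun a b c => by
    simp [μ, Finsupp.single_eq_of_ne hxy.symm, Finsupp.single_eq_of_ne hyz]
  have hz : ∀ a b c, μ a b c z = c := fun a b c => by
    simp [μ, Finsupp.single_eq_of_ne hxz.symm, Finsupp.single_eq_of_ne hyz.symm]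
  have hother : ∀ a b c j, j ≠ x → j ≠ y → j ≠ z → μ a b c j = 0 := fun a b c j h1 h2 h3 => by
    simp [μ, Finsupp.single_eq_of_ne h1, Finsupp.single_eq_of_ne h2, Finsupp.single_eq_of_ne h3]
  have hlow : ∀ a b c j, 0 < (j.2 : ℕ) → μ a b c (low j) ≠ 0 → j = x ∨ j = y := by
    intro a b c j hj h
    by_contra hcon
    push Not at hcon
    refine h (hother _ _ _ _ ?_ ?_ ?_)
    · intro h'
      have h1 : (j.1 : ι) = i := congrArg Sigma.fst h'
      have h2 : (j.2 : ℕ) - 1 = 2 := congrArg (fun j : Var q => (j.2 : ℕ)) h'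
      have h3 := j.snd_le
      have h4 : q j.1 = q i := congrArg q h1
      omega
    · intro h'
      have h2 : (j.2 : ℕ) - 1 = 1 := congrArg (fun j : Var q => (j.2 : ℕ)) h'
      exact hcon.1 (Var.ext (congrArg Sigma.fst h' : j.1 = i) (by change (j.2 : ℕ) = 2; omega))
    · intro h'
      have h2 : (j.2 : ℕ) - 1 = 0 := congrArg (fun j : Var q => (j.2 : ℕ)) h'
      exact hcon.2 (Var.ext (congrArg Sigma.fst h' : j.1 = i) (by change (j.2 : ℕ) = 1; omega))
  -- the coefficient of `x ^ a * y ^ b * z ^ (c + 1)` in `lowDer f`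
  have hrec : ∀ a b c, coeff (μ a (b + 1) c) f * (b + 1)
      + (if b ≠ 0 then coeff (μ (a + 1) (b - 1) (c + 1)) f * (a + 1) else 0) = 0 := by
    intro a b c
    have h := coeff_lowDer (μ a b (c + 1)) f
    rw [hf, coeff_zero, Finset.sum_eq_add_of_mem x y (Finset.mem_univ _) (Finset.mem_univ _) hxy] at h
    · have h1 : μ a b (c + 1) - Finsupp.single z 1 = μ a b c := by
        simp only [μ]
        rw [Finsupp.single_add, ← add_assoc, add_tsub_cancel_right]
      have h2 : μ a b c + Finsupp.single y 1 = μ a (b + 1) c := by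
        simp only [μ]
        rw [Finsupp.single_add]
        abel
      have h3 : b ≠ 0 → μ a b (c + 1) - Finsupp.single y 1 = μ a (b - 1) (c + 1) := by
        intro hb
        obtain ⟨b, rfl⟩ := Nat.exists_eq_succ_of_ne_zero hb
        simp only [μ]
        rw [Nat.succ_eq_add_one, Finsupp.single_add, Nat.add_sub_cancel,
          add_right_comm (Finsupp.single x a), ← add_assoc, add_tsub_cancel_right,
          add_right_comm]
      have h4 : μ a (b - 1) (c + 1) + Finsupp.single x 1 = μ (a + 1) (b - 1) (c + 1) := by
        simp only [μ]
        rw [Finsupp.single_add x]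
        abel
      rw [hlx, hly, if_pos (⟨Nat.one_pos, by rw [hz]; omega⟩ : 0 < (y.2 : ℕ) ∧ _), h1, h2, hy, hy] at h
      rw [add_comm]
      refine Eq.trans ?_ h.symm
      congr 1
      by_cases hb : b = 0
      · rw [if_neg (fun h => h hb), if_neg (fun h => h.2 hb)]
      · rw [if_pos hb, if_pos ⟨Nat.two_pos, hb⟩, h3 hb, h4, hx]
    · intro j _ hj
      exact if_neg fun h => (hlow _ _ _ j h.1 h.2).elim hj.1 hj.2
  have hzero : ∀ r a, e = 2 * a + 1 + 2 * r → coeff (μ a (1 + 2 * r) a) f = 0 := by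
    intro r
    induction r with
    | zero =>
      intro a _
      simpa using hrec a 0 a
    | succ r ih =>
      intro a ha
      have h := hrec a (2 + 2 * r) a
      rw [if_pos (by omega), show 2 + 2 * r - 1 = 1 + 2 * r by omega, ih (a + 1) (by omega), zero_mul,
        add_zero, mul_eq_zero] at h
      rcases h with h | h
      · rw [← h]
        congr 2
        ring
      · exfalso
        have h5 : ((2 + 2 * r + 1 : ℕ) : F) = 0 := by rw [← h]; push_cast; ring
        rw [CharP.cast_eq_zero_iff F p] at h5
        exact absurd (Nat.le_of_dvd (by omega) h5) (by omega)
  obtain ⟨r, hr⟩ := he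
  have h := hzero r 0 (by omega)
  have hμ : μ 0 (1 + 2 * r) 0 = Finsupp.single y e := by
    simp only [μ]
    rw [Finsupp.single_zero, Finsupp.single_zero, zero_add, add_zero, hr, add_comm]
  rw [hμ] at h
  exact h

/-- Small odd powers of the middle variable of a block of three variables do not occur in
invariants: up to a transfer, whose weights are too large, such a term belongs to the part of
weight `0`, which is the part of lowest weight and therefore killed by `lowDer`. -/
theorem coeff_eq_zero_of_odd [Fintype ι] [Fact p.Prime] [CharP F p] (hq : ∀ i, q i < p)
    {f : MvPolynomial (Var q) F} (hf : diffOp (jordanAut F 0) f = 0) {i : ι} (hi : q i = 2) {e : ℕ}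
    (he : Odd e) (hep : e < p - 1) : coeff (Finsupp.single ⟨i, ⟨1, by omega⟩⟩ e) f = 0 := by
  classical
  set m : Var q →₀ ℕ := Finsupp.single ⟨i, ⟨1, by omega⟩⟩ e with hm
  have hdeg : ∀ i', blockDeg i' m = if i = i' then e else 0 := fun i' => blockDeg_single _ _ _
  have hwt : wt m = 0 := by
    rw [hm, wt_single]
    change ((q i : ℤ) - 2 * (1 : ℕ)) * e = 0
    rw [hi]
    simp
  have hsum : ∑ i', (q i' * blockDeg i' m : ℕ) = 2 * e := by
    rw [Finset.sum_eq_single i, hdeg, if_pos rfl, hi]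
    · intro i' _ hne
      rw [hdeg, if_neg hne.symm, mul_zero]
    · simp
  obtain ⟨a, ha, hinv, hcoeff⟩ := exists_blockDeg_part (fun i => blockDeg i m) hf
  obtain ⟨h, hh, hh'⟩ := exists_sub_transfer_mem_wtGe hq (fun i' => by
    rw [hdeg]; split_ifs <;> omega) ha hinv
  have hfix : diffOp (jordanAut F 0) (a - (diffOp (jordanAut F 0) ^ (p - 1)) h) = 0 := by
    rw [map_sub, hinv, ← Module.End.mul_apply, ← pow_succ',
      Nat.sub_add_cancel (Fact.out : p.Prime).one_le, diffOp_pow_char p hq, LinearMap.zero_apply,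
      sub_zero]
  obtain ⟨g, hg, g', hg', hgg⟩ := exists_add_of_restrictSupport {m | wt m = 0} hh'
  replace hg : g ∈ wtHom F (fun i => blockDeg i m) 0 :=
    restrictSupport_mono F (fun m hm => And.intro hm.1.1 hm.2) hg
  replace hg' : g' ∈ wtGe F (fun i => blockDeg i m) 1 :=
    restrictSupport_mono F (fun m hm => And.intro hm.1.1 (by
      have h1 := hm.1.2
      have h2 : wt m ≠ 0 := hm.2
      omega)) hg'
  have hD : lowDer F q g = 0 := by
    refine eq_zero_of_mem_restrictSupport_of_disjoint (lowDer_mem_wtHom _ g hg)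
      (T := {m' | (∀ i, blockDeg i m' = blockDeg i m) ∧ (3 : ℤ) ≤ wt m'}) ?_ ?_
    · have h1 := (diffOp_mem_wtGe (wtHom_le_wtGe _ _ hg)).2
      have h2 := (diffOp_mem_wtGe hg').1
      have h3 : lowDer F q g = -((diffOp (jordanAut F 0) g - lowOp F q g)
          + diffOp (jordanAut F 0) g') := by
        rw [← hgg, map_add] at hfix
        change lowOp F q g = _
        linear_combination hfix
      change lowDer F q g ∈ wtGe F (fun i => blockDeg i m) 3
      rw [h3]
      exact Submodule.neg_mem _ (Submodule.add_mem _
        (wtGe_anti _ (by norm_num) h1) (wtGe_anti _ (by norm_num) h2))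
    · refine Set.disjoint_left.mpr fun m hm hm' => ?_
      have h1 := hm.2
      have h2 := hm'.2
      linarith
  rw [← hcoeff m fun _ => rfl, ← sub_add_cancel a ((diffOp (jordanAut F 0) ^ (p - 1)) h), ← hgg,
    coeff_add, coeff_add, coeff_eq_zero_of_odd_of_lowDer hi hD he (p := p) (by omega),
    coeff_eq_zero_of_mem_restrictSupport hg' fun h => by have := h.2; omega,
    coeff_eq_zero_of_mem_restrictSupport (diffOp_pow_mem_wtGe (blockDeg_mem_wtGe hh) (p - 1))
      fun h => by have := h.2; rw [hsum] at this; omega, add_zero, add_zero]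

end LowerBound

section Indecomposable

open MvPolynomial

variable {F : Type*} [Field F] {ι : Type*} {q : ι → ℕ} {p : ℕ}

/-! ### An indecomposable invariant of large degree -/

/-- The exponent of `x ^ (ε + p - 1) * ∏ y ^ (p - 1)`, where `x` is the variable below the top
variable of the block `i₀` and `y` runs over the top variables of the other blocks. -/
def extremalMon [Fintype ι] [DecidableEq ι] (p : ℕ) (q : ι → ℕ) (i₀ : ι) (ε : ℕ) : Var q →₀ ℕ :=
  Finsupp.single (low (top q i₀)) (ε + (p - 1))
    + ∑ i ∈ Finset.univ.erase i₀, Finsupp.single (top q i) (p - 1)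

theorem degree_extremalMon [Fintype ι] [DecidableEq ι] (i₀ : ι) (ε : ℕ) :
    (extremalMon p q i₀ ε).degree = (p - 1) * Fintype.card ι + ε := by
  have h : 1 ≤ Fintype.card ι := Fintype.card_pos_iff.mpr ⟨i₀⟩
  obtain ⟨k, hk⟩ := Nat.exists_eq_add_of_le h
  rw [extremalMon, map_add, map_sum]
  simp only [Finsupp.degree_single, Finset.sum_const, smul_eq_mul]
  rw [Finset.card_erase_of_mem (Finset.mem_univ _), Finset.card_univ, hk, Nat.add_sub_cancel_left]
  ring

theorem low_top_ne_top {i₀ : ι} (h : 0 < q i₀) (i : ι) : low (top q i₀) ≠ top q i := by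
  intro h'
  have h1 : i₀ = i := congrArg Sigma.fst h'
  subst h1
  have h2 : q i₀ - 1 = q i₀ := congrArg (fun j : Var q => (j.2 : ℕ)) h'
  omega

theorem extremalMon_low_top [Fintype ι] [DecidableEq ι] {i₀ : ι} (h : 0 < q i₀) (ε : ℕ) :
    extremalMon p q i₀ ε (low (top q i₀)) = ε + (p - 1) := by
  rw [extremalMon, Finsupp.add_apply, Finsupp.single_eq_same, Finsupp.finsetSum_apply,
    Finset.sum_eq_zero, add_zero]
  exact fun i _ => Finsupp.single_eq_of_ne (low_top_ne_top h i)

theorem extremalMon_top_le [Fintype ι] [DecidableEq ι] {i₀ : ι} (h : 0 < q i₀) (ε : ℕ) (i : ι) :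
    extremalMon p q i₀ ε (top q i) ≤ p - 1 := by
  rw [extremalMon, Finsupp.add_apply, Finsupp.single_eq_of_ne (low_top_ne_top h i).symm,
    zero_add, Finsupp.finsetSum_apply]
  by_cases hi : i ∈ Finset.univ.erase i₀
  · rw [Finset.sum_eq_single_of_mem i hi]
    · rw [Finsupp.single_eq_same]
    · exact fun i' _ hne => Finsupp.single_eq_of_ne fun h => hne (congrArg Sigma.fst h).symm
  · rw [Finset.sum_eq_zero]
    · exact Nat.zero_le _
    · intro i' hi'
      exact Finsupp.single_eq_of_ne fun h => hi (by
        rwa [show i = i' from congrArg Sigma.fst h])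

theorem extremalMon_support [Fintype ι] [DecidableEq ι] {i₀ : ι} {ε : ℕ} {j : Var q}
    (hj : extremalMon p q i₀ ε j ≠ 0) : j = low (top q i₀) ∨ ∃ i ≠ i₀, j = top q i := by
  by_contra hcon
  push Not at hcon
  refine hj ?_
  rw [extremalMon, Finsupp.add_apply, Finsupp.single_eq_of_ne hcon.1, zero_add,
    Finsupp.finsetSum_apply, Finset.sum_eq_zero]
  exact fun i hi => Finsupp.single_eq_of_ne (hcon.2 i (Finset.ne_of_mem_erase hi))

/-- The transfer of `x ^ ε * ∏ y ^ (p - 1)`, with `y` running over all top variables, contains the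
extremal monomial: modulo the lower variables, the only top variable that is not fixed is
`top q i₀`. -/
theorem coeff_transfer_extremalMon [Fintype ι] [DecidableEq ι] [Fact p.Prime] [CharP F p] {i₀ : ι}
    (h : 0 < q i₀) (ε : ℕ) :
    coeff (extremalMon p q i₀ ε) ((diffOp (jordanAut F 0) ^ (p - 1))
      (X (low (top q i₀)) ^ ε * ∏ i, X (top q i) ^ (p - 1))) = -1 := by
  set l : ι → ℕ := Function.update q i₀ (q i₀ - 1) with hl
  have hl0 : l i₀ = q i₀ - 1 := Function.update_self _ _ _
  have hl1 : ∀ i, i ≠ i₀ → l i = q i := fun i hi => Function.update_of_ne hi _ _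
  have hle : ∀ i, l i ≤ q i := fun i => by
    by_cases hi : i = i₀
    · subst hi; omega
    · exact (hl1 i hi).le
  have hmem : extremalMon p q i₀ ε ∈ avoidLow l := by
    intro j hj
    by_contra hne
    rcases extremalMon_support hne with rfl | ⟨i, -, rfl⟩
    · exact absurd hj (by change ¬ (q i₀ - 1 < l i₀); omega)
    · exact absurd hj (not_lt.mpr (hle i))
  have hX1 : killLow F l (X (low (top q i₀))) = X (low (top q i₀)) := by
    rw [killLow_X]
    exact if_neg (by change ¬ (q i₀ - 1 < l i₀); omega)
  have hX2 : ∀ i, killLow F l (X (top q i)) = X (top q i) := fun i => by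
    rw [killLow_X]
    exact if_neg (not_lt.mpr (hle i))
  have hs1 : jordanAut F l (X (low (top q i₀))) = X (low (top q i₀)) := by
    rw [jordanAut_X, if_neg (by change ¬ (l i₀ < q i₀ - 1); omega), add_zero]
  have hs2 : ∀ i, i ≠ i₀ → jordanAut F l (X (top q i)) = X (top q i) := fun i hi => by
    rw [jordanAut_X, if_neg (by change ¬ (l i < q i); rw [hl1 i hi]; exact lt_irrefl _), add_zero]
  have hs3 : jordanAut F l (X (top q i₀)) = X (top q i₀) + X (low (top q i₀)) := by
    rw [jordanAut_X, if_pos (by change l i₀ < q i₀; omega)]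
  rw [← coeff_killLow hmem, killLow_diffOp_pow (l := 0) (fun i => Nat.zero_le _), map_mul, map_pow, map_prod,
    hX1]
  simp_rw [map_pow, hX2]
  rw [← Finset.prod_erase_mul _ _ (Finset.mem_univ i₀), ← mul_assoc, diffOp_pow_mul_of_fixed,
    transfer_pow_pred p hs3 hs1, mul_neg, coeff_neg, neg_inj]
  · have : (X (low (top q i₀)) ^ ε * ∏ i ∈ Finset.univ.erase i₀, X (top q i) ^ (p - 1))
        * X (low (top q i₀)) ^ (p - 1) = monomial (extremalMon p q i₀ ε) (1 : F) := by
      rw [extremalMon, ← one_mul (1 : F), ← monomial_mul, monomial_sum_one, mul_right_comm, ← pow_add,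
        X_pow_eq_monomial]
      simp_rw [X_pow_eq_monomial]
    rw [this, coeff_monomial, if_pos rfl]
  · rw [map_mul, map_pow, map_prod, hs1]
    congr 1
    refine Finset.prod_congr rfl fun i hi => ?_
    rw [map_pow, hs2 i (Finset.ne_of_mem_erase hi)]

/-- A divisor of an extremal monomial which is of degree less than `p - 1` in `low (top q i₀)` does
not occur in an invariant, unless it lies in the block `i₀` and this block has three variables. -/
theorem coeff_eq_zero_of_le_extremalMon [Fintype ι] [DecidableEq ι] [Fact p.Prime] [CharP F p]
    (hq : ∀ i, q i < p) (hq1 : ∀ i, 1 ≤ q i) {i₀ : ι} (hi₀ : 2 ≤ q i₀) {ε : ℕ}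
    {f : MvPolynomial (Var q) F} (hf : diffOp (jordanAut F 0) f = 0) {m : Var q →₀ ℕ}
    (hm : m ≤ extremalMon p q i₀ ε) (hlt : m (low (top q i₀)) < p - 1)
    (hex : ∃ i, m (top q i) ≠ 0 ∨ (m (low (top q i)) ≠ 0 ∧ 3 ≤ q i₀)) : coeff m f = 0 := by
  have hsupp : ∀ j, m j ≠ 0 → j = low (top q i₀) ∨ ∃ i ≠ i₀, j = top q i := fun j hj =>
    extremalMon_support (p := p) (ε := ε) (by have := hm j; omega)
  have hb0 : blockDeg i₀ m = m (low (top q i₀)) := by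
    refine Finset.sum_eq_single_of_mem (low (top q i₀)).2 (Finset.mem_univ _) fun b _ hb => ?_
    by_contra hne
    rcases hsupp _ hne with h | ⟨i, hi, h⟩
    · exact hb (Fin.ext (congrArg (fun j : Var q => (j.2 : ℕ)) h))
    · exact hi (congrArg Sigma.fst h).symm
  have hb1 : ∀ i, i ≠ i₀ → blockDeg i m = m (top q i) := by
    intro i hi
    refine Finset.sum_eq_single_of_mem (Fin.last (q i)) (Finset.mem_univ _) fun b _ hb => ?_
    by_contra hne
    rcases hsupp _ hne with h | ⟨i', -, h⟩
    · exact hi (congrArg Sigma.fst h)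
    · have h1 : i = i' := congrArg Sigma.fst h
      subst h1
      exact hb (Fin.ext (congrArg (fun j : Var q => (j.2 : ℕ)) h))
  have hsum : ∑ j : Var q, ((q j.1 - j.2) * m j : ℤ) = m (low (top q i₀)) := by
    rw [Finset.sum_eq_single_of_mem (low (top q i₀)) (Finset.mem_univ _)]
    · change ((q i₀ : ℤ) - (q i₀ - 1 : ℕ)) * _ = _
      rw [Nat.cast_sub (by omega)]
      push_cast
      ring
    · intro j _ hj
      by_cases hne : m j = 0
      · rw [hne, Nat.cast_zero, mul_zero]
      · rcases hsupp j hne with h | ⟨i, -, rfl⟩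
        · exact absurd h hj
        · rw [top_snd, top_fst, sub_self, zero_mul]
  have hwt := wt_eq_sub m
  rw [hsum] at hwt
  have hbig : 2 * m (low (top q i₀)) < ∑ i, q i * blockDeg i m := by
    have h1 : q i₀ * blockDeg i₀ m ≤ ∑ i, q i * blockDeg i m :=
      Finset.single_le_sum (f := fun i => q i * blockDeg i m) (fun _ _ => Nat.zero_le _)
        (Finset.mem_univ i₀)
    obtain ⟨i, hi⟩ := hex
    by_cases hii : i = i₀
    · subst hii
      rcases hi with hi | ⟨hi, h3⟩
      · exfalso
        rcases hsupp _ hi with h | ⟨i', hi', h⟩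
        · exact low_top_ne_top (by omega) _ h.symm
        · exact hi' (congrArg Sigma.fst h).symm
      · rw [hb0] at h1
        refine lt_of_lt_of_le ?_ h1
        exact Nat.mul_lt_mul_of_pos_right (by omega) (Nat.pos_of_ne_zero hi)
    · have hi' : m (top q i) ≠ 0 := by
        rcases hi with hi | ⟨hi, -⟩
        · exact hi
        · exfalso
          rcases hsupp _ hi with h | ⟨i', hi', h⟩
          · exact hii (congrArg Sigma.fst h)
          · exact low_top_ne_top (hq1 i) _ h
      have h2 : q i₀ * blockDeg i₀ m + q i * blockDeg i m ≤ ∑ i, q i * blockDeg i m := by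
        rw [← Finset.add_sum_erase _ _ (Finset.mem_univ i₀)]
        refine Nat.add_le_add_left ?_ _
        exact Finset.single_le_sum (f := fun i => q i * blockDeg i m) (fun _ _ => Nat.zero_le _)
          (Finset.mem_erase.mpr ⟨hii, Finset.mem_univ i⟩)
      rw [hb0, hb1 i hii] at h2
      have h3 := Nat.mul_le_mul_right (m (low (top q i₀))) hi₀
      have h4 := Nat.mul_le_mul_right (m (top q i)) (hq1 i)
      omega
  refine coeff_eq_zero_of_wt_neg hq hf (fun i => ?_) (by omega) (by omega)
  by_cases hi : i = i₀
  · subst hi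
    omega
  · rw [hb1 i hi]
    have h1 := hm (top q i)
    have h2 := extremalMon_top_le (p := p) (q := q) (i₀ := i₀) (by omega) ε i
    have h3 := (Fact.out : p.Prime).one_le
    omega

/-- If the extremal monomial is not a product of two non-constant monomials that occur in
invariants, then it does not occur in a polynomial in invariants of lower degree. -/
theorem coeff_extremalMon_of_mem_lowInv [Fintype ι] [DecidableEq ι] {i₀ : ι} {ε : ℕ} (hε : 0 < ε)
    (H : ∀ f g : MvPolynomial (Var q) F, diffOp (jordanAut F 0) f = 0 →
      diffOp (jordanAut F 0) g = 0 → ∀ m m' : Var q →₀ ℕ, m ≠ 0 → m' ≠ 0 →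
      m + m' = extremalMon p q i₀ ε → coeff m f = 0 ∨ coeff m' g = 0)
    {f : MvPolynomial (Var q) F} (hf : f ∈ lowInv F q ((p - 1) * Fintype.card ι + ε)) :
    coeff (extremalMon p q i₀ ε) f = 0 := by
  have hne : extremalMon p q i₀ ε ≠ 0 := fun h => by
    have := degree_extremalMon (p := p) (q := q) i₀ ε
    rw [h, map_zero] at this
    omega
  have key : diffOp (jordanAut F 0) f = 0 ∧ coeff (extremalMon p q i₀ ε) f = 0 := by
    induction hf using Algebra.adjoin_induction with
    | mem f hf =>
      obtain ⟨e, he, hf1, hf2⟩ := hf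
      refine ⟨hf2, coeff_eq_zero_of_mem_restrictSupport hf1 fun h => ?_⟩
      have h' : (extremalMon p q i₀ ε).degree = e := h
      rw [degree_extremalMon] at h'
      omega
    | algebraMap r =>
      rw [diffOp_eq_zero_iff, AlgHom.commutes, algebraMap_eq, coeff_C, if_neg hne.symm]
      exact ⟨rfl, rfl⟩
    | add f g _ _ hf hg =>
      rw [map_add, coeff_add, hf.1, hg.1, hf.2, hg.2, add_zero, add_zero]
      exact ⟨rfl, rfl⟩
    | mul f g _ _ hf hg =>
      constructor
      · rw [diffOp_mul_of_fixed ((diffOp_eq_zero_iff _ _).mp hf.1), hg.1, mul_zero]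
      · rw [coeff_mul]
        refine Finset.sum_eq_zero fun ⟨m, m'⟩ hm => ?_
        rw [Finset.HasAntidiagonal.mem_antidiagonal] at hm
        change m + m' = _ at hm
        by_cases h0 : m = 0
        · rw [h0, zero_add] at hm
          rw [hm, hg.2, mul_zero]
        by_cases h0' : m' = 0
        · rw [h0', add_zero] at hm
          rw [hm, hf.2, zero_mul]
        rcases H f g hf.1 hg.1 m m' h0 h0' hm with h | h
        · rw [h, zero_mul]
        · rw [h, mul_zero]
  exact key.2

/-- The transfer that contains the extremal monomial is not a polynomial in invariants of lower
degree, if the extremal monomial does not split as a product of monomials occurring in invariants. -/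
theorem exists_fixed_notMem_lowInv [Fintype ι] [DecidableEq ι] [Fact p.Prime] [CharP F p]
    (hq : ∀ i, q i < p) {i₀ : ι} (hi₀ : 0 < q i₀) {ε : ℕ} (hε : 0 < ε)
    (H : ∀ f g : MvPolynomial (Var q) F, diffOp (jordanAut F 0) f = 0 →
      diffOp (jordanAut F 0) g = 0 → ∀ m m' : Var q →₀ ℕ, m ≠ 0 → m' ≠ 0 →
      m + m' = extremalMon p q i₀ ε → coeff m f = 0 ∨ coeff m' g = 0) :
    ∃ f : MvPolynomial (Var q) F, jordanAut F 0 f = f ∧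
      f ∉ lowInv F q ((p - 1) * Fintype.card ι + ε) := by
  refine ⟨(diffOp (jordanAut F 0) ^ (p - 1))
    (X (low (top q i₀)) ^ ε * ∏ i, X (top q i) ^ (p - 1)), ?_, fun hf => ?_⟩
  · rw [← diffOp_eq_zero_iff, ← Module.End.mul_apply, ← pow_succ',
      Nat.sub_add_cancel (Fact.out : p.Prime).one_le, diffOp_pow_char p hq, LinearMap.zero_apply]
  · have h := coeff_extremalMon_of_mem_lowInv hε H hf
    rw [coeff_transfer_extremalMon hi₀, neg_eq_zero] at h
    exact one_ne_zero h

theorem exists_ne_zero_of_le_extremalMon [Fintype ι] [DecidableEq ι] {i₀ : ι} {ε : ℕ}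
    {m : Var q →₀ ℕ} (hm : m ≤ extremalMon p q i₀ ε) (h0 : m ≠ 0) :
    m (low (top q i₀)) ≠ 0 ∨ ∃ i, m (top q i) ≠ 0 := by
  obtain ⟨j, hj⟩ : ∃ j, m j ≠ 0 := by
    by_contra hcon
    push Not at hcon
    exact h0 (Finsupp.ext hcon)
  rcases extremalMon_support (p := p) (i₀ := i₀) (j := j) (ε := ε) (by have := hm j; omega) with
    rfl | ⟨i, -, rfl⟩
  · exact Or.inl hj
  · exact Or.inr ⟨i, hj⟩

/-- If there is a block with at least four variables, then there is an invariant that is not a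
polynomial in invariants of degree less than `(p - 1) * k + p - 2`. -/
theorem exists_fixed_notMem_lowInv_of_three_le [Fintype ι] [Fact p.Prime] [CharP F p]
    (hq : ∀ i, q i < p) (hq1 : ∀ i, 1 ≤ q i) {i₀ : ι} (hi₀ : 3 ≤ q i₀) :
    ∃ f : MvPolynomial (Var q) F, jordanAut F 0 f = f ∧
      f ∉ lowInv F q ((p - 1) * Fintype.card ι + (p - 2)) := by
  classical
  have hp := hq i₀
  refine exists_fixed_notMem_lowInv hq (i₀ := i₀) (by omega) (by omega) ?_
  intro f g hf hg m m' hm hm' hmm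
  have hsum : m (low (top q i₀)) + m' (low (top q i₀)) = p - 2 + (p - 1) := by
    rw [← Finsupp.add_apply, hmm, extremalMon_low_top (by omega)]
  have hex : ∀ m ≤ extremalMon p q i₀ (p - 2), m ≠ 0 →
      ∃ i, m (top q i) ≠ 0 ∨ (m (low (top q i)) ≠ 0 ∧ 3 ≤ q i₀) := by
    intro m hle h0
    rcases exists_ne_zero_of_le_extremalMon hle h0 with h | ⟨i, h⟩
    · exact ⟨i₀, Or.inr ⟨h, hi₀⟩⟩
    · exact ⟨i, Or.inl h⟩
  have h1 : m ≤ extremalMon p q i₀ (p - 2) := hmm ▸ le_self_add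
  have h2 : m' ≤ extremalMon p q i₀ (p - 2) := hmm ▸ le_add_self
  by_cases hlt : m (low (top q i₀)) < p - 1
  · exact Or.inl (coeff_eq_zero_of_le_extremalMon hq hq1 (by omega) hf h1 hlt (hex m h1 hm))
  · exact Or.inr (coeff_eq_zero_of_le_extremalMon hq hq1 (by omega) hg h2 (by omega) (hex m' h2 hm'))

/-- If there is a block with three variables and `p` is odd, then there is an invariant that is not
a polynomial in invariants of degree less than `(p - 1) * k + 1`. -/
theorem exists_fixed_notMem_lowInv_of_eq_two [Fintype ι] [Fact p.Prime] [CharP F p]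
    (hq : ∀ i, q i < p) (hq1 : ∀ i, 1 ≤ q i) {i₀ : ι} (hi₀ : q i₀ = 2) :
    ∃ f : MvPolynomial (Var q) F, jordanAut F 0 f = f ∧
      f ∉ lowInv F q ((p - 1) * Fintype.card ι + 1) := by
  classical
  have hp := hq i₀
  have hodd : p % 2 = 1 := Nat.odd_iff.mp ((Fact.out : p.Prime).odd_of_ne_two (by omega))
  refine exists_fixed_notMem_lowInv hq (i₀ := i₀) (by omega) one_pos ?_
  -- One of the two exponents of `low (top q i₀)` is odd, and both are at most `p`.
  have key : ∀ f g : MvPolynomial (Var q) F, diffOp (jordanAut F 0) f = 0 →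
      diffOp (jordanAut F 0) g = 0 → ∀ m m' : Var q →₀ ℕ, m' ≠ 0 →
      m + m' = extremalMon p q i₀ 1 → m (low (top q i₀)) % 2 = 1 →
      coeff m f = 0 ∨ coeff m' g = 0 := by
    intro f g hf hg m m' hm' hmm hmod
    have hsum : m (low (top q i₀)) + m' (low (top q i₀)) = 1 + (p - 1) := by
      rw [← Finsupp.add_apply, hmm, extremalMon_low_top (by omega)]
    have h1 : m ≤ extremalMon p q i₀ 1 := hmm ▸ le_self_add
    have h2 : m' ≤ extremalMon p q i₀ 1 := hmm ▸ le_add_self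
    by_cases hlt : m (low (top q i₀)) < p - 1
    · left
      by_cases hex : ∃ i, m (top q i) ≠ 0
      · obtain ⟨i, hi⟩ := hex
        exact coeff_eq_zero_of_le_extremalMon hq hq1 hi₀.ge hf h1 hlt ⟨i, Or.inl hi⟩
      · push Not at hex
        have hm1 : m = Finsupp.single ⟨i₀, ⟨1, by omega⟩⟩ (m (low (top q i₀))) := by
          have hj1 : low (top q i₀) = ⟨i₀, ⟨1, by omega⟩⟩ :=
            Var.ext rfl (by change q i₀ - 1 = 1; omega)
          rw [← hj1]
          ext j
          by_cases hj : j = low (top q i₀)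
          · rw [hj, Finsupp.single_eq_same]
          · rw [Finsupp.single_eq_of_ne hj]
            by_contra hne
            rcases extremalMon_support (p := p) (i₀ := i₀) (j := j) (ε := 1) (by have := h1 j; omega) with
              h | ⟨i, -, rfl⟩
            · exact hj h
            · exact hne (hex i)
        rw [hm1]
        exact coeff_eq_zero_of_odd hq hf hi₀ (Nat.odd_iff.mpr hmod) hlt
    · right
      rcases exists_ne_zero_of_le_extremalMon h2 hm' with h | ⟨i, h⟩
      · omega
      · exact coeff_eq_zero_of_le_extremalMon hq hq1 hi₀.ge hg h2 (by omega) ⟨i, Or.inl h⟩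
  intro f g hf hg m m' hm hm' hmm
  have hsum : m (low (top q i₀)) + m' (low (top q i₀)) = 1 + (p - 1) := by
    rw [← Finsupp.add_apply, hmm, extremalMon_low_top (by omega)]
  by_cases hmod : m (low (top q i₀)) % 2 = 1
  · exact key f g hf hg m m' hm' hmm hmod
  · exact (key g f hg hf m' m hm (by rw [add_comm, hmm]) (by omega)).symm

end Indecomposable

section JordanBasis

open Polynomial Module
open scoped DirectSum

variable {F V : Type*} [Field F] [AddCommGroup V] [Module F V]

/-! ### Jordan bases of nilpotent operators -/

theorem dfinsupp_basis_apply {ι R : Type*} [DecidableEq ι] {M : ι → Type*} [Semiring R]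
    [∀ i, AddCommMonoid (M i)] [∀ i, Module R (M i)] {η : ι → Type*} (b : ∀ i, Basis (η i) R (M i))
    (i : ι) (j : η i) : DFinsupp.basis b ⟨i, j⟩ = DFinsupp.single i (b i j) := by
  rw [← Basis.repr_symm_single_one, LinearEquiv.symm_apply_eq]
  change _ = (sigmaFinsuppLequivDFinsupp R).symm
    (DFinsupp.mapRange.linearEquiv (fun i => (b i).repr) (DFinsupp.single i (b i j)))
  rw [LinearEquiv.eq_symm_apply, DFinsupp.mapRange.linearEquiv_apply, DFinsupp.mapRange_single,
    Basis.repr_self]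
  exact sigmaFinsuppEquivDFinsupp_single _ _

/-- The structure theorem for torsion modules over `F[X]`, applied to the module defined by a
nilpotent operator; some of the blocks may be empty. -/
theorem exists_basis_sigma_of_pow_eq_zero [FiniteDimensional F V] (N : Module.End F V)
    {n : ℕ} (hN : N ^ n = 0) :
    ∃ (d : ℕ) (k : Fin d → ℕ) (B : Basis (Σ i, Fin (k i)) F V),
      ∀ i (a : Fin (k i)), N (B ⟨i, a⟩) = if h : (a : ℕ) + 1 < k i then B ⟨i, ⟨a + 1, h⟩⟩ else 0 := by
  have htors : Module.IsTorsion' (AEval F V N) (Submonoid.powers (X : F[X])) := by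
    intro x
    refine ⟨⟨X ^ n, n, rfl⟩, ?_⟩
    change (X ^ n : F[X]) • x = 0
    obtain ⟨v, rfl⟩ := (AEval.of F V N).surjective x
    rw [AEval.X_pow_smul_of, hN, zero_smul, map_zero]
  obtain ⟨d, k, ⟨φ⟩⟩ := Module.torsion_by_prime_power_decomposition irreducible_X htors
  have hmon : ∀ i, (X ^ k i : F[X]).Monic := fun i => monic_X_pow _
  have hpow : ∀ i (a : Fin (X ^ k i : F[X]).natDegree),
      AdjoinRoot.powerBasisAux' (hmon i) a = AdjoinRoot.mk (X ^ k i) (X ^ (a : ℕ)) := fun i a => by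
    have h := (AdjoinRoot.powerBasis' (hmon i)).basis_eq_pow a
    rw [map_pow]
    exact h
  have hX : ∀ i (f : F[X]), (X : F[X]) • (DFinsupp.single i (AdjoinRoot.mk (X ^ k i) f) :
      ⨁ i : Fin d, F[X] ⧸ Submodule.span F[X] {(X : F[X]) ^ (k i)})
        = DFinsupp.single i (AdjoinRoot.mk (X ^ k i) (X * f)) := fun i f =>
    (DFinsupp.single_smul _ _).symm
  let e : V ≃ₗ[F] (⨁ i : Fin d, F[X] ⧸ Submodule.span F[X] {(X : F[X]) ^ (k i)}) :=
    (AEval.of F V N).trans (φ.restrictScalars F)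
  let B0 : Basis (Σ i, Fin (X ^ k i : F[X]).natDegree) F
      (⨁ i : Fin d, F[X] ⧸ Submodule.span F[X] {(X : F[X]) ^ (k i)}) :=
    DFinsupp.basis fun i => (AdjoinRoot.powerBasisAux' (hmon i))
  let B1 := (B0.map e.symm).reindex
    (Equiv.sigmaCongrRight fun i => finCongr (natDegree_X_pow (R := F) (k i)))
  refine ⟨d, k, B1, fun i a => ?_⟩
  have hB1 : ∀ i (a : Fin (k i)), B1 ⟨i, a⟩
      = e.symm (DFinsupp.single i (AdjoinRoot.mk (X ^ k i) (X ^ (a : ℕ)))) := by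
    intro i a
    rw [Basis.reindex_apply, Basis.map_apply]
    congr 1
    exact (dfinsupp_basis_apply _ _ _).trans (congrArg (DFinsupp.single i) (hpow i _))
  have hNe : ∀ y, N (e.symm y) = e.symm ((X : F[X]) • y) := by
    intro y
    change N ((AEval.of F V N).symm (φ.symm y)) = (AEval.of F V N).symm (φ.symm ((X : F[X]) • y))
    rw [map_smul, AEval.of_symm_X_smul]
    rfl
  rw [hB1, hNe, hX, ← pow_succ']
  split_ifs with h
  · rw [hB1]
  · have h0 : AdjoinRoot.mk (X ^ k i : F[X]) (X ^ ((a : ℕ) + 1)) = 0 := by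
      rw [AdjoinRoot.mk_eq_zero]
      exact pow_dvd_pow _ (by omega)
    rw [h0]
    exact (congrArg e.symm (DFinsupp.single_zero i)).trans (map_zero _)

/-- A nilpotent operator has a Jordan basis. The blocks are nonempty, and the block `i` has
`q i + 1` vectors. -/
theorem exists_jordan_basis [FiniteDimensional F V] (N : Module.End F V) {n : ℕ} (hN : N ^ n = 0) :
    ∃ (ι : Type) (_ : Fintype ι) (q : ι → ℕ) (b : Basis (Var q) F V),
      ∀ j, N (b j) = if 0 < (j.2 : ℕ) then b (low j) else 0 := by
  obtain ⟨d, k, B, hB⟩ := exists_basis_sigma_of_pow_eq_zero N hN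
  -- Empty blocks are dropped, and the order of each block is reversed.
  let q : {i : Fin d // 0 < k i} → ℕ := fun i => k i - 1
  let e : Var q ≃ Σ i, Fin (k i) :=
    { toFun := fun j => ⟨j.1, ⟨k j.1 - 1 - j.2, by have := j.1.2; omega⟩⟩
      invFun := fun a => ⟨⟨a.1, a.2.pos⟩, ⟨k a.1 - 1 - a.2, by
        change _ < k a.1 - 1 + 1
        omega⟩⟩
      left_inv := fun j => Var.ext rfl (by
        have h := j.snd_le
        change (j.2 : ℕ) ≤ k j.1 - 1 at h
        change k j.1 - 1 - (k j.1 - 1 - j.2) = (j.2 : ℕ)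
        omega)
      right_inv := fun a => Sigma.ext rfl (heq_of_eq (Fin.ext (by
        change k a.1 - 1 - (k a.1 - 1 - a.2) = (a.2 : ℕ)
        omega))) }
  refine ⟨_, inferInstance, q, B.reindex e.symm, fun j => ?_⟩
  have hj := j.snd_le
  have hj' := j.1.2
  change (j.2 : ℕ) ≤ k j.1 - 1 at hj
  rw [Basis.reindex_apply, Basis.reindex_apply, Equiv.symm_symm]
  change N (B ⟨j.1, ⟨k j.1 - 1 - j.2, _⟩⟩)
    = if 0 < (j.2 : ℕ) then B ⟨j.1, ⟨k j.1 - 1 - (j.2 - 1), _⟩⟩ else 0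
  rw [hB]
  by_cases h : 0 < (j.2 : ℕ)
  · rw [if_pos h, dif_pos (by change k j.1 - 1 - (j.2 : ℕ) + 1 < k j.1; omega)]
    congr 3
    change k j.1 - 1 - (j.2 : ℕ) + 1 = k j.1 - 1 - (j.2 - 1)
    omega
  · rw [if_neg h, dif_neg (by change ¬ (k j.1 - 1 - (j.2 : ℕ) + 1 < k j.1); omega)]

section Basis

variable {ι : Type*} {q : ι → ℕ} {N : Module.End F V} {b : Basis (Var q) F V}

theorem repr_of_jordan_basis [Fintype ι]
    (hb : ∀ j, N (b j) = if 0 < (j.2 : ℕ) then b (low j) else 0)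
    (x : V) (j : Var q) (hj : (j.2 : ℕ) < q j.1) : b.repr (N x) j = b.repr x (up j hj) := by
  classical
  have h : b.coord j ∘ₗ N = b.coord (up j hj) := by
    refine b.ext fun j' => ?_
    rw [LinearMap.comp_apply, hb, Basis.coord_apply, Basis.coord_apply, Basis.repr_self,
      Finsupp.single_apply]
    split_ifs with h1 h2 h2
    · rw [h2, show low (up j hj) = j from Var.ext rfl (Nat.add_sub_cancel _ _), Basis.repr_self,
        Finsupp.single_eq_same]
    · rw [Basis.repr_self, Finsupp.single_eq_of_ne]
      rintro rfl
      exact h2 (Var.ext rfl (Nat.sub_add_cancel h1).symm)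
    · exact absurd (by rw [h2]; exact Nat.succ_pos _) h1
    · rw [map_zero, Finsupp.zero_apply]
  exact LinearMap.congr_fun h x

theorem pow_apply_jordan_basis (hb : ∀ j, N (b j) = if 0 < (j.2 : ℕ) then b (low j) else 0) (a : ℕ)
    (j : Var q) : (N ^ a) (b j) = if a ≤ (j.2 : ℕ) then b ⟨j.1, ⟨j.2 - a, by omega⟩⟩ else 0 := by
  induction a with
  | zero => rw [if_pos (Nat.zero_le _)]; rfl
  | succ a ih =>
    rw [pow_succ', Module.End.mul_apply, ih]
    by_cases h : a ≤ (j.2 : ℕ)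
    · rw [if_pos h, hb]
      by_cases h' : a + 1 ≤ (j.2 : ℕ)
      · rw [if_pos h', if_pos (by change 0 < (j.2 : ℕ) - a; omega)]
        rfl
      · rw [if_neg h', if_neg (by change ¬ 0 < (j.2 : ℕ) - a; omega)]
    · rw [if_neg h, if_neg (by omega), map_zero]

theorem pow_eq_zero_iff_of_jordan_basis
    (hb : ∀ j, N (b j) = if 0 < (j.2 : ℕ) then b (low j) else 0) (a : ℕ) :
    N ^ a = 0 ↔ ∀ i, q i < a := by
  constructor
  · intro h i
    by_contra hcon
    have h1 := pow_apply_jordan_basis hb a (top q i)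
    rw [h, if_pos (by rw [top_snd]; omega), LinearMap.zero_apply] at h1
    exact b.ne_zero _ h1.symm
  · intro h
    refine b.ext fun j => ?_
    rw [pow_apply_jordan_basis hb, if_neg, LinearMap.zero_apply]
    have := j.snd_le
    have := h j.1
    omega

theorem finrank_ker_of_jordan_basis [Fintype ι]
    (hb : ∀ j, N (b j) = if 0 < (j.2 : ℕ) then b (low j) else 0) :
    finrank F (LinearMap.ker N) = Fintype.card ι := by
  have hinj : Function.Injective fun i : ι => (⟨i, 0⟩ : Var q) := fun i i' h => congrArg Sigma.fst h
  have hker : LinearMap.ker N = Submodule.span F (Set.range fun i : ι => b ⟨i, 0⟩) := by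
    refine le_antisymm (fun x hx => ?_) ?_
    · have hx' : ∀ j : Var q, 0 < (j.2 : ℕ) → b.repr x j = 0 := by
        intro j hj
        have hlt : ((low j).2 : ℕ) < q (low j).1 := by
          have := j.snd_le
          change (j.2 : ℕ) - 1 < q j.1
          omega
        have h := repr_of_jordan_basis hb x (low j) hlt
        rw [LinearMap.mem_ker.mp hx, map_zero, Finsupp.zero_apply] at h
        rw [show j = up (low j) hlt from Var.ext rfl (Nat.sub_add_cancel hj).symm, ← h]
      rw [← b.sum_repr x]
      refine Submodule.sum_mem _ fun j _ => ?_
      by_cases hj : 0 < (j.2 : ℕ)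
      · rw [hx' j hj, zero_smul]
        exact Submodule.zero_mem _
      · refine Submodule.smul_mem _ _ (Submodule.subset_span ⟨j.1, ?_⟩)
        exact congrArg b (Var.ext rfl (by change 0 = (j.2 : ℕ); omega))
    · rw [Submodule.span_le]
      rintro _ ⟨i, rfl⟩
      exact (hb _).trans (if_neg (lt_irrefl 0))
  rw [hker]
  exact finrank_span_eq_card (b.linearIndependent.comp _ hinj)

end Basis

end JordanBasis

section CyclicRepresentation

open Module

variable {F : Type*} [Field F] {p : ℕ} {V W : Type*} [AddCommGroup V] [Module F V]
  [AddCommGroup W] [Module F W]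

/-! ### Representations of the cyclic group -/

/-- The generator of `Z/p`. -/
def gen (p : ℕ) : Multiplicative (ZMod p) := Multiplicative.ofAdd 1

theorem mem_zpowers_gen [NeZero p] (g : Multiplicative (ZMod p)) :
    g ∈ Subgroup.zpowers (gen p) := by
  refine ⟨((Multiplicative.toAdd g).val : ℤ), ?_⟩
  change gen p ^ ((Multiplicative.toAdd g).val : ℤ) = g
  rw [zpow_natCast, gen, ← ofAdd_nsmul, nsmul_one, ZMod.natCast_zmod_val, ofAdd_toAdd]

theorem gen_pow : gen p ^ p = 1 := by
  rw [gen, ← ofAdd_nsmul, nsmul_one, ZMod.natCast_self, ofAdd_zero]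

theorem intertwine_sub_one_pow {G : Type*} [Group G] {τ : Representation F G V}
    {ρ : Representation F G W} (j : V →ₗ[F] W) (g : G) (h : ∀ v, j (τ g v) = ρ g (j v)) (a : ℕ)
    (v : V) : j (((τ g - 1) ^ a) v) = ((ρ g - 1) ^ a) (j v) := by
  induction a generalizing v with
  | zero => rfl
  | succ a ih =>
    rw [pow_succ, Module.End.mul_apply, ih, pow_succ, Module.End.mul_apply, LinearMap.sub_apply,
      map_sub, h]
    rfl

/-- The operator `γ - 1` on the linear forms, where `γ` is the generator of `Z/p`. -/
def dualOp (ρ : Representation F (Multiplicative (ZMod p)) W) : Module.End F (Dual F W) :=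
  ρ.dual (gen p) - 1

theorem dualOp_pow_apply (ρ : Representation F (Multiplicative (ZMod p)) W) (a : ℕ) (f : Dual F W)
    (w : W) : (dualOp ρ ^ a) f w = f (((ρ (gen p)⁻¹ - 1) ^ a) w) := by
  induction a generalizing f with
  | zero => rfl
  | succ a ih =>
    rw [pow_succ, Module.End.mul_apply, ih, pow_succ', Module.End.mul_apply, LinearMap.sub_apply,
      map_sub]
    rfl

theorem dualOp_pow_char [Fact p.Prime] [CharP F p]
    (ρ : Representation F (Multiplicative (ZMod p)) W) : dualOp ρ ^ p = 0 := by
  have h : ρ.dual (gen p) ^ p = 1 := by rw [← map_pow, gen_pow, map_one]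
  exact (sub_one_pow_char_of_algebra (F := F) p (A := Module.End F (Dual F W)) _).trans
    (by rw [h, sub_self])

/-- A group element and its inverse have the same nilpotency index after subtracting `1`. -/
theorem dualOp_pow_eq_zero_iff (ρ : Representation F (Multiplicative (ZMod p)) W) (a : ℕ) :
    dualOp ρ ^ a = 0 ↔ (ρ (gen p) - 1) ^ a = 0 := by
  have h1 : dualOp ρ ^ a = 0 ↔ (ρ (gen p)⁻¹ - 1) ^ a = 0 := by
    constructor
    · intro h
      refine LinearMap.ext fun w => (Module.forall_dual_apply_eq_zero_iff F _).mp fun f => ?_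
      rw [← dualOp_pow_apply, h]
      rfl
    · intro h
      refine LinearMap.ext fun f => LinearMap.ext fun w => ?_
      rw [dualOp_pow_apply, h, LinearMap.zero_apply, map_zero]
      rfl
  have h2 : ∀ g, ρ g⁻¹ - 1 = -ρ g⁻¹ * (ρ g - 1) := fun g => by
    rw [mul_sub, mul_one, neg_mul, ← map_mul, inv_mul_cancel, map_one]
    abel
  have h3 : ∀ g, (ρ g - 1) ^ a = 0 → (ρ g⁻¹ - 1) ^ a = 0 := fun g h => by
    have hcomm : Commute (-ρ g⁻¹) (ρ g - 1) := by
      refine (Commute.sub_right ?_ (Commute.one_right _)).neg_left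
      change ρ g⁻¹ * ρ g = ρ g * ρ g⁻¹
      rw [← map_mul, ← map_mul, inv_mul_cancel, mul_inv_cancel]
    rw [h2, hcomm.mul_pow, h, mul_zero]
  rw [h1]
  exact ⟨fun h => by simpa using h3 _ h, h3 _⟩

/-- The fixed space of `W` has the same dimension as that of the dual of `W`, since an operator and
its transpose have the same rank. -/
theorem finrank_invariants [NeZero p] [FiniteDimensional F W]
    (ρ : Representation F (Multiplicative (ZMod p)) W) :
    finrank F ρ.invariants = finrank F (LinearMap.ker (dualOp ρ)) := by
  set A : W →ₗ[F] W := ρ (gen p)⁻¹ - 1 with hA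
  have h1 : ρ.invariants = LinearMap.ker A := by
    ext w
    rw [ρ.mem_invariants_iff_of_forall_mem_zpowers (gen p)⁻¹
      (fun g => by rw [Subgroup.zpowers_inv]; exact mem_zpowers_gen g), LinearMap.mem_ker, hA,
      LinearMap.sub_apply, sub_eq_zero]
    rfl
  have h2 : dualOp ρ = A.dualMap := by
    refine LinearMap.ext fun f => LinearMap.ext fun w => ?_
    have := dualOp_pow_apply ρ 1 f w
    rw [pow_one, pow_one] at this
    exact this
  have h3 := LinearMap.finrank_range_add_finrank_ker A
  have h4 := LinearMap.finrank_range_add_finrank_ker A.dualMap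
  rw [LinearMap.finrank_range_dualMap_eq_finrank_range, Subspace.dual_finrank_eq] at h4
  rw [h1, h2]
  omega

/-- A Jordan block of size one in the dual of a representation splits off a trivial summand. -/
theorem one_le_of_isReduced [NeZero p] [FiniteDimensional F W]
    {ρ : Representation F (Multiplicative (ZMod p)) W} (hred : IsReduced ρ) {ι : Type*} {q : ι → ℕ}
    {b : Basis (Var q) F (Dual F W)}
    (hb : ∀ j, dualOp ρ (b j) = if 0 < (j.2 : ℕ) then b (low j) else 0) (i : ι) : 1 ≤ q i := by
  by_contra hq
  let j₀ : Var q := ⟨i, 0⟩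
  let x : Dual F W := b j₀
  obtain ⟨w, hw⟩ : ∃ w : W, ∀ f : Dual F W, f w = b.coord j₀ f :=
    ⟨(evalEquiv F W).symm (b.coord j₀), fun f => apply_evalEquiv_symm_apply _ _ _ _⟩
  have hcoord : b.coord j₀ ∘ₗ dualOp ρ = 0 := by
    refine b.ext fun j => ?_
    rw [LinearMap.comp_apply, hb]
    split_ifs with hj
    · rw [Basis.coord_apply, Basis.repr_self, Finsupp.single_eq_of_ne]
      · rfl
      · intro h
        have h1 : i = j.1 := congrArg Sigma.fst h
        have h2 := j.snd_le
        have h3 : q i = q j.1 := congrArg q h1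
        omega
    · rw [map_zero]
      rfl
  have hwinv : ∀ g, ρ g w = w := by
    refine (ρ.mem_invariants_iff_of_forall_mem_zpowers (gen p)⁻¹
      (fun g => by rw [Subgroup.zpowers_inv]; exact mem_zpowers_gen g) w).mpr ?_
    rw [← sub_eq_zero]
    refine (Module.forall_dual_apply_eq_zero_iff F _).mp fun f => ?_
    have h := dualOp_pow_apply ρ 1 f w
    rw [pow_one, pow_one, hw] at h
    exact h.symm.trans (LinearMap.congr_fun hcoord f)
  have hxinv : ∀ g v, x (ρ g v) = x v := by
    have h : x ∈ ρ.dual.invariants := by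
      rw [ρ.dual.mem_invariants_iff_of_forall_mem_zpowers (gen p) mem_zpowers_gen, ← sub_eq_zero]
      exact (hb j₀).trans (if_neg (lt_irrefl 0))
    intro g v
    have h' := LinearMap.congr_fun (h g⁻¹) v
    rw [Representation.dual_apply, inv_inv] at h'
    exact h'
  have hxw : x w = 1 := by
    rw [hw, Basis.coord_apply, Basis.repr_self, Finsupp.single_eq_same]
  let U : Subrepresentation ρ := ⟨Submodule.span F {w}, fun g v hv => by
    obtain ⟨a, rfl⟩ := Submodule.mem_span_singleton.mp hv
    rw [map_smul, hwinv]
    exact hv⟩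
  let U' : Subrepresentation ρ := ⟨LinearMap.ker x, fun g v hv => by
    rw [LinearMap.mem_ker, hxinv]
    exact hv⟩
  have hU : U = ⊥ := by
    refine hred U U' ⟨disjoint_iff.mpr ?_, codisjoint_iff.mpr ?_⟩ ⟨fun g => ?_⟩
    · refine Subrepresentation.toSubmodule_injective ?_
      rw [Subrepresentation.toSubmodule_inf]
      change Submodule.span F {w} ⊓ LinearMap.ker x = ⊥
      rw [eq_bot_iff]
      rintro v ⟨hv, hv'⟩
      obtain ⟨a, rfl⟩ := Submodule.mem_span_singleton.mp hv
      have h : x (a • w) = 0 := hv'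
      rw [map_smul, hxw, smul_eq_mul, mul_one] at h
      rw [h, zero_smul]
      exact Submodule.zero_mem _
    · refine Subrepresentation.toSubmodule_injective ?_
      rw [Subrepresentation.toSubmodule_sup]
      change Submodule.span F {w} ⊔ LinearMap.ker x = ⊤
      rw [eq_top_iff]
      intro v _
      refine Submodule.mem_sup.mpr ⟨x v • w, Submodule.smul_mem _ _ (Submodule.mem_span_singleton_self w),
        v - x v • w, ?_, add_sub_cancel _ _⟩
      rw [LinearMap.mem_ker, map_sub, map_smul, hxw, smul_eq_mul, mul_one, sub_self]
    · refine LinearMap.ext fun ⟨v, hv⟩ => Subtype.ext ?_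
      change ρ g v = v
      obtain ⟨a, rfl⟩ := Submodule.mem_span_singleton.mp hv
      rw [map_smul, hwinv]
  have hw0 : w ∈ (⊥ : Submodule F W) := by
    have h : U.toSubmodule = ⊥ := congrArg Subrepresentation.toSubmodule hU
    rw [← h]
    exact Submodule.mem_span_singleton_self w
  rw [(Submodule.mem_bot F).mp hw0, map_zero] at hxw
  exact zero_ne_one hxw

theorem jordanRep_sub_one_pow_apply [Fact p.Prime] [CharP F p] {n : ℕ} (hn : n ≤ p) (a : ℕ)
    (v : Fin n → F) (i : Fin n) : ((jordanRep F p n hn (gen p) - 1) ^ a) v i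
      = if h : (i : ℕ) + a < n then v ⟨i + a, h⟩ else 0 := by
  have h1 : ∀ (v : Fin n → F) (i : Fin n), (jordanRep F p n hn (gen p) - 1) v i
      = if h : (i : ℕ) + 1 < n then v ⟨i + 1, h⟩ else 0 := by
    intro v i
    have hJ : jordanRep F p n hn (gen p) = Matrix.toLin' (jordanBlock F n) := by
      change Matrix.toLin' (jordanBlock F n ^ (1 : ZMod p).val) = _
      have : Fact (1 < p) := ⟨(Fact.out : p.Prime).one_lt⟩
      rw [ZMod.val_one, pow_one]
    rw [LinearMap.sub_apply, Pi.sub_apply, hJ, Matrix.toLin'_apply, Matrix.mulVec, dotProduct]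
    have h2 : ∀ j : Fin n, jordanBlock F n i j * v j
        = (if j = i then v j else 0) + if (j : ℕ) = i + 1 then v j else 0 := by
      intro j
      rw [jordanBlock, Matrix.of_apply]
      by_cases hj : j = i
      · subst hj
        simp
      · have hj' : (j : ℕ) ≠ i := fun h => hj (Fin.ext h)
        by_cases hj2 : (j : ℕ) = i + 1 <;> simp [hj, hj', hj2]
    simp_rw [h2]
    rw [Finset.sum_add_distrib, Finset.sum_ite_eq' Finset.univ i, if_pos (Finset.mem_univ i),
      Module.End.one_apply, add_sub_cancel_left]
    split_ifs with h
    · rw [Finset.sum_eq_single_of_mem ⟨i + 1, h⟩ (Finset.mem_univ _)]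
      · rw [if_pos rfl]
      · exact fun j _ hj => if_neg fun h' => hj (Fin.ext h')
    · exact Finset.sum_eq_zero fun j _ => if_neg fun h' => h (by
        rw [← h']
        exact j.isLt)
  induction a generalizing i with
  | zero => rw [dif_pos (by exact i.isLt)]; rfl
  | succ a ih =>
    rw [pow_succ', Module.End.mul_apply, h1]
    split_ifs with h h' h'
    · rw [ih, dif_pos (by change (i : ℕ) + 1 + a < n; omega)]
      congr 2
      change (i : ℕ) + 1 + a = i + (a + 1)
      omega
    · rw [ih, dif_neg (by change ¬ (i : ℕ) + 1 + a < n; omega)]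
    · omega
    · rfl

theorem jordanRep_sub_one_pow_eq_zero_iff [Fact p.Prime] [CharP F p] {n : ℕ} (hn : n ≤ p) (a : ℕ) :
    (jordanRep F p n hn (gen p) - 1) ^ a = 0 ↔ n ≤ a := by
  constructor
  · intro h
    by_contra hlt
    have h1 := jordanRep_sub_one_pow_apply (F := F) hn a (fun _ => 1) ⟨0, by omega⟩
    rw [h, dif_pos (by change 0 + a < n; omega)] at h1
    exact zero_ne_one h1
  · intro h
    refine LinearMap.ext fun v => funext fun i => ?_
    rw [jordanRep_sub_one_pow_apply, dif_neg (by omega)]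
    rfl

theorem le_of_hasSummand_jordanRep [Fact p.Prime] [CharP F p]
    {ρ : Representation F (Multiplicative (ZMod p)) W} {n : ℕ} (hn : n ≤ p)
    (h : HasSummand ρ (jordanRep F p n hn)) {a : ℕ} (ha : (ρ (gen p) - 1) ^ a = 0) : n ≤ a := by
  obtain ⟨U, U', -, ⟨φ⟩⟩ := h
  rw [← jordanRep_sub_one_pow_eq_zero_iff (F := F) hn]
  refine LinearMap.ext fun v => ?_
  let j : (Fin n → F) →ₗ[F] W := U.toSubmodule.subtype ∘ₗ φ.symm.toLinearMap
  have hj : Function.Injective j := U.toSubmodule.injective_subtype.comp φ.symm.toLinearEquiv.injective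
  refine hj ?_
  rw [intertwine_sub_one_pow (ρ := ρ) j (gen p), ha]
  · exact (map_zero j).symm
  · intro v
    have := LinearMap.congr_fun (φ.symm.isIntertwining' (gen p)) v
    exact congrArg U.toSubmodule.subtype this

/-- In a sum of copies of `V_2` and `V_3`, with `V_3` occurring, the operator `γ - 1` has the
nilpotency index `3`. -/
theorem sub_one_pow_of_equiv_sum [Fact p.Prime] [CharP F p]
    {ρ : Representation F (Multiplicative (ZMod p)) W} {m l : ℕ} (h2 : 2 ≤ p) (h3 : 3 ≤ p)
    (hl : 0 < l) (φ : ρ.Equiv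
      ((Representation.directSum fun _ : Fin m => jordanRep F p 2 h2).prod
        (Representation.directSum fun _ : Fin l => jordanRep F p 3 h3))) :
    (ρ (gen p) - 1) ^ 3 = 0 ∧ (ρ (gen p) - 1) ^ 2 ≠ 0 := by
  have hφ : ∀ g v, φ.toLinearMap (ρ g v) = _ := fun g v => LinearMap.congr_fun (φ.isIntertwining' g) v
  constructor
  · refine LinearMap.ext fun w => φ.toLinearEquiv.injective (Prod.ext ?_ ?_)
    · refine DFinsupp.ext fun i => ?_
      have h := intertwine_sub_one_pow (τ := ρ) (ρ := jordanRep F p 2 h2)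
        (DirectSum.component F (Fin m) (fun _ => Fin 2 → F) i ∘ₗ LinearMap.fst F _ _ ∘ₗ φ.toLinearMap)
        (gen p) (fun v => by
          change (φ.toLinearMap (ρ (gen p) v)).1 i = _
          rw [hφ]
          rfl) 3 w
      rw [(jordanRep_sub_one_pow_eq_zero_iff (F := F) h2 3).mpr (by norm_num)] at h
      refine h.trans ?_
      rw [LinearMap.zero_apply, LinearMap.zero_apply, map_zero]
      rfl
    · refine DFinsupp.ext fun i => ?_
      have h := intertwine_sub_one_pow (τ := ρ) (ρ := jordanRep F p 3 h3)
        (DirectSum.component F (Fin l) (fun _ => Fin 3 → F) i ∘ₗ LinearMap.snd F _ _ ∘ₗ φ.toLinearMap)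
        (gen p) (fun v => by
          change (φ.toLinearMap (ρ (gen p) v)).2 i = _
          rw [hφ]
          rfl) 3 w
      rw [(jordanRep_sub_one_pow_eq_zero_iff (F := F) h3 3).mpr le_rfl] at h
      refine h.trans ?_
      rw [LinearMap.zero_apply, LinearMap.zero_apply, map_zero]
      rfl
  · intro h0
    have h4 : ¬ (jordanRep F p 3 h3 (gen p) - 1) ^ 2 = 0 := by
      rw [jordanRep_sub_one_pow_eq_zero_iff]
      norm_num
    refine h4 (LinearMap.ext fun v => ?_)
    have h := intertwine_sub_one_pow (τ := ρ) (ρ := jordanRep F p 3 h3)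
      (DirectSum.component F (Fin l) (fun _ => Fin 3 → F) ⟨0, hl⟩ ∘ₗ LinearMap.snd F _ _
        ∘ₗ φ.toLinearMap)
      (gen p) (fun v => by
        change (φ.toLinearMap (ρ (gen p) v)).2 _ = _
        rw [hφ]
        rfl) 2 (φ.toLinearEquiv.symm (0, DirectSum.lof F (Fin l) (fun _ => Fin 3 → F) ⟨0, hl⟩ v))
    rw [h0, LinearMap.zero_apply, map_zero] at h
    refine Eq.trans ?_ h.symm
    congr 1
    change v = (φ.toLinearEquiv (φ.toLinearEquiv.symm _)).2 ⟨0, hl⟩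
    rw [LinearEquiv.apply_symm_apply]
    exact (DirectSum.lof_apply (M := fun _ : Fin l => Fin 3 → F) F _ _).symm

end CyclicRepresentation

section Transport

open Module

variable {F : Type*} [Field F] {p : ℕ} {W : Type*} [AddCommGroup W] [Module F W]

/-! ### The coordinate ring as a polynomial ring -/

theorem coordAction_one {G : Type*} [Group G] (ρ : Representation F G W) (f : CoordRing F W) :
    coordAction ρ 1 f = f := by
  have h : coordAction ρ 1 = AlgHom.id F _ := by
    refine SymmetricAlgebra.algHom_ext (LinearMap.ext fun x => ?_)
    change SymmetricAlgebra.lift _ (SymmetricAlgebra.ι F _ x) = SymmetricAlgebra.ι F _ x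
    rw [SymmetricAlgebra.lift_ι_apply, map_one]
    rfl
  rw [h]
  rfl

theorem coordAction_mul {G : Type*} [Group G] (ρ : Representation F G W) (g h : G)
    (f : CoordRing F W) : coordAction ρ (g * h) f = coordAction ρ g (coordAction ρ h f) := by
  have key : coordAction ρ (g * h) = (coordAction ρ g).comp (coordAction ρ h) := by
    refine SymmetricAlgebra.algHom_ext (LinearMap.ext fun x => ?_)
    change SymmetricAlgebra.lift _ (SymmetricAlgebra.ι F _ x)
      = coordAction ρ g (SymmetricAlgebra.lift _ (SymmetricAlgebra.ι F _ x))
    rw [SymmetricAlgebra.lift_ι_apply, SymmetricAlgebra.lift_ι_apply, map_mul]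
    exact (SymmetricAlgebra.lift_ι_apply
      (f := SymmetricAlgebra.ι F (Module.Dual F W) ∘ₗ ρ.dual g) (ρ.dual h x)).symm
  rw [key]
  rfl

theorem mem_invariantRing_iff [NeZero p] (ρ : Representation F (Multiplicative (ZMod p)) W)
    (f : CoordRing F W) : f ∈ invariantRing ρ ↔ coordAction ρ (gen p) f = f := by
  refine ⟨fun h => h _, fun h g => ?_⟩
  have hpow : ∀ n : ℕ, coordAction ρ (gen p ^ n) f = f := by
    intro n
    induction n with
    | zero => rw [pow_zero, coordAction_one]
    | succ n ih => rw [pow_succ, coordAction_mul, h, ih]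
  obtain ⟨n, rfl⟩ := mem_powers_iff_mem_zpowers.mpr (mem_zpowers_gen g)
  exact hpow n

variable {ι : Type*} {q : ι → ℕ} (b : Basis (Var q) F (Dual F W))

theorem equivMvPolynomial_coordAction {ρ : Representation F (Multiplicative (ZMod p)) W}
    (hb : ∀ j, dualOp ρ (b j) = if 0 < (j.2 : ℕ) then b (low j) else 0) (f : CoordRing F W) :
    SymmetricAlgebra.equivMvPolynomial b (coordAction ρ (gen p) f)
      = jordanAut F 0 (SymmetricAlgebra.equivMvPolynomial b f) := by
  have h : (SymmetricAlgebra.equivMvPolynomial b).toAlgHom.comp (coordAction ρ (gen p))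
      = (jordanAut F 0).comp (SymmetricAlgebra.equivMvPolynomial b).toAlgHom := by
    refine SymmetricAlgebra.algHom_ext (b.ext fun j => ?_)
    change SymmetricAlgebra.equivMvPolynomial b
        (SymmetricAlgebra.lift _ (SymmetricAlgebra.ι F _ (b j)))
      = jordanAut F 0 (SymmetricAlgebra.equivMvPolynomial b (SymmetricAlgebra.ι F _ (b j)))
    have hj : ρ.dual (gen p) (b j) = b j + if 0 < (j.2 : ℕ) then b (low j) else 0 := by
      rw [← hb, dualOp, LinearMap.sub_apply, Module.End.one_apply, add_sub_cancel]
    rw [SymmetricAlgebra.lift_ι_apply, SymmetricAlgebra.equivMvPolynomial_ι_apply, jordanAut_X,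
      LinearMap.comp_apply, hj, map_add, map_add, SymmetricAlgebra.equivMvPolynomial_ι_apply]
    congr 1
    by_cases h : 0 < (j.2 : ℕ)
    · rw [if_pos h, SymmetricAlgebra.equivMvPolynomial_ι_apply]
      exact (if_pos h).symm
    · rw [if_neg h, map_zero, map_zero]
      exact (if_neg h).symm
  exact DFunLike.congr_fun h f

theorem map_homogeneousPart (n : ℕ) :
    (homogeneousPart F W n).map (SymmetricAlgebra.equivMvPolynomial b).toAlgHom.toLinearMap
      = MvPolynomial.homogeneousSubmodule (Var q) F n := by
  rw [homogeneousPart, Submodule.map_pow, ← MvPolynomial.homogeneousSubmodule_one_pow]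
  congr 1
  rw [MvPolynomial.homogeneousSubmodule_one_eq_span_X, ← LinearMap.range_comp,
    LinearMap.range_eq_map, ← b.span_eq, Submodule.map_span, ← Set.range_comp]
  congr 2
  exact funext fun j => SymmetricAlgebra.equivMvPolynomial_ι_apply b j

theorem mem_homogeneousPart_iff (n : ℕ) (f : CoordRing F W) :
    f ∈ homogeneousPart F W n ↔ SymmetricAlgebra.equivMvPolynomial b f
      ∈ MvPolynomial.restrictSupport F {m : Var q →₀ ℕ | m.degree = n} := by
  rw [mem_degree_iff_isHomogeneous, ← MvPolynomial.mem_homogeneousSubmodule, ← map_homogeneousPart b]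
  refine ⟨fun h => ⟨f, h, rfl⟩, ?_⟩
  rintro ⟨g, hg, hgf⟩
  rwa [← (SymmetricAlgebra.equivMvPolynomial b).injective hgf]

theorem mem_invHom_equivMvPolynomial_iff [NeZero p]
    {ρ : Representation F (Multiplicative (ZMod p)) W}
    (hb : ∀ j, dualOp ρ (b j) = if 0 < (j.2 : ℕ) then b (low j) else 0) (n : ℕ)
    (f : CoordRing F W) : SymmetricAlgebra.equivMvPolynomial b f ∈ invHom F q n
      ↔ f ∈ homogeneousPart F W n ∧ f ∈ invariantRing ρ := by
  rw [mem_invHom, mem_homogeneousPart_iff b, mem_invariantRing_iff,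
    ← equivMvPolynomial_coordAction b hb, EmbeddingLike.apply_eq_iff_eq]

/-- Degree bounds for generators can be read off in the coordinates of a Jordan basis of the linear
forms, where the generator of `Z/p` acts by `jordanAut F 0`. -/
theorem generatedInDegreeLE_iff [NeZero p] {ρ : Representation F (Multiplicative (ZMod p)) W}
    (hb : ∀ j, dualOp ρ (b j) = if 0 < (j.2 : ℕ) then b (low j) else 0) (d : ℕ) :
    GeneratedInDegreeLE ρ d ↔ ∀ f : MvPolynomial (Var q) F, jordanAut F 0 f = f →
      f ∈ lowInv F q (d + 1) := by
  set Φ := SymmetricAlgebra.equivMvPolynomial b with hΦ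
  constructor
  · rintro ⟨S, hS, hS'⟩ f hf
    have hmem : Φ.symm f ∈ Algebra.adjoin F S := by
      rw [hS', mem_invariantRing_iff]
      refine Φ.injective ?_
      rw [equivMvPolynomial_coordAction b hb, ← hΦ, AlgEquiv.apply_symm_apply, hf]
    have hle : Algebra.adjoin F S ≤ (lowInv F q (d + 1)).comap Φ.toAlgHom := by
      refine Algebra.adjoin_le fun s hs => ?_
      obtain ⟨n, hn, hsn⟩ := hS s hs
      refine Algebra.subset_adjoin ⟨n, Nat.lt_succ_of_le hn, ?_⟩
      exact (mem_invHom_equivMvPolynomial_iff b hb n s).mpr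
        ⟨hsn, hS' ▸ Algebra.subset_adjoin hs⟩
    have h : Φ (Φ.symm f) ∈ lowInv F q (d + 1) := hle hmem
    rwa [AlgEquiv.apply_symm_apply] at h
  · intro h
    refine ⟨{f | ∃ n ≤ d, f ∈ homogeneousPart F W n ∧ f ∈ invariantRing ρ},
      fun f ⟨n, hn, hf, _⟩ => ⟨n, hn, hf⟩, le_antisymm ?_ ?_⟩
    · exact Algebra.adjoin_le fun f ⟨_, _, _, hf⟩ => hf
    · intro f hf
      rw [mem_invariantRing_iff] at hf
      have hmem := h (Φ f) (by rw [← equivMvPolynomial_coordAction b hb, hf])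
      have hle : lowInv F q (d + 1) ≤ (Algebra.adjoin F
          {f | ∃ n ≤ d, f ∈ homogeneousPart F W n ∧ f ∈ invariantRing ρ}).comap Φ.symm.toAlgHom := by
        refine Algebra.adjoin_le fun s ⟨n, hn, hs⟩ => ?_
        refine Algebra.subset_adjoin ⟨n, Nat.le_of_lt_succ hn, ?_⟩
        refine (mem_invHom_equivMvPolynomial_iff b hb n _).mp ?_
        change Φ (Φ.symm s) ∈ _
        rwa [AlgEquiv.apply_symm_apply]
      have h' : Φ.symm (Φ f) ∈ Algebra.adjoin F
          {f | ∃ n ≤ d, f ∈ homogeneousPart F W n ∧ f ∈ invariantRing ρ} := hle hmem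
      rwa [AlgEquiv.symm_apply_apply] at h'

theorem isNoetherNumber_of_lowInv [NeZero p] {ρ : Representation F (Multiplicative (ZMod p)) W}
    (hb : ∀ j, dualOp ρ (b j) = if 0 < (j.2 : ℕ) then b (low j) else 0) {d : ℕ}
    (hle : ∀ f : MvPolynomial (Var q) F, jordanAut F 0 f = f → f ∈ lowInv F q (d + 1))
    (hge : ∃ f : MvPolynomial (Var q) F, jordanAut F 0 f = f ∧ f ∉ lowInv F q d) :
    IsNoetherNumber ρ d := by
  refine ⟨(generatedInDegreeLE_iff b hb d).mpr hle, fun e he => ?_⟩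
  by_contra hlt
  obtain ⟨f, hf, hf'⟩ := hge
  refine hf' (Algebra.adjoin_mono ?_ ((generatedInDegreeLE_iff b hb e).mp he f hf))
  rintro g ⟨n, hn, hg⟩
  exact ⟨n, by omega, hg⟩

end Transport

end CyclicInvariants

end

/-- `Z/p` is `Multiplicative (ZMod p)`, the module `W` is a representation `ρ`, the fixed space
`W^{Z/p}` is `ρ.invariants`, and `V_n` is `jordanRep F p n _`, which exists for `n ≤ p`. -/
theorem proposition1p1 {p : ℕ} [Fact p.Prime] {F : Type*} [Field F] [CharP F p]
    {W : Type*} [AddCommGroup W] [Module F W] [FiniteDimensional F W]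
    (ρ : Representation F (Multiplicative (ZMod p)) W)
    (hred : CyclicInvariants.IsReduced ρ) :
    (∀ (n : ℕ) (hn : n ≤ p), 3 < n →
      CyclicInvariants.HasSummand ρ (CyclicInvariants.jordanRep F p n hn) →
      CyclicInvariants.IsNoetherNumber ρ
        ((p - 1) * Module.finrank F ρ.invariants + (p - 2))) ∧
    (∀ (m l : ℕ) (h2 : 2 ≤ p) (h3 : 3 ≤ p), 0 < l →
      Nonempty (ρ.Equiv
        ((Representation.directSum fun _ : Fin m => CyclicInvariants.jordanRep F p 2 h2).prod
          (Representation.directSum fun _ : Fin l => CyclicInvariants.jordanRep F p 3 h3))) →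
      CyclicInvariants.IsNoetherNumber ρ
        ((p - 1) * Module.finrank F ρ.invariants + 1)) := by
  have hp : p.Prime := Fact.out
  have : NeZero p := ⟨hp.ne_zero⟩
  obtain ⟨ι, _, q, b, hb⟩ :=
    CyclicInvariants.exists_jordan_basis _ (CyclicInvariants.dualOp_pow_char ρ)
  have hq : ∀ i, q i < p := (CyclicInvariants.pow_eq_zero_iff_of_jordan_basis hb p).mp
    (CyclicInvariants.dualOp_pow_char ρ)
  have hq1 : ∀ i, 1 ≤ q i := CyclicInvariants.one_le_of_isReduced hred hb
  rw [CyclicInvariants.finrank_invariants, CyclicInvariants.finrank_ker_of_jordan_basis hb]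
  constructor
  · intro n hn h3 hsum
    -- a summand of dimension at least four forces a block of at least four variables
    obtain ⟨i, hi⟩ : ∃ i, 3 ≤ q i := by
      by_contra hcon
      push Not at hcon
      have h := (CyclicInvariants.pow_eq_zero_iff_of_jordan_basis hb 3).mpr hcon
      rw [CyclicInvariants.dualOp_pow_eq_zero_iff] at h
      exact absurd (CyclicInvariants.le_of_hasSummand_jordanRep hn hsum h) (by omega)
    have : Nonempty ι := ⟨i⟩
    -- the bound `(p - 1) k + t` for decomposable degrees is used with `t = p - 1`
    refine CyclicInvariants.isNoetherNumber_of_lowInv b hb (fun f hf => ?_)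
      (CyclicInvariants.exists_fixed_notMem_lowInv_of_three_le hq hq1 hi)
    have h := CyclicInvariants.fixed_mem_lowInv hq (t := p - 1) (by omega)
      (CyclicInvariants.prod_X_mem_hilbertIdeal hq) hf
    rwa [show (p - 1) * Fintype.card ι + (p - 2) + 1 = (p - 1) * Fintype.card ι + (p - 1) by omega]
  · rintro m l h2 h3 hl ⟨φ⟩
    obtain ⟨hz, hnz⟩ := CyclicInvariants.sub_one_pow_of_equiv_sum h2 h3 hl φ
    rw [← CyclicInvariants.dualOp_pow_eq_zero_iff,
      CyclicInvariants.pow_eq_zero_iff_of_jordan_basis hb] at hz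
    rw [Ne, ← CyclicInvariants.dualOp_pow_eq_zero_iff,
      CyclicInvariants.pow_eq_zero_iff_of_jordan_basis hb] at hnz
    push Not at hnz
    obtain ⟨i, hi⟩ := hnz
    have : Nonempty ι := ⟨i⟩
    -- the bound `(p - 1) k + t` for decomposable degrees is used with `t = 2`
    refine CyclicInvariants.isNoetherNumber_of_lowInv b hb (fun f hf => ?_)
      (CyclicInvariants.exists_fixed_notMem_lowInv_of_eq_two hq hq1 (i₀ := i)
        (le_antisymm (Nat.lt_succ_iff.mp (hz i)) hi))
    exact CyclicInvariants.fixed_mem_lowInv hq le_rfl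
      (CyclicInvariants.prod_X_mem_hilbertIdeal_of_le_two fun i => Nat.lt_succ_iff.mp (hz i)) hf
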